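/- **Setting.** Let $I\subseteq\mathbb R$ and $J_1,J_2,J_3\subseteq\mathbb R$ be non-empty open intervals and $\Omega=I\times J_1\times J_2\times J_3$ with coordinates $(t,x,y,z)$. All scale factors, lapse functions and potentials are smooth, and lapse and scale factors vanish nowhere. For a metric $g$ on $\Omega$ consider the Klein-Gordon equation $\Delta u-V(t,x,y,z)u=0$, with $\Delta u=g^{\mu\nu}(u_{,\mu\nu}-\Gamma^{\kappa}_{\mu\nu}u_{,\kappa})$, and its Lagrangian $L=\tfrac12\sqrt{|g|}\,(g^{\mu\nu}u_{,\mu}u_{,\nu}+Vu^2)$. A Lie point symmetry is a smooth vector field $X=\xi^\mu(x,u)\partial_\mu+\eta(x,u)\partial_u$ on $\Omega\times\mathbb R$ whose second prolongation annihilates the equation on the equation manifold in the second jet space. It is a Noether point symmetry if moreover $X^{[1]}L+LD_\mu\xi^\mu=D_\mu A^\mu$ for some smooth $A^\mu(x,u)$. It is trivial if it equals $(a_0u+b(x))\partial_u$ with $a_0$ constant and $b$ a solution. Below $U$ denotes an arbitrary real function of three variables (a different one in each formula), and every "if and only if" holds both for "Lie point symmetry" and for "Noether point symmetry". **(A) General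 Bianchi I line element** $ds^2=-N^2(t)dt^2+A^2(t)dx^2+B^2(t)dy^2+C^2(t)dz^2$. - (i) $\partial_x$ is a symmetry iff $V=U(t,y,z)$; (ii) $\partial_y$ is a symmetry iff $V=U(t,x,z)$; (iii) $\partial_z$ is a symmetry iff $V=U(t,x,y)$. - (iv) For $\alpha\ne0$, $\alpha\partial_x+\beta\partial_y+\gamma\partial_z$ is a symmetry iff $V=U\left(t,\,y-\tfrac{\beta}{\alpha}x,\,z-\tfrac{\gamma}{\alpha}x\right)$. - (Completeness) Suppose that no two of $A,B,C$ are proportional (the spacetime is not locally rotationally symmetric) and that the Weyl tensor does not vanish identically on $\Omega$ (the spacetime is not conformally flat). Then the equation admits a non-trivial symmetry if and only if one of the following holds: $V$ is of the form (iv) with some $\alpha\neq 0$, after a relabelling of the spatial axes; or there are coordinates $t'=\tau(t)$ ($\tau$ smooth, $\tau'\neq0$), $x'_i=k_ix_{\sigma(i)}$ ($k_i\ne0$ constants, $\sigma$ a permutation of the axes) in which the line element is that of (B) and $V$ is of the form (vi) with $c\neq0$, $\alpha_1\ne0$; or there are such coordinates, with $t'>0$, in which the line element is that of (C) and $V$ is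 of the form (viii) with $\alpha_1,\alpha_2\neq0$. **(B) Line element** $ds^2=C^2(t)\left[-dt^2+e^{-2t/c}dx^2+e^{-2\alpha_1t/c}dy^2+dz^2\right]$, $c\neq0$. The field $X_1=c\partial_t+x\partial_x+\alpha_1y\partial_y$ is a conformal Killing vector with factor $\psi_1=c(\ln|C|)_{,t}$. - (v) $X_1-\psi_1u\partial_u$ is a symmetry iff $$V=\frac{cC_{,tt}-(\alpha_1+1)C_{,t}}{cC^3}+\frac1{C^2}U\left(xe^{-t/c},\,ye^{-\alpha_1t/c},\,z\right).$$ - (vi) If $\alpha_1\neq0$, then $X_1+\alpha\partial_x+\beta\partial_y+\gamma\partial_z-\psi_1u\partial_u$ is a symmetry iff $$V=\frac{cC_{,tt}-(\alpha_1+1)C_{,t}}{cC^3}+\frac1{C^2}U\left((x+\alpha)e^{-t/c},\,\left(y+\tfrac{\beta}{\alpha_1}\right)e^{-\alpha_1t/c},\,z-\tfrac{\gamma}{c}t\right).$$ - If $\alpha_1\notin\{0,1\}$, the equation admits a non-trivial symmetry iff $V$ is of the form (iv) with some $\alpha\neq 0$, after a relabelling of the spatial axes, or of the form (vi) for some $\alpha,\beta,\gamma$.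 **(C) Line element** $ds^2=C^2(t)\left[-dt^2+t^{2(\alpha_2-1)/\alpha_2}dx^2+t^{2(\alpha_2-\alpha_1)/\alpha_2}dy^2+dz^2\right]$, $t>0$ on $I$, $\alpha_2\ne0$. The field $X_2=\alpha_2t\partial_t+x\partial_x+\alpha_1y\partial_y+\alpha_2z\partial_z$ is a conformal Killing vector with factor $\psi_2=\alpha_2[1+t(\ln|C|)_{,t}]$. Put $$F(t)=\frac{\alpha_2t^2C_{,tt}+(2\alpha_2-\alpha_1-1)\,tC_{,t}}{\alpha_2C}.$$ - (vii) $X_2-\psi_2u\partial_u$ is a symmetry iff $$V=\frac1{t^2C^2}\left(U\left(xt^{-1/\alpha_2},\,yt^{-\alpha_1/\alpha_2},\,\tfrac zt\right)+F(t)\right).$$ - (viii) If $\alpha_1\neq0$, then $X_2+\alpha\partial_x+\beta\partial_y+\gamma\partial_z-\psi_2u\partial_u$ is a symmetry iff $$V=\frac1{t^2C^2}\left(U\left((x+\alpha)t^{-1/\alpha_2},\,\left(y+\tfrac{\beta}{\alpha_1}\right)t^{-\alpha_1/\alpha_2},\,\left(z+\tfrac{\gamma}{\alpha_2}\right)t^{-1}\right)+F(t)\right).$$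 - If $\alpha_1\notin\{0,1\}$, $\alpha_2\neq1$ and $\alpha_1\ne\alpha_2$, the equation admits a non-trivial symmetry iff $V$ is of the form (iv) with some $\alpha\neq 0$, after a relabelling of the spatial axes, or of the form (viii) for some $\alpha,\beta,\gamma$. -/

import Mathlib

open scoped ContDiff

noncomputable section

namespace KleinGordon

/-! ## Coordinate geometry on open subsets of `ℝⁿ` -/

/-- The coordinate space `ℝⁿ` of independent variables `x = (x^μ)`. -/
abbrev Pt (n : ℕ) : Type := Fin n → ℝ

/-- The components `g_{μν}(x)` of a metric tensor. -/
abbrev MetricField (n : ℕ) : Type := Pt n → Matrix (Fin n) (Fin n) ℝ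

variable {n : ℕ}

/-- The partial derivative `∂f/∂x^μ`. -/
def pd (μ : Fin n) (f : Pt n → ℝ) (x : Pt n) : ℝ := fderiv ℝ f x (Pi.single μ 1)

/-- Christoffel symbols `Γ^κ_{μν}` of the Levi-Civita connection. -/
def christoffel (g : MetricField n) (κ μ ν : Fin n) (x : Pt n) : ℝ :=
  (1 / 2) * ∑ l, (g x)⁻¹ κ l *
    (pd μ (fun y => g y l ν) x + pd ν (fun y => g y l μ) x - pd l (fun y => g y μ ν) x)

/-- Riemann tensor
`R^κ_{λμν} = ∂_μ Γ^κ_{νλ} - ∂_ν Γ^κ_{μλ} + Γ^κ_{μρ} Γ^ρ_{νλ} - Γ^κ_{νρ} Γ^ρ_{μλ}`. -/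
def riemann (g : MetricField n) (κ l μ ν : Fin n) (x : Pt n) : ℝ :=
  pd μ (christoffel g κ ν l) x - pd ν (christoffel g κ μ l) x
    + ∑ ρ, (christoffel g κ μ ρ x * christoffel g ρ ν l x
      - christoffel g κ ν ρ x * christoffel g ρ μ l x)

/-- Riemann tensor with all indices down, `R_{κλμν}`. -/
def riemannLow (g : MetricField n) (κ l μ ν : Fin n) (x : Pt n) : ℝ :=
  ∑ ρ, g x κ ρ * riemann g ρ l μ ν x

/-- Ricci tensor `R_{λν} = R^κ_{λκν}`. -/
def ricci (g : MetricField n) (l ν : Fin n) (x : Pt n) : ℝ := ∑ κ, riemann g κ l κ ν x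

/-- Scalar curvature. -/
def scalarCurv (g : MetricField n) (x : Pt n) : ℝ :=
  ∑ μ, ∑ ν, (g x)⁻¹ μ ν * ricci g μ ν x

/-- Weyl tensor `C_{κλμν}` in dimension four. -/
def weyl (g : MetricField 4) (κ l μ ν : Fin 4) (x : Pt 4) : ℝ :=
  riemannLow g κ l μ ν x
    - (1 / 2) * (g x κ μ * ricci g l ν x - g x κ ν * ricci g l μ x
        - g x l μ * ricci g κ ν x + g x l ν * ricci g κ μ x)
    + (scalarCurv g x / 6) * (g x κ μ * g x l ν - g x κ ν * g x l μ)

/-- A four-dimensional metric is (locally) conformally flat on `Ω` when its Weyl tensor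
vanishes there. -/
def ConformallyFlatOn (g : MetricField 4) (Ω : Set (Pt 4)) : Prop :=
  ∀ x ∈ Ω, ∀ κ l μ ν, weyl g κ l μ ν x = 0

/-- `ξ` is a conformal Killing vector with conformal factor `ψ`:
`L_ξ g_{μν} = ξ^κ ∂_κ g_{μν} + g_{κν} ∂_μ ξ^κ + g_{μκ} ∂_ν ξ^κ = 2 ψ g_{μν}`. -/
def IsCKVOn (g : MetricField n) (Ω : Set (Pt n)) (ξ : Pt n → Pt n) (ψ : Pt n → ℝ) : Prop :=
  ∀ x ∈ Ω, ∀ μ ν,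
    ∑ κ, (ξ x κ * pd κ (fun y => g y μ ν) x + g x κ ν * pd μ (fun y => ξ y κ) x
      + g x μ κ * pd ν (fun y => ξ y κ) x) = 2 * ψ x * g x μ ν

/-! ## Jets, prolongations, Lie and Noether point symmetries -/

/-- First jets `(x, u, u_μ)`. -/
abbrev Jet1 (n : ℕ) : Type := Pt n × ℝ × Pt n

/-- Second jets `(x, u, u_μ, u_{μν})`; only those with symmetric `u_{μν}` are used. -/
abbrev Jet2 (n : ℕ) : Type := Pt n × ℝ × Pt n × (Fin n → Fin n → ℝ)

/-- A vector field `ξ^μ(x,u) ∂_μ + η(x,u) ∂_u` on the space of variables `(x, u)`. -/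
structure PointField (n : ℕ) where
  ξ : Pt n × ℝ → Pt n
  η : Pt n × ℝ → ℝ

/-- The total derivative `D_μ F = F_{,μ} + u_μ F_{,u}` of a function `F(x,u)`. -/
def totalD (F : Pt n × ℝ → ℝ) (μ : Fin n) (x : Pt n) (u : ℝ) (p : Pt n) : ℝ :=
  fderiv ℝ F (x, u) (Pi.single μ 1, p μ)

/-- The total derivative `D_ν F = F_{,ν} + u_ν F_{,u} + u_{νκ} ∂F/∂u_κ` of a function
`F(x,u,u_κ)`. -/
def totalD1 (F : Jet1 n → ℝ) (ν : Fin n) (x : Pt n) (u : ℝ) (p : Pt n)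
    (q : Fin n → Fin n → ℝ) : ℝ :=
  fderiv ℝ F (x, u, p) (Pi.single ν 1, p ν, q ν)

/-- First prolongation coefficients `η_μ = D_μ η - (D_μ ξ^κ) u_κ`. -/
def prolong1 (X : PointField n) (j : Jet1 n) (μ : Fin n) : ℝ :=
  totalD X.η μ j.1 j.2.1 j.2.2
    - ∑ κ, totalD (fun y => X.ξ y κ) μ j.1 j.2.1 j.2.2 * j.2.2 κ

/-- Second prolongation coefficients `η_{μν} = D_ν η_μ - (D_ν ξ^κ) u_{μκ}`. -/
def prolong2 (X : PointField n) (x : Pt n) (u : ℝ) (p : Pt n) (q : Fin n → Fin n → ℝ)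
    (μ ν : Fin n) : ℝ :=
  totalD1 (fun j => prolong1 X j μ) ν x u p q
    - ∑ κ, totalD (fun y => X.ξ y κ) ν x u p * q μ κ

/-- The Klein-Gordon equation `Δu - V u = 0` as a function on second jets:
`H = g^{μν} u_{μν} - g^{νκ} Γ^μ_{νκ} u_μ - V u`. -/
def kgH (g : MetricField n) (V : Pt n → ℝ) (j : Jet2 n) : ℝ :=
  (∑ μ, ∑ ν, (g j.1)⁻¹ μ ν * j.2.2.2 μ ν)
    - (∑ μ, (∑ ν, ∑ κ, (g j.1)⁻¹ ν κ * christoffel g μ ν κ j.1) * j.2.2.1 μ)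
    - V j.1 * j.2.1

/-- `b` is a solution on `Ω` of the Klein-Gordon equation. -/
def IsKGSolutionOn (g : MetricField n) (V : Pt n → ℝ) (Ω : Set (Pt n)) (b : Pt n → ℝ) : Prop :=
  ContDiffOn ℝ ∞ b Ω ∧
    ∀ x ∈ Ω, kgH g V (x, b x, fun μ => pd μ b x, fun μ ν => pd ν (pd μ b) x) = 0

/-- The Klein-Gordon Lagrangian
`L = ½ √|g| g^{μν} u_μ u_ν + ½ √|g| V u²`. -/
def kgL (g : MetricField n) (V : Pt n → ℝ) (j : Jet1 n) : ℝ :=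
  (1 / 2) * Real.sqrt |(g j.1).det| * (∑ μ, ∑ ν, (g j.1)⁻¹ μ ν * j.2.2 μ * j.2.2 ν)
    + (1 / 2) * Real.sqrt |(g j.1).det| * V j.1 * j.2.1 ^ 2

/-- `X` is a smooth vector field on `Ω × ℝ`. -/
def PointField.SmoothOn (X : PointField n) (Ω : Set (Pt n)) : Prop :=
  ContDiffOn ℝ ∞ X.ξ (Ω ×ˢ Set.univ) ∧ ContDiffOn ℝ ∞ X.η (Ω ×ˢ Set.univ)

/-- `X` is a Lie point symmetry on `Ω` of the Klein-Gordon equation `H = 0`: the second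
prolongation of `X` annihilates `H` on the hypersurface `H = 0` of the second jet space. -/
def IsLieSymmetry (g : MetricField n) (V : Pt n → ℝ) (Ω : Set (Pt n)) (X : PointField n) :
    Prop :=
  X.SmoothOn Ω ∧
    ∀ x ∈ Ω, ∀ (u : ℝ) (p : Pt n) (q : Fin n → Fin n → ℝ), (∀ μ ν, q μ ν = q ν μ) →
      kgH g V (x, u, p, q) = 0 →
        fderiv ℝ (kgH g V) (x, u, p, q)
          (X.ξ (x, u), X.η (x, u), prolong1 X (x, u, p), prolong2 X x u p q) = 0

/-- `X` is a Noether point symmetry on `Ω` of the Klein-Gordon equation: a Lie point symmetry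
with `X^{[1]} L + L D_μ ξ^μ = D_μ A^μ` for some smooth `A^μ(x,u)`. -/
def IsNoetherSymmetry (g : MetricField n) (V : Pt n → ℝ) (Ω : Set (Pt n)) (X : PointField n) :
    Prop :=
  IsLieSymmetry g V Ω X ∧
    ∃ A : Pt n × ℝ → Pt n, ContDiffOn ℝ ∞ A (Ω ×ˢ Set.univ) ∧
      ∀ x ∈ Ω, ∀ (u : ℝ) (p : Pt n),
        fderiv ℝ (kgL g V) (x, u, p) (X.ξ (x, u), X.η (x, u), prolong1 X (x, u, p))
          + kgL g V (x, u, p) * ∑ μ, totalD (fun y => X.ξ y μ) μ x u p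
        = ∑ μ, totalD (fun y => A y μ) μ x u p

/-- The trivial symmetries `(a₀ u + b(x)) ∂_u` with `a₀` constant and `b` a solution. -/
def IsTrivialOn (g : MetricField n) (V : Pt n → ℝ) (Ω : Set (Pt n)) (X : PointField n) : Prop :=
  (∀ x ∈ Ω, ∀ u : ℝ, X.ξ (x, u) = 0) ∧
    ∃ (a₀ : ℝ) (b : Pt n → ℝ), IsKGSolutionOn g V Ω b ∧
      ∀ x ∈ Ω, ∀ u : ℝ, X.η (x, u) = a₀ * u + b x

/-- The Klein-Gordon equation admits a non-trivial Lie point symmetry on `Ω`. -/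
def AdmitsLie (g : MetricField n) (V : Pt n → ℝ) (Ω : Set (Pt n)) : Prop :=
  ∃ X : PointField n, IsLieSymmetry g V Ω X ∧ ¬ IsTrivialOn g V Ω X

/-- The Klein-Gordon equation admits a non-trivial Noether point symmetry on `Ω`. -/
def AdmitsNoether (g : MetricField n) (V : Pt n → ℝ) (Ω : Set (Pt n)) : Prop :=
  ∃ X : PointField n, IsNoetherSymmetry g V Ω X ∧ ¬ IsTrivialOn g V Ω X

/-- The field `ξ^μ(x) ∂_μ - ψ(x) u ∂_u` (in dimension four `(2-n)/2 = -1`). -/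
def conformalLift (ξ : Pt n → Pt n) (ψ : Pt n → ℝ) : PointField n where
  ξ := fun y => ξ y.1
  η := fun y => -(ψ y.1) * y.2

/-! ## Bianchi I spacetimes, coordinates `(t, x, y, z) = (p 0, p 1, p 2, p 3)` -/

/-- The coordinate box `I × J₀ × J₁ × J₂`. -/
def box (I : Set ℝ) (J : Fin 3 → Set ℝ) : Set (Pt 4) :=
  {p | p 0 ∈ I ∧ ∀ i : Fin 3, p i.succ ∈ J i}

/-- `ds² = -N² dt² + a₀² dx² + a₁² dy² + a₂² dz²`. -/
def bianchiI (N : ℝ → ℝ) (a : Fin 3 → ℝ → ℝ) : MetricField 4 := fun p =>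
  Matrix.diagonal (Fin.cons (-(N (p 0)) ^ 2) (fun i => (a i (p 0)) ^ 2))

/-- Smooth and nowhere zero on `I`. -/
def IsScaleFactorOn (I : Set ℝ) (f : ℝ → ℝ) : Prop :=
  ContDiffOn ℝ ∞ f I ∧ ∀ t ∈ I, f t ≠ 0

/-- Two of the three scale factors are proportional (locally rotationally symmetric case). -/
def IsLRSOn (I : Set ℝ) (a : Fin 3 → ℝ → ℝ) : Prop :=
  ∃ i j : Fin 3, i ≠ j ∧ ∃ k : ℝ, ∀ t ∈ I, a i t = k * a j t

/-- Scale factors of `ds² = C² [-dt² + e^{-2t/c} dx² + e^{-2α₁t/c} dy² + dz²]` (lapse `C`). -/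
def expFactors (C : ℝ → ℝ) (c α₁ : ℝ) : Fin 3 → ℝ → ℝ :=
  ![fun t => C t * Real.exp (-t / c), fun t => C t * Real.exp (-(α₁ * t) / c), C]

/-- Scale factors of
`ds² = C² [-dt² + t^{2(α₂-1)/α₂} dx² + t^{2(α₂-α₁)/α₂} dy² + dz²]` (lapse `C`, `t > 0`). -/
def powFactors (C : ℝ → ℝ) (α₁ α₂ : ℝ) : Fin 3 → ℝ → ℝ :=
  ![fun t => C t * t ^ ((α₂ - 1) / α₂), fun t => C t * t ^ ((α₂ - α₁) / α₂), C]

/-- `α ∂_x + β ∂_y + γ ∂_z`. -/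
def transl (α β γ : ℝ) : Pt 4 → Pt 4 := fun _ => ![0, α, β, γ]

/-- `X₁ = c ∂_t + x ∂_x + α₁ y ∂_y`. -/
def X₁ (c α₁ : ℝ) : Pt 4 → Pt 4 := fun p => ![c, p 1, α₁ * p 2, 0]

/-- `ψ(X₁) = c (ln|C|)_{,t}`. -/
def ψ₁ (C : ℝ → ℝ) (c : ℝ) : Pt 4 → ℝ := fun p =>
  c * deriv (fun s => Real.log |C s|) (p 0)

/-- `X₂ = α₂ t ∂_t + x ∂_x + α₁ y ∂_y + α₂ z ∂_z`. -/
def X₂ (α₁ α₂ : ℝ) : Pt 4 → Pt 4 := fun p => ![α₂ * p 0, p 1, α₁ * p 2, α₂ * p 3]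

/-- `ψ(X₂) = α₂ [1 + t (ln|C|)_{,t}]`. -/
def ψ₂ (C : ℝ → ℝ) (α₂ : ℝ) : Pt 4 → ℝ := fun p =>
  α₂ * (1 + p 0 * deriv (fun s => Real.log |C s|) (p 0))

/-! ## The potentials -/

/-- `U(t, y - (β/α) x, z - (γ/α) x)`. -/
def potIV (α β γ : ℝ) (U : ℝ → ℝ → ℝ → ℝ) : Pt 4 → ℝ := fun p =>
  U (p 0) (p 2 - β / α * p 1) (p 3 - γ / α * p 1)

/-- `(c C_{,tt} - (α₁+1) C_{,t}) / (c C³) + C⁻² U(x e^{-t/c}, y e^{-α₁t/c}, z)`. -/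
def potV (C : ℝ → ℝ) (c α₁ : ℝ) (U : ℝ → ℝ → ℝ → ℝ) : Pt 4 → ℝ := fun p =>
  (c * deriv (deriv C) (p 0) - (α₁ + 1) * deriv C (p 0)) / (c * C (p 0) ^ 3)
    + 1 / C (p 0) ^ 2 *
      U (p 1 * Real.exp (-(p 0) / c)) (p 2 * Real.exp (-(α₁ * p 0) / c)) (p 3)

/-- `(c C_{,tt} - (α₁+1) C_{,t}) / (c C³)
+ C⁻² U((x+α) e^{-t/c}, (y+β/α₁) e^{-α₁t/c}, z - (γ/c) t)`. -/
def potVI (C : ℝ → ℝ) (c α₁ α β γ : ℝ) (U : ℝ → ℝ → ℝ → ℝ) : Pt 4 → ℝ := fun p =>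
  (c * deriv (deriv C) (p 0) - (α₁ + 1) * deriv C (p 0)) / (c * C (p 0) ^ 3)
    + 1 / C (p 0) ^ 2 *
      U ((p 1 + α) * Real.exp (-(p 0) / c)) ((p 2 + β / α₁) * Real.exp (-(α₁ * p 0) / c))
        (p 3 - γ / c * p 0)

/-- `F = (α₂ t² C_{,tt} + (2α₂ - α₁ - 1) t C_{,t}) / (α₂ C)`. -/
def potF (C : ℝ → ℝ) (α₁ α₂ t : ℝ) : ℝ :=
  (α₂ * t ^ 2 * deriv (deriv C) t + (2 * α₂ - α₁ - 1) * t * deriv C t) / (α₂ * C t)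

/-- `(t C)⁻² (U(x t^{-1/α₂}, y t^{-α₁/α₂}, z/t) + F(t))`. -/
def potVII (C : ℝ → ℝ) (α₁ α₂ : ℝ) (U : ℝ → ℝ → ℝ → ℝ) : Pt 4 → ℝ := fun p =>
  1 / (p 0 ^ 2 * C (p 0) ^ 2) *
    (U (p 1 * p 0 ^ (-1 / α₂)) (p 2 * p 0 ^ (-α₁ / α₂)) (p 3 / p 0) + potF C α₁ α₂ (p 0))

/-- `(t C)⁻² (U((x+α) t^{-1/α₂}, (y+β/α₁) t^{-α₁/α₂}, (z+γ/α₂)/t) + F(t))`. -/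
def potVIII (C : ℝ → ℝ) (α₁ α₂ α β γ : ℝ) (U : ℝ → ℝ → ℝ → ℝ) : Pt 4 → ℝ := fun p =>
  1 / (p 0 ^ 2 * C (p 0) ^ 2) *
    (U ((p 1 + α) * p 0 ^ (-1 / α₂)) ((p 2 + β / α₁) * p 0 ^ (-α₁ / α₂))
        ((p 3 + γ / α₂) / p 0)
      + potF C α₁ α₂ (p 0))

/-! ## Changes of coordinates that preserve the Bianchi I form -/

/-- `(t, x_i) ↦ (τ(t), k_i x_{σ(i)})`: a new time, and relabelled and rescaled spatial axes. -/
def adapt (τ : ℝ → ℝ) (k : Fin 3 → ℝ) (σ : Equiv.Perm (Fin 3)) : Pt 4 → Pt 4 := fun p =>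
  Fin.cons (τ (p 0)) (fun i => k i * p (σ i).succ)

/-- `adapt τ k σ` is a smooth change of coordinates over `I` under which the line element with
lapse `N'` and scale factors `a'` becomes the one with lapse `N` and scale factors `a`. -/
def IsAdapted (I : Set ℝ) (N : ℝ → ℝ) (a : Fin 3 → ℝ → ℝ) (N' : ℝ → ℝ) (a' : Fin 3 → ℝ → ℝ)
    (τ : ℝ → ℝ) (k : Fin 3 → ℝ) (σ : Equiv.Perm (Fin 3)) : Prop :=
  ContDiffOn ℝ ∞ τ I ∧ (∀ t ∈ I, deriv τ t ≠ 0) ∧ (∀ i, k i ≠ 0) ∧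
    ∀ t ∈ I, (N t) ^ 2 = (N' (τ t) * deriv τ t) ^ 2 ∧
      ∀ i, (a (σ i) t) ^ 2 = (k i * a' i (τ t)) ^ 2

/-- Translation-invariant potentials: `V` is of the form `potIV` with some `α ≠ 0`, after a
relabelling of the spatial axes. -/
def IsTranslationForm (V : Pt 4 → ℝ) (Ω : Set (Pt 4)) : Prop :=
  ∃ (σ : Equiv.Perm (Fin 3)) (α β γ : ℝ) (U : ℝ → ℝ → ℝ → ℝ), α ≠ 0 ∧
    ∀ p ∈ Ω, V p = potIV α β γ U (adapt id 1 σ p)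

/-- In suitable coordinates the line element is that of `expFactors` and the potential is
`potVI`. -/
def IsExpForm (I : Set ℝ) (N : ℝ → ℝ) (a : Fin 3 → ℝ → ℝ) (V : Pt 4 → ℝ) (Ω : Set (Pt 4)) :
    Prop :=
  ∃ (τ : ℝ → ℝ) (k : Fin 3 → ℝ) (σ : Equiv.Perm (Fin 3)) (C : ℝ → ℝ) (c α₁ α β γ : ℝ)
    (U : ℝ → ℝ → ℝ → ℝ), c ≠ 0 ∧ α₁ ≠ 0 ∧ IsScaleFactorOn (τ '' I) C ∧
      IsAdapted I N a C (expFactors C c α₁) τ k σ ∧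
      ∀ p ∈ Ω, V p = potVI C c α₁ α β γ U (adapt τ k σ p)

/-- In suitable coordinates the line element is that of `powFactors` and the potential is
`potVIII`. -/
def IsPowForm (I : Set ℝ) (N : ℝ → ℝ) (a : Fin 3 → ℝ → ℝ) (V : Pt 4 → ℝ) (Ω : Set (Pt 4)) :
    Prop :=
  ∃ (τ : ℝ → ℝ) (k : Fin 3 → ℝ) (σ : Equiv.Perm (Fin 3)) (C : ℝ → ℝ) (α₁ α₂ α β γ : ℝ)
    (U : ℝ → ℝ → ℝ → ℝ), α₁ ≠ 0 ∧ α₂ ≠ 0 ∧ (∀ t ∈ I, 0 < τ t) ∧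
      IsScaleFactorOn (τ '' I) C ∧ IsAdapted I N a C (powFactors C α₁ α₂) τ k σ ∧
      ∀ p ∈ Ω, V p = potVIII C α₁ α₂ α β γ U (adapt τ k σ p)

/-- `X` is a Lie point symmetry exactly when `P` holds, and a Noether point symmetry exactly
when `P` holds. -/
def SymmetryIff (g : MetricField n) (V : Pt n → ℝ) (Ω : Set (Pt n)) (X : PointField n)
    (P : Prop) : Prop :=
  (IsLieSymmetry g V Ω X ↔ P) ∧ (IsNoetherSymmetry g V Ω X ↔ P)

/-- A non-trivial Lie point symmetry exists exactly when `P` holds, and a non-trivial Noether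
point symmetry exists exactly when `P` holds. -/
def AdmitsIff (g : MetricField n) (V : Pt n → ℝ) (Ω : Set (Pt n)) (P : Prop) : Prop :=
  (AdmitsLie g V Ω ↔ P) ∧ (AdmitsNoether g V Ω ↔ P)

end KleinGordon

end

namespace KleinGordon

variable {n : ℕ}

/-! The metric is diagonal and depends on time only, so at a fixed first jet the Lie condition is an
affine function of the symmetric matrix `q` of second derivatives that must vanish on an affine
hyperplane. Such a function is a multiple of the equation of the hyperplane
(`affine_on_hyperplane_iff`). Comparing different values of `p` shows that ξ does not depend on `u`
and that η is affine in `u`, so X = ζ(x)∂ + (α(x)u + b(x))∂_u. What remains says that ζ is a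
conformal Killing field, with some factor ψ, together with an equation in `(u, p)`. When ζ is a
dilation or a translation, that equation splits: α + ψ is constant, `b` is a solution, and ζ(V) +
2ψV + Δψ = 0 (`PotentialEq`). Conversely, the last equation makes ζ∂ − ψu∂_u a Noether symmetry with
gauge vector −½√|g| g^{μν}ψ_{,ν}u². Hence Lie and Noether point symmetries obey the same criterion
(`symmetryIff_dilation`).

The conformal Killing fields are found from the metric divided by its lapse. For G = ∂_iT, with T
the time component, each axis j ≠ i gives a linear second-order equation in time
(`IsConformalField.integrability`). The equations of the two such axes differ only by a multiple of
G, whose coefficient is a difference of Weyl eigenvalues (`weylGap`). These differences sum to zero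
cyclically, so where the Weyl tensor is nonzero two of them are nonzero. Two spatial derivatives of
T then vanish on a slab of times, hence everywhere by uniqueness for the linear equation. Since no
two scale factors are proportional, the third derivative vanishes too and the spatial components
decouple. The field is therefore T(t)∂_t + Σ(l_i x_i + m_i)∂_i (`exists_affField`).

For such a field with T ≠ 0 the equation of the potential is a linear first-order equation: there
are M and R for which MV − R is constant along the flow, whose orbits are the common level sets of
E_i x_i + F_i. This gives the stated forms of V in both models. For completeness, (TN/a_i)' = l_i
N/a_i shows that T either vanishes identically (a translation) or vanishes nowhere. If T vanishes
nowhere and some l_i = 0, then TN/a_i is constant and a logarithmic time gives line element (B). If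
no l_i vanishes, a multiple of TN/a_2 is itself the time of line element (C). -/

lemma isOpen_box {I : Set ℝ} {J : Fin 3 → Set ℝ} (hI : IsOpen I) (hJ : ∀ i, IsOpen (J i)) :
    IsOpen (box I J) := by
  have : box I J = (fun p : Pt 4 => p 0) ⁻¹' I ∩ ⋂ i : Fin 3, (fun p : Pt 4 => p i.succ) ⁻¹' J i := by
    ext p; simp [box]
  rw [this]
  exact (hI.preimage (continuous_apply _)).inter
    (isOpen_iInter_of_finite fun i => (hJ i).preimage (continuous_apply _))

lemma convex_box {I : Set ℝ} {J : Fin 3 → Set ℝ} (hI : I.OrdConnected)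
    (hJ : ∀ i, (J i).OrdConnected) : Convex ℝ (box I J) := by
  intro p hp q hq s t hs ht hst
  exact ⟨hI.convex hp.1 hq.1 hs ht hst, fun i => (hJ i).convex (hp.2 i) (hq.2 i) hs ht hst⟩

/-! ### Partial derivatives -/

section pd

variable {Ω : Set (Pt n)} {f g : Pt n → ℝ} {x : Pt n}

lemma differentiableAt_of_smooth {E : Type*} [NormedAddCommGroup E] [NormedSpace ℝ E]
    {F : Type*} [NormedAddCommGroup F] [NormedSpace ℝ F] {f : E → F} {s : Set E} {x : E}
    (hs : IsOpen s) (hf : ContDiffOn ℝ ∞ f s) (hx : x ∈ s) : DifferentiableAt ℝ f x :=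
  (hf.contDiffAt (hs.mem_nhds hx)).differentiableAt (by simp)

lemma pd_congr (hΩ : IsOpen Ω) (h : ∀ y ∈ Ω, f y = g y) (hx : x ∈ Ω) (μ : Fin n) :
    pd μ f x = pd μ g x := by
  unfold pd
  rw [Filter.EventuallyEq.fderiv_eq (f₁ := f) (f := g)]
  filter_upwards [hΩ.mem_nhds hx] with y hy using h y hy

lemma smooth_fderiv_apply {E : Type*} [NormedAddCommGroup E] [NormedSpace ℝ E]
    {f : E → ℝ} {s : Set E} (hs : IsOpen s) (hf : ContDiffOn ℝ ∞ f s) (v : E) :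
    ContDiffOn ℝ ∞ (fun x => fderiv ℝ f x v) s :=
  (hf.fderiv_of_isOpen hs (m := ∞) (by simp)).clm_apply contDiffOn_const

lemma smooth_pd (hΩ : IsOpen Ω) (hf : ContDiffOn ℝ ∞ f Ω) (μ : Fin n) :
    ContDiffOn ℝ ∞ (pd μ f) Ω := smooth_fderiv_apply hΩ hf _

lemma pd_comm (hΩ : IsOpen Ω) (hf : ContDiffOn ℝ ∞ f Ω) (hx : x ∈ Ω) (μ ν : Fin n) :
    pd μ (pd ν f) x = pd ν (pd μ f) x := by
  have h := (hf.contDiffAt (hΩ.mem_nhds hx)).isSymmSndFDerivAt (by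
    simpa using (WithTop.coe_le_coe.2 le_top : ((2 : ℕ∞) : WithTop ℕ∞) ≤ ((⊤ : ℕ∞) : WithTop ℕ∞)))
  have hd : DifferentiableAt ℝ (fderiv ℝ f) x :=
    differentiableAt_of_smooth hΩ (hf.fderiv_of_isOpen hΩ (m := ∞) (by simp)) hx
  have key : ∀ v w : Pt n, fderiv ℝ (fun y => fderiv ℝ f y v) x w = fderiv ℝ (fderiv ℝ f) x w v := by
    intro v w
    rw [fderiv_clm_apply hd (differentiableAt_const v)]
    simp
  unfold pd
  rw [key, key]
  exact h.eq _ _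

lemma pd_add (hf : DifferentiableAt ℝ f x) (hg : DifferentiableAt ℝ g x) (μ : Fin n) :
    pd μ (fun y => f y + g y) x = pd μ f x + pd μ g x := by
  unfold pd; rw [fderiv_fun_add hf hg]; rfl

lemma pd_sub (hf : DifferentiableAt ℝ f x) (hg : DifferentiableAt ℝ g x) (μ : Fin n) :
    pd μ (fun y => f y - g y) x = pd μ f x - pd μ g x := by
  unfold pd; rw [fderiv_fun_sub hf hg]; rfl

lemma pd_mul (hf : DifferentiableAt ℝ f x) (hg : DifferentiableAt ℝ g x) (μ : Fin n) :
    pd μ (fun y => f y * g y) x = f x * pd μ g x + pd μ f x * g x := by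
  unfold pd; rw [fderiv_fun_mul hf hg]; simp [mul_comm]

lemma pd_neg (μ : Fin n) : pd μ (fun y => - f y) x = - pd μ f x := by
  unfold pd; rw [fderiv_fun_neg]; rfl

@[simp] lemma pd_const (c : ℝ) (μ : Fin n) : pd μ (fun _ : Pt n => c) x = 0 := by
  unfold pd; simp

lemma fderiv_eq_sum_pd (f : Pt n → ℝ) (x v : Pt n) :
    fderiv ℝ f x v = ∑ μ, v μ * pd μ f x := by
  conv_lhs => rw [pi_eq_sum_univ' v]
  simp [pd, map_sum]

lemma pd_time {f : ℝ → ℝ} {x : Pt 4} (hf : DifferentiableAt ℝ f (x 0)) (μ : Fin 4) :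
    pd μ (fun p : Pt 4 => f (p 0)) x = if μ = 0 then deriv f (x 0) else 0 := by
  have h : HasFDerivAt (fun p : Pt 4 => f (p 0))
      ((deriv f (x 0)) • (ContinuousLinearMap.proj (R := ℝ) (φ := fun _ : Fin 4 => ℝ) 0)) x :=
    hf.hasDerivAt.comp_hasFDerivAt x (hasFDerivAt_apply 0 x)
  unfold pd
  rw [h.fderiv]
  by_cases hμ : μ = 0
  · subst hμ; simp
  · simp [hμ, Ne.symm hμ]

lemma smooth_time {I : Set ℝ} {J : Fin 3 → Set ℝ} {f : ℝ → ℝ} (hf : ContDiffOn ℝ ∞ f I) :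
    ContDiffOn ℝ ∞ (fun p : Pt 4 => f (p 0)) (box I J) :=
  hf.comp (contDiff_apply ℝ ℝ (0 : Fin 4)).contDiffOn fun _ hp => hp.1

/-- A function on a convex open set whose derivative in the direction `v` vanishes is constant
along `v`. -/
lemma eq_of_pd_eq_zero (hΩ : IsOpen Ω) (hc : Convex ℝ Ω) (hf : DifferentiableOn ℝ f Ω)
    {x y : Pt n} (hx : x ∈ Ω) (hy : y ∈ Ω) (h : ∀ z ∈ Ω, fderiv ℝ f z (y - x) = 0) :
    f x = f y := by
  have hseg : ∀ t ∈ Set.Icc (0 : ℝ) 1, x + t • (y - x) ∈ Ω := fun t ht =>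
    hc.add_smul_sub_mem hx hy ht
  have hd : ∀ t ∈ Set.Icc (0 : ℝ) 1,
      HasDerivAt (fun t : ℝ => f (x + t • (y - x))) 0 t := by
    intro t ht
    have h1 := ((hf _ (hseg t ht)).differentiableAt (hΩ.mem_nhds (hseg t ht))).hasFDerivAt
    have h2 : HasDerivAt (fun t : ℝ => x + t • (y - x)) (y - x) t := by
      simpa using ((hasDerivAt_id t).smul_const (y - x)).const_add x
    have := h1.comp_hasDerivAt t h2
    rwa [h _ (hseg t ht)] at this
  have := constant_of_has_deriv_right_zero
    (f := fun t : ℝ => f (x + t • (y - x))) (a := 0) (b := 1)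
    (fun t ht => (hd t ht).continuousAt.continuousWithinAt)
    (fun t ht => (hd t ⟨ht.1, ht.2.le⟩).hasDerivWithinAt) 1 (by simp)
  simpa using this.symm

end pd

/-! ### The Klein-Gordon operator of a Bianchi I line element -/

/-- The diagonal of the inverse metric. -/
noncomputable def invDiag (N : ℝ → ℝ) (a : Fin 3 → ℝ → ℝ) (μ : Fin 4) (t : ℝ) : ℝ :=
  Fin.cases (motive := fun _ => ℝ) (-(1 / N t ^ 2)) (fun i => 1 / a i t ^ 2) μ

/-- Coefficient of `u_t` in the wave operator. -/
noncomputable def dragCoeff (N : ℝ → ℝ) (a : Fin 3 → ℝ → ℝ) (t : ℝ) : ℝ :=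
  1 / N t ^ 2 * (logDeriv (a 0) t + logDeriv (a 1) t + logDeriv (a 2) t - logDeriv N t)

@[simp] lemma invDiag_zero (N : ℝ → ℝ) (a : Fin 3 → ℝ → ℝ) (t : ℝ) :
    invDiag N a 0 t = -(1 / N t ^ 2) := rfl
@[simp] lemma invDiag_succ (N : ℝ → ℝ) (a : Fin 3 → ℝ → ℝ) (i : Fin 3) (t : ℝ) :
    invDiag N a i.succ t = 1 / a i t ^ 2 := rfl

/-- The diagonal of the metric. -/
noncomputable def diagOf (N : ℝ → ℝ) (a : Fin 3 → ℝ → ℝ) (μ : Fin 4) (t : ℝ) : ℝ :=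
  Fin.cases (motive := fun _ => ℝ) (-(N t) ^ 2) (fun i => a i t ^ 2) μ

@[simp] lemma diagOf_zero (N : ℝ → ℝ) (a : Fin 3 → ℝ → ℝ) (t : ℝ) :
    diagOf N a 0 t = -(N t) ^ 2 := rfl
@[simp] lemma diagOf_succ (N : ℝ → ℝ) (a : Fin 3 → ℝ → ℝ) (i : Fin 3) (t : ℝ) :
    diagOf N a i.succ t = a i t ^ 2 := rfl

lemma bianchiI_eq (N : ℝ → ℝ) (a : Fin 3 → ℝ → ℝ) (p : Pt 4) :
    bianchiI N a p = Matrix.diagonal (fun μ => diagOf N a μ (p 0)) := by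
  unfold bianchiI diagOf
  congr 1

/-- Half the logarithmic derivative of the diagonal of the metric. -/
noncomputable def hubble (N : ℝ → ℝ) (a : Fin 3 → ℝ → ℝ) (μ : Fin 4) (t : ℝ) : ℝ :=
  Fin.cases (motive := fun _ => ℝ) (logDeriv N t) (fun i => logDeriv (a i) t) μ

@[simp] lemma hubble_zero (N : ℝ → ℝ) (a : Fin 3 → ℝ → ℝ) (t : ℝ) :
    hubble N a 0 t = logDeriv N t := rfl
@[simp] lemma hubble_succ (N : ℝ → ℝ) (a : Fin 3 → ℝ → ℝ) (i : Fin 3) (t : ℝ) :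
    hubble N a i.succ t = logDeriv (a i) t := rfl

section geometry

variable {I : Set ℝ} {J : Fin 3 → Set ℝ} {N : ℝ → ℝ} {a : Fin 3 → ℝ → ℝ}

lemma IsScaleFactorOn.diff {f : ℝ → ℝ} (hI : IsOpen I) (hf : IsScaleFactorOn I f) {t : ℝ}
    (ht : t ∈ I) : DifferentiableAt ℝ f t := differentiableAt_of_smooth hI hf.1 ht

lemma smooth_deriv {f : ℝ → ℝ} (hI : IsOpen I) (hf : ContDiffOn ℝ ∞ f I) :
    ContDiffOn ℝ ∞ (deriv f) I := hf.deriv_of_isOpen hI (by simp)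

lemma smooth_logDeriv {f : ℝ → ℝ} (hI : IsOpen I) (hf : IsScaleFactorOn I f) :
    ContDiffOn ℝ ∞ (logDeriv f) I := (smooth_deriv hI hf.1).div hf.1 hf.2

lemma diagOf_ne_zero (hN : IsScaleFactorOn I N) (ha : ∀ i, IsScaleFactorOn I (a i)) {t : ℝ}
    (ht : t ∈ I) (μ : Fin 4) : diagOf N a μ t ≠ 0 := by
  refine Fin.cases ?_ (fun i => ?_) μ
  · simpa [diagOf] using hN.2 t ht
  · simpa [diagOf] using (ha i).2 t ht

lemma invDiag_eq_inv (μ : Fin 4) (t : ℝ) : invDiag N a μ t = (diagOf N a μ t)⁻¹ := by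
  refine Fin.cases ?_ (fun i => ?_) μ <;> simp [diagOf, inv_neg]

lemma invDiag_ne_zero (hN : IsScaleFactorOn I N) (ha : ∀ i, IsScaleFactorOn I (a i)) {t : ℝ}
    (ht : t ∈ I) (μ : Fin 4) : invDiag N a μ t ≠ 0 := by
  rw [invDiag_eq_inv]; exact inv_ne_zero (diagOf_ne_zero hN ha ht μ)

lemma hasDerivAt_diagOf (hI : IsOpen I) (hN : IsScaleFactorOn I N)
    (ha : ∀ i, IsScaleFactorOn I (a i)) {t : ℝ} (ht : t ∈ I) (μ : Fin 4) :
    HasDerivAt (diagOf N a μ) (2 * hubble N a μ t * diagOf N a μ t) t := by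
  refine Fin.cases ?_ (fun i => ?_) μ
  · have h := ((hN.diff hI ht).hasDerivAt.pow 2).neg
    have h0 := hN.2 t ht
    refine h.congr_deriv ?_
    simp only [hubble_zero, diagOf_zero, logDeriv_apply]; field_simp; simp; ring
  · have h := (((ha i).diff hI ht).hasDerivAt.pow 2)
    have h0 := (ha i).2 t ht
    refine h.congr_deriv ?_
    simp only [hubble_succ, diagOf_succ, logDeriv_apply]; field_simp; simp; ring

lemma hasDerivAt_invDiag (hI : IsOpen I) (hN : IsScaleFactorOn I N)
    (ha : ∀ i, IsScaleFactorOn I (a i)) {t : ℝ} (ht : t ∈ I) (μ : Fin 4) :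
    HasDerivAt (invDiag N a μ) (-(2 * hubble N a μ t * invDiag N a μ t)) t := by
  have h := (hasDerivAt_diagOf hI hN ha ht μ).inv (diagOf_ne_zero hN ha ht μ)
  have h0 := diagOf_ne_zero hN ha ht μ
  have : invDiag N a μ = fun t => (diagOf N a μ t)⁻¹ := funext fun t => invDiag_eq_inv μ t
  rw [this]
  refine h.congr_deriv ?_
  simp only
  field_simp

lemma smooth_hubble (hI : IsOpen I) (hN : IsScaleFactorOn I N)
    (ha : ∀ i, IsScaleFactorOn I (a i)) (μ : Fin 4) : ContDiffOn ℝ ∞ (hubble N a μ) I := by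
  refine Fin.cases ?_ (fun i => ?_) μ
  · exact smooth_logDeriv hI hN
  · exact smooth_logDeriv hI (ha i)

lemma smooth_dragCoeff (hI : IsOpen I) (hN : IsScaleFactorOn I N)
    (ha : ∀ i, IsScaleFactorOn I (a i)) : ContDiffOn ℝ ∞ (dragCoeff N a) I := by
  unfold dragCoeff
  refine (contDiffOn_const.div (hN.1.pow 2) fun t ht => pow_ne_zero _ (hN.2 t ht)).mul ?_
  exact (((smooth_logDeriv hI (ha 0)).add (smooth_logDeriv hI (ha 1))).add
    (smooth_logDeriv hI (ha 2))).sub (smooth_logDeriv hI hN)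

lemma inv_bianchiI (hN : IsScaleFactorOn I N) (ha : ∀ i, IsScaleFactorOn I (a i)) {p : Pt 4}
    (hp : p 0 ∈ I) :
    (bianchiI N a p)⁻¹ = Matrix.diagonal (fun μ => invDiag N a μ (p 0)) := by
  rw [bianchiI_eq]
  apply Matrix.inv_eq_right_inv
  rw [Matrix.diagonal_mul_diagonal]
  have : (fun μ => diagOf N a μ (p 0) * invDiag N a μ (p 0)) = fun _ => 1 := by
    ext μ; rw [invDiag_eq_inv]; exact mul_inv_cancel₀ (diagOf_ne_zero hN ha hp μ)
  rw [this]; exact Matrix.diagonal_one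

lemma pd_bianchiI (hI : IsOpen I) (hN : IsScaleFactorOn I N)
    (ha : ∀ i, IsScaleFactorOn I (a i)) {p : Pt 4} (hp : p 0 ∈ I) (ρ μ ν : Fin 4) :
    pd ρ (fun y => bianchiI N a y μ ν) p =
      if ρ = 0 ∧ μ = ν then 2 * hubble N a μ (p 0) * diagOf N a μ (p 0) else 0 := by
  by_cases h : μ = ν
  · subst h
    have : (fun y => bianchiI N a y μ μ) = fun y => diagOf N a μ (y 0) := by
      ext y; rw [bianchiI_eq]; simp
    have hd := hasDerivAt_diagOf hI hN ha hp μ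
    rw [this, pd_time hd.differentiableAt, hd.deriv]
    simp
  · have : (fun y => bianchiI N a y μ ν) = fun y => 0 := by
      ext y; rw [bianchiI_eq]; simp [h]
    rw [this]; simp [h]

/-- The Christoffel symbols of a Bianchi I line element. -/
noncomputable def chr (N : ℝ → ℝ) (a : Fin 3 → ℝ → ℝ) (κ μ ν : Fin 4) (t : ℝ) : ℝ :=
  (if μ = 0 ∧ κ = ν then hubble N a κ t else 0) + (if ν = 0 ∧ κ = μ then hubble N a κ t else 0)
    - (if κ = 0 ∧ μ = ν then invDiag N a 0 t * (hubble N a μ t * diagOf N a μ t) else 0)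

/-- Only ∂_0 of a diagonal entry is nonzero, and it equals twice the Hubble rate times the entry;
this 2 cancels the ½ of the definition. -/
lemma christoffel_bianchiI (hI : IsOpen I) (hN : IsScaleFactorOn I N)
    (ha : ∀ i, IsScaleFactorOn I (a i)) {p : Pt 4} (hp : p 0 ∈ I) (κ μ ν : Fin 4) :
    christoffel (bianchiI N a) κ μ ν p = chr N a κ μ ν (p 0) := by
  unfold christoffel chr
  simp_rw [inv_bianchiI hN ha hp, Matrix.diagonal_apply, pd_bianchiI hI hN ha hp, ite_mul, zero_mul]
  rw [Finset.sum_ite_eq]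
  have h0 := diagOf_ne_zero hN ha hp κ
  have h1 : invDiag N a κ (p 0) * diagOf N a κ (p 0) = 1 := by
    rw [invDiag_eq_inv]; exact inv_mul_cancel₀ h0
  simp only [Finset.mem_univ, if_true]
  -- In the first two terms the differentiated entry has index κ and cancels against the inverse
  -- metric. In the third term it has index μ, so the metric ratio stays.
  have h2 : ∀ P : Prop, ∀ [Decidable P], invDiag N a κ (p 0) *
      (if P then 2 * hubble N a κ (p 0) * diagOf N a κ (p 0) else 0) =
      2 * (if P then hubble N a κ (p 0) else 0) := by
    intro P _
    split_ifs
    · linear_combination (2 * hubble N a κ (p 0)) * h1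
    · ring
  have h3 : invDiag N a κ (p 0) *
      (if κ = 0 ∧ μ = ν then 2 * hubble N a μ (p 0) * diagOf N a μ (p 0) else 0) =
      2 * (if κ = 0 ∧ μ = ν then
        invDiag N a 0 (p 0) * (hubble N a μ (p 0) * diagOf N a μ (p 0)) else 0) := by
    split_ifs with h
    · rw [h.1]; ring
    · ring
  rw [mul_sub, mul_add, h2, h2, h3]
  ring

end geometry



/-! ### Prolongations -/

section prolong

variable {n : ℕ} {Ω : Set (Pt n)} {x : Pt n}

/-- Partial derivative with respect to `x^μ` of a function of `(x, u)`. -/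
noncomputable def dX (μ : Fin n) (F : Pt n × ℝ → ℝ) (z : Pt n × ℝ) : ℝ :=
  fderiv ℝ F z (Pi.single μ 1, 0)

/-- Partial derivative with respect to `u` of a function of `(x, u)`. -/
noncomputable def dU (F : Pt n × ℝ → ℝ) (z : Pt n × ℝ) : ℝ := fderiv ℝ F z (0, 1)

lemma totalD_eq (F : Pt n × ℝ → ℝ) (μ : Fin n) (x : Pt n) (u : ℝ) (p : Pt n) :
    totalD F μ x u p = dX μ F (x, u) + p μ * dU F (x, u) := by
  unfold totalD dX dU
  have : ((Pi.single μ 1, p μ) : Pt n × ℝ) = (Pi.single μ 1, 0) + p μ • ((0 : Pt n), (1 : ℝ)) := by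
    ext <;> simp
  rw [this, map_add, map_smul, smul_eq_mul]

lemma isOpen_prod_univ (hΩ : IsOpen Ω) : IsOpen (Ω ×ˢ (Set.univ : Set ℝ)) :=
  hΩ.prod isOpen_univ

lemma smooth_dX (hΩ : IsOpen Ω) {F : Pt n × ℝ → ℝ} (hF : ContDiffOn ℝ ∞ F (Ω ×ˢ Set.univ))
    (μ : Fin n) : ContDiffOn ℝ ∞ (dX μ F) (Ω ×ˢ Set.univ) :=
  smooth_fderiv_apply (isOpen_prod_univ hΩ) hF _

lemma smooth_dU (hΩ : IsOpen Ω) {F : Pt n × ℝ → ℝ} (hF : ContDiffOn ℝ ∞ F (Ω ×ˢ Set.univ)) :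
    ContDiffOn ℝ ∞ (dU F) (Ω ×ˢ Set.univ) :=
  smooth_fderiv_apply (isOpen_prod_univ hΩ) hF _

lemma fderiv_congr_prod (hΩ : IsOpen Ω) {F G : Pt n × ℝ → ℝ}
    (h : ∀ y ∈ Ω, ∀ u, F (y, u) = G (y, u)) (hx : x ∈ Ω) (u : ℝ) :
    fderiv ℝ F (x, u) = fderiv ℝ G (x, u) := by
  apply Filter.EventuallyEq.fderiv_eq
  filter_upwards [(isOpen_prod_univ hΩ).mem_nhds (show (x, u) ∈ _ from ⟨hx, trivial⟩)] with y hy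
  exact h y.1 hy.1 y.2

lemma dX_congr (hΩ : IsOpen Ω) {F G : Pt n × ℝ → ℝ} (h : ∀ y ∈ Ω, ∀ u, F (y, u) = G (y, u))
    (hx : x ∈ Ω) (u : ℝ) (μ : Fin n) : dX μ F (x, u) = dX μ G (x, u) := by
  unfold dX; rw [fderiv_congr_prod hΩ h hx]

lemma dU_congr (hΩ : IsOpen Ω) {F G : Pt n × ℝ → ℝ} (h : ∀ y ∈ Ω, ∀ u, F (y, u) = G (y, u))
    (hx : x ∈ Ω) (u : ℝ) : dU F (x, u) = dU G (x, u) := by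
  unfold dU; rw [fderiv_congr_prod hΩ h hx]

lemma hasFDerivAt_affine {α b : Pt n → ℝ} (hα : DifferentiableAt ℝ α x)
    (hb : DifferentiableAt ℝ b x) (u : ℝ) :
    HasFDerivAt (fun z : Pt n × ℝ => α z.1 * z.2 + b z.1)
      ((α x) • (ContinuousLinearMap.snd ℝ (Pt n) ℝ)
        + u • ((fderiv ℝ α x).comp (ContinuousLinearMap.fst ℝ (Pt n) ℝ))
        + (fderiv ℝ b x).comp (ContinuousLinearMap.fst ℝ (Pt n) ℝ)) (x, u) := by
  have h1 : HasFDerivAt (fun z : Pt n × ℝ => α z.1)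
      ((fderiv ℝ α x).comp (ContinuousLinearMap.fst ℝ (Pt n) ℝ)) (x, u) :=
    hα.hasFDerivAt.comp (x, u) hasFDerivAt_fst
  have h2 : HasFDerivAt (fun z : Pt n × ℝ => b z.1)
      ((fderiv ℝ b x).comp (ContinuousLinearMap.fst ℝ (Pt n) ℝ)) (x, u) :=
    hb.hasFDerivAt.comp (x, u) hasFDerivAt_fst
  exact (h1.mul hasFDerivAt_snd).add h2

lemma dX_affine {α b : Pt n → ℝ} (hα : DifferentiableAt ℝ α x) (hb : DifferentiableAt ℝ b x)
    (u : ℝ) (μ : Fin n) :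
    dX μ (fun z : Pt n × ℝ => α z.1 * z.2 + b z.1) (x, u) = pd μ α x * u + pd μ b x := by
  unfold dX; rw [(hasFDerivAt_affine hα hb u).fderiv]; simp [pd, mul_comm]

lemma dU_affine {α b : Pt n → ℝ} (hα : DifferentiableAt ℝ α x) (hb : DifferentiableAt ℝ b x)
    (u : ℝ) : dU (fun z : Pt n × ℝ => α z.1 * z.2 + b z.1) (x, u) = α x := by
  unfold dU; rw [(hasFDerivAt_affine hα hb u).fderiv]; simp

lemma dX_base {b : Pt n → ℝ} (hb : DifferentiableAt ℝ b x) (u : ℝ) (μ : Fin n) :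
    dX μ (fun z : Pt n × ℝ => b z.1) (x, u) = pd μ b x := by
  have := dX_affine (α := fun _ => 0) (differentiableAt_const 0) hb u μ
  simpa using this

lemma dU_base {b : Pt n → ℝ} (hb : DifferentiableAt ℝ b x) (u : ℝ) :
    dU (fun z : Pt n × ℝ => b z.1) (x, u) = 0 := by
  have := dU_affine (α := fun _ => 0) (differentiableAt_const 0) hb u
  simpa using this

lemma PointField.SmoothOn.comp_ξ {X : PointField n} (hX : X.SmoothOn Ω) (κ : Fin n) :
    ContDiffOn ℝ ∞ (fun y => X.ξ y κ) (Ω ×ˢ Set.univ) := contDiffOn_pi.1 hX.1 κ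

lemma prolong1_eq (X : PointField n) (j : Jet1 n) (μ : Fin n) :
    prolong1 X j μ = dX μ X.η (j.1, j.2.1) + j.2.2 μ * dU X.η (j.1, j.2.1)
      - ∑ κ, (dX μ (fun y => X.ξ y κ) (j.1, j.2.1)
          + j.2.2 μ * dU (fun y => X.ξ y κ) (j.1, j.2.1)) * j.2.2 κ := by
  simp only [prolong1, totalD_eq]

lemma hasDerivAt_line {F : Pt n × ℝ → ℝ} {u : ℝ} (hF : DifferentiableAt ℝ F (x, u)) (ν : Fin n)
    (p : Pt n) :
    HasDerivAt (fun s : ℝ => F (x + s • Pi.single ν (1 : ℝ), u + s * p ν)) (totalD F ν x u p) 0 := by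
  have h2 : HasDerivAt (fun s : ℝ => ((x + s • Pi.single ν (1 : ℝ), u + s * p ν) : Pt n × ℝ))
      (Pi.single ν 1, p ν) 0 := by
    have h3 : HasDerivAt (fun s : ℝ => x + s • (Pi.single ν (1 : ℝ) : Pt n)) (Pi.single ν 1) 0 := by
      simpa using ((hasDerivAt_id (0 : ℝ)).smul_const (Pi.single ν (1 : ℝ) : Pt n)).const_add x
    have h4 : HasDerivAt (fun s : ℝ => u + s * p ν) (p ν) 0 := by
      simpa using ((hasDerivAt_id (0 : ℝ)).mul_const (p ν)).const_add u
    exact h3.prodMk h4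
  have hF' : DifferentiableAt ℝ F ((fun s : ℝ => ((x + s • Pi.single ν (1 : ℝ), u + s * p ν) :
      Pt n × ℝ)) 0) := by simpa using hF
  have := hF'.hasFDerivAt.comp_hasDerivAt (0 : ℝ) h2
  simpa [totalD, Function.comp_def] using this

/-- The total derivative is an ordinary derivative along the line s ↦ (x + s e_ν, u + s p_ν, p + s
q_ν). There the product rule applies to the explicit formula of `prolong1_eq`, so the Fréchet
derivative of the first prolongation is never written out. -/
lemma totalD1_prolong1 (hΩ : IsOpen Ω) {X : PointField n} (hX : X.SmoothOn Ω) (hx : x ∈ Ω)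
    (u : ℝ) (p : Pt n) (q : Fin n → Fin n → ℝ) (μ ν : Fin n) :
    totalD1 (fun j => prolong1 X j μ) ν x u p q =
      totalD (dX μ X.η) ν x u p + (q ν μ * dU X.η (x, u) + p μ * totalD (dU X.η) ν x u p)
      - ∑ κ, ((totalD (dX μ fun y => X.ξ y κ) ν x u p + (q ν μ * dU (fun y => X.ξ y κ) (x, u)
          + p μ * totalD (dU fun y => X.ξ y κ) ν x u p)) * p κ
        + (dX μ (fun y => X.ξ y κ) (x, u) + p μ * dU (fun y => X.ξ y κ) (x, u)) * q ν κ) := by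
  have ho := isOpen_prod_univ hΩ
  have hz : (x, u) ∈ Ω ×ˢ (Set.univ : Set ℝ) := ⟨hx, trivial⟩
  have d1 : DifferentiableAt ℝ (dX μ X.η) (x, u) :=
    differentiableAt_of_smooth ho (smooth_dX hΩ hX.2 μ) hz
  have d2 : DifferentiableAt ℝ (dU X.η) (x, u) :=
    differentiableAt_of_smooth ho (smooth_dU hΩ hX.2) hz
  have d3 : ∀ κ, DifferentiableAt ℝ (dX μ fun y => X.ξ y κ) (x, u) := fun κ =>
    differentiableAt_of_smooth ho (smooth_dX hΩ (hX.comp_ξ κ) μ) hz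
  have d4 : ∀ κ, DifferentiableAt ℝ (dU fun y => X.ξ y κ) (x, u) := fun κ =>
    differentiableAt_of_smooth ho (smooth_dU hΩ (hX.comp_ξ κ)) hz
  have hfun : (fun j => prolong1 X j μ) = fun j : Jet1 n =>
      dX μ X.η (j.1, j.2.1) + j.2.2 μ * dU X.η (j.1, j.2.1)
      - ∑ κ, (dX μ (fun y => X.ξ y κ) (j.1, j.2.1)
          + j.2.2 μ * dU (fun y => X.ξ y κ) (j.1, j.2.1)) * j.2.2 κ :=
    funext fun j => prolong1_eq X j μ
  have hproj : DifferentiableAt ℝ (fun j : Jet1 n => (j.1, j.2.1)) (x, u, p) := by fun_prop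
  have hp : ∀ κ, DifferentiableAt ℝ (fun j : Jet1 n => j.2.2 κ) (x, u, p) := fun κ => by fun_prop
  have comp : ∀ F : Pt n × ℝ → ℝ, DifferentiableAt ℝ F (x, u) →
      DifferentiableAt ℝ (fun j : Jet1 n => F (j.1, j.2.1)) (x, u, p) := fun F hF =>
    DifferentiableAt.comp (x, u, p) (f := fun j : Jet1 n => (j.1, j.2.1)) (g := F) hF hproj
  have hdiff : DifferentiableAt ℝ (fun j => prolong1 X j μ) (x, u, p) := by
    rw [hfun]
    refine ((comp _ d1).add ((hp μ).mul (comp _ d2))).sub ?_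
    refine DifferentiableAt.fun_sum fun κ _ => ?_
    exact ((comp _ (d3 κ)).add ((hp μ).mul (comp _ (d4 κ)))).mul (hp κ)
  have hline : HasDerivAt (fun s : ℝ => ((x + s • Pi.single ν (1 : ℝ), u + s * p ν, p + s • q ν) :
      Jet1 n)) (Pi.single ν 1, p ν, q ν) 0 := by
    have h3 : HasDerivAt (fun s : ℝ => x + s • (Pi.single ν (1 : ℝ) : Pt n)) (Pi.single ν 1) 0 := by
      simpa using ((hasDerivAt_id (0 : ℝ)).smul_const (Pi.single ν (1 : ℝ) : Pt n)).const_add x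
    have h4 : HasDerivAt (fun s : ℝ => u + s * p ν) (p ν) 0 := by
      simpa using ((hasDerivAt_id (0 : ℝ)).mul_const (p ν)).const_add u
    have h5 : HasDerivAt (fun s : ℝ => p + s • q ν) (q ν) 0 := by
      simpa using ((hasDerivAt_id (0 : ℝ)).smul_const (q ν)).const_add p
    exact h3.prodMk (h4.prodMk h5)
  have hdiff' : DifferentiableAt ℝ (fun j => prolong1 X j μ)
      ((fun s : ℝ => ((x + s • Pi.single ν (1 : ℝ), u + s * p ν, p + s • q ν) : Jet1 n)) 0) := by
    simpa using hdiff
  have key := hdiff'.hasFDerivAt.comp_hasDerivAt (0 : ℝ) hline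
  have hq : ∀ κ, HasDerivAt (fun s : ℝ => p κ + s * q ν κ) (q ν κ) 0 := fun κ => by
    simpa using ((hasDerivAt_id (0 : ℝ)).mul_const (q ν κ)).const_add (p κ)
  have expl : HasDerivAt (fun s : ℝ =>
      dX μ X.η (x + s • Pi.single ν (1 : ℝ), u + s * p ν)
        + (p μ + s * q ν μ) * dU X.η (x + s • Pi.single ν (1 : ℝ), u + s * p ν)
      - ∑ κ, (dX μ (fun y => X.ξ y κ) (x + s • Pi.single ν (1 : ℝ), u + s * p ν)
          + (p μ + s * q ν μ) * dU (fun y => X.ξ y κ) (x + s • Pi.single ν (1 : ℝ), u + s * p ν))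
            * (p κ + s * q ν κ)) _ 0 :=
    ((hasDerivAt_line d1 ν p).add ((hq μ).mul (hasDerivAt_line d2 ν p))).sub
      (HasDerivAt.fun_sum fun κ _ =>
        ((hasDerivAt_line (d3 κ) ν p).add ((hq μ).mul (hasDerivAt_line (d4 κ) ν p))).mul (hq κ))
  have heq : ((fun j => prolong1 X j μ) ∘
      (fun s : ℝ => ((x + s • Pi.single ν (1 : ℝ), u + s * p ν, p + s • q ν) : Jet1 n))) =
      fun s : ℝ =>
      dX μ X.η (x + s • Pi.single ν (1 : ℝ), u + s * p ν)
        + (p μ + s * q ν μ) * dU X.η (x + s • Pi.single ν (1 : ℝ), u + s * p ν)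
      - ∑ κ, (dX μ (fun y => X.ξ y κ) (x + s • Pi.single ν (1 : ℝ), u + s * p ν)
          + (p μ + s * q ν μ) * dU (fun y => X.ξ y κ) (x + s • Pi.single ν (1 : ℝ), u + s * p ν))
            * (p κ + s * q ν κ) := by
    funext s
    simp [prolong1_eq]
  -- The chain rule and the product rule give two derivatives of one function of `s`; uniqueness
  -- identifies them.
  rw [heq] at key
  have hu := key.unique expl
  have h0 : (fun s : ℝ => ((x + s • Pi.single ν (1 : ℝ), u + s * p ν, p + s • q ν) : Jet1 n)) 0
      = (x, u, p) := by simp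
  rw [h0] at hu
  unfold totalD1
  rw [hu]
  simp

/-- The second prolongation coefficients on the diagonal of a field of the form
`ζ(x) ∂ + (α(x) u + b(x)) ∂_u`. -/
lemma prolong2_affine (hΩ : IsOpen Ω) {X : PointField n} {ζ : Pt n → Pt n} {α b : Pt n → ℝ}
    (hζ : ∀ κ, ContDiffOn ℝ ∞ (fun y => ζ y κ) Ω) (hα : ContDiffOn ℝ ∞ α Ω)
    (hb : ContDiffOn ℝ ∞ b Ω) (hX : X.SmoothOn Ω)
    (hξ : ∀ y ∈ Ω, ∀ u, X.ξ (y, u) = ζ y) (hη : ∀ y ∈ Ω, ∀ u, X.η (y, u) = α y * u + b y)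
    (hx : x ∈ Ω) (u : ℝ) (p : Pt n) (q : Fin n → Fin n → ℝ) (μ : Fin n) :
    prolong2 X x u p q μ μ =
      pd μ (pd μ α) x * u + pd μ (pd μ b) x + 2 * p μ * pd μ α x + q μ μ * α x
      - ∑ κ, (pd μ (pd μ fun y => ζ y κ) x * p κ + 2 * pd μ (fun y => ζ y κ) x * q μ κ) := by
  have dα : ∀ y ∈ Ω, DifferentiableAt ℝ α y := fun y hy => differentiableAt_of_smooth hΩ hα hy
  have db : ∀ y ∈ Ω, DifferentiableAt ℝ b y := fun y hy => differentiableAt_of_smooth hΩ hb hy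
  have dζ : ∀ κ, ∀ y ∈ Ω, DifferentiableAt ℝ (fun y => ζ y κ) y := fun κ y hy =>
    differentiableAt_of_smooth hΩ (hζ κ) hy
  have dα' : DifferentiableAt ℝ (pd μ α) x := differentiableAt_of_smooth hΩ (smooth_pd hΩ hα μ) hx
  have db' : DifferentiableAt ℝ (pd μ b) x := differentiableAt_of_smooth hΩ (smooth_pd hΩ hb μ) hx
  have dζ' : ∀ κ, DifferentiableAt ℝ (pd μ fun y => ζ y κ) x := fun κ =>
    differentiableAt_of_smooth hΩ (smooth_pd hΩ (hζ κ) μ) hx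
  have e1 : ∀ y ∈ Ω, ∀ u, dX μ X.η (y, u) = pd μ α y * u + pd μ b y := fun y hy u => by
    rw [dX_congr hΩ (G := fun z => α z.1 * z.2 + b z.1) hη hy, dX_affine (dα y hy) (db y hy)]
  have e2 : ∀ y ∈ Ω, ∀ u, dU X.η (y, u) = α y := fun y hy u => by
    rw [dU_congr hΩ (G := fun z => α z.1 * z.2 + b z.1) hη hy, dU_affine (dα y hy) (db y hy)]
  have e3 : ∀ κ, ∀ y ∈ Ω, ∀ u, dX μ (fun y => X.ξ y κ) (y, u) = pd μ (fun y => ζ y κ) y :=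
    fun κ y hy u => by
      rw [dX_congr hΩ (G := fun z => ζ z.1 κ) (fun y hy u => by rw [hξ y hy]) hy,
        dX_base (b := fun y => ζ y κ) (dζ κ y hy)]
  have e4 : ∀ κ, ∀ y ∈ Ω, ∀ u, dU (fun y => X.ξ y κ) (y, u) = 0 :=
    fun κ y hy u => by
      rw [dU_congr hΩ (G := fun z => ζ z.1 κ) (fun y hy u => by rw [hξ y hy]) hy,
        dU_base (b := fun y => ζ y κ) (dζ κ y hy)]
  have f1 : totalD (dX μ X.η) μ x u p = pd μ (pd μ α) x * u + pd μ (pd μ b) x + p μ * pd μ α x := by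
    rw [totalD_eq, dX_congr hΩ (G := fun z => pd μ α z.1 * z.2 + pd μ b z.1) e1 hx,
      dU_congr hΩ (G := fun z => pd μ α z.1 * z.2 + pd μ b z.1) e1 hx, dX_affine dα' db',
      dU_affine dα' db']
  have f2 : totalD (dU X.η) μ x u p = pd μ α x := by
    rw [totalD_eq, dX_congr hΩ (G := fun z => α z.1) e2 hx,
      dU_congr hΩ (G := fun z => α z.1) e2 hx, dX_base (dα x hx), dU_base (dα x hx)]
    ring
  have f3 : ∀ κ, totalD (dX μ fun y => X.ξ y κ) μ x u p = pd μ (pd μ fun y => ζ y κ) x := fun κ => by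
    rw [totalD_eq, dX_congr hΩ (G := fun z => pd μ (fun y => ζ y κ) z.1) (e3 κ) hx,
      dU_congr hΩ (G := fun z => pd μ (fun y => ζ y κ) z.1) (e3 κ) hx, dX_base (dζ' κ),
      dU_base (dζ' κ)]
    ring
  have f4 : ∀ κ, totalD (dU fun y => X.ξ y κ) μ x u p = 0 := fun κ => by
    have hc : DifferentiableAt ℝ (fun _ : Pt n => (0 : ℝ)) x := differentiableAt_const 0
    rw [totalD_eq, dX_congr hΩ (G := fun z => (fun _ => (0 : ℝ)) z.1) (e4 κ) hx,
      dU_congr hΩ (G := fun z => (fun _ => (0 : ℝ)) z.1) (e4 κ) hx, dX_base hc, dU_base hc]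
    simp
  have f5 : ∀ κ, totalD (fun y => X.ξ y κ) μ x u p = pd μ (fun y => ζ y κ) x := fun κ => by
    rw [totalD_eq, e3 κ x hx, e4 κ x hx]; ring
  unfold prolong2
  rw [totalD1_prolong1 hΩ hX hx, f1, f2, e2 x hx]
  simp only [f3, f4, f5, e3 _ x hx, e4 _ x hx, Finset.sum_add_distrib]
  have : ∑ κ, 2 * pd μ (fun y => ζ y κ) x * q μ κ = 2 * ∑ κ, pd μ (fun y => ζ y κ) x * q μ κ := by
    rw [Finset.mul_sum]; exact Finset.sum_congr rfl fun κ _ => by ring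
  rw [this]
  simp only [mul_zero, add_zero]
  ring

lemma prolong1_affine (hΩ : IsOpen Ω) {X : PointField n} {ζ : Pt n → Pt n} {α b : Pt n → ℝ}
    (hζ : ∀ κ, ContDiffOn ℝ ∞ (fun y => ζ y κ) Ω) (hα : ContDiffOn ℝ ∞ α Ω)
    (hb : ContDiffOn ℝ ∞ b Ω)
    (hξ : ∀ y ∈ Ω, ∀ u, X.ξ (y, u) = ζ y) (hη : ∀ y ∈ Ω, ∀ u, X.η (y, u) = α y * u + b y)
    (hx : x ∈ Ω) (u : ℝ) (p : Pt n) (μ : Fin n) :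
    prolong1 X (x, u, p) μ =
      pd μ α x * u + pd μ b x + p μ * α x - ∑ κ, pd μ (fun y => ζ y κ) x * p κ := by
  have dα : DifferentiableAt ℝ α x := differentiableAt_of_smooth hΩ hα hx
  have db : DifferentiableAt ℝ b x := differentiableAt_of_smooth hΩ hb hx
  have dζ : ∀ κ, DifferentiableAt ℝ (fun y => ζ y κ) x := fun κ =>
    differentiableAt_of_smooth hΩ (hζ κ) hx
  rw [prolong1_eq, dX_congr hΩ (G := fun z => α z.1 * z.2 + b z.1) hη hx, dX_affine dα db,
    dU_congr hΩ (G := fun z => α z.1 * z.2 + b z.1) hη hx, dU_affine dα db]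
  congr 1
  refine Finset.sum_congr rfl fun κ _ => ?_
  rw [dX_congr hΩ (G := fun z => ζ z.1 κ) (fun y hy u => by rw [hξ y hy]) hx,
        dX_base (b := fun y => ζ y κ) (dζ κ),
        dU_congr hΩ (G := fun z => ζ z.1 κ) (fun y hy u => by rw [hξ y hy]) hx,
        dU_base (b := fun y => ζ y κ) (dζ κ)]
  ring

end prolong



/-! ### The determining equations -/

section determining

variable {I : Set ℝ} {J : Fin 3 → Set ℝ} {N : ℝ → ℝ} {a : Fin 3 → ℝ → ℝ} {V : Pt 4 → ℝ}

/-- The contraction g^{νκ}Γ^μ_{νκ} survives only for μ = 0, so `p 0` is the only first derivative in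
the equation. -/
lemma kgH_bianchiI (hI : IsOpen I) (hN : IsScaleFactorOn I N)
    (ha : ∀ i, IsScaleFactorOn I (a i)) {x : Pt 4} (hx : x 0 ∈ I) (u : ℝ) (p : Pt 4)
    (q : Fin 4 → Fin 4 → ℝ) :
    kgH (bianchiI N a) V (x, u, p, q) =
      ∑ μ, invDiag N a μ (x 0) * q μ μ - dragCoeff N a (x 0) * p 0 - V x * u := by
  have h0 := hN.2 _ hx
  have h1 := (ha 0).2 _ hx
  have h2 := (ha 1).2 _ hx
  have h3 := (ha 2).2 _ hx
  have hs : ∀ μ ν : Fin 4, (bianchiI N a x)⁻¹ μ ν = if μ = ν then invDiag N a μ (x 0) else 0 :=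
    fun μ ν => by rw [inv_bianchiI hN ha hx, Matrix.diagonal_apply]
  have hd : ∀ μ, ∑ ν, ∑ κ, (bianchiI N a x)⁻¹ ν κ * christoffel (bianchiI N a) μ ν κ x =
      if μ = 0 then dragCoeff N a (x 0) else 0 := by
    intro μ
    simp_rw [hs, christoffel_bianchiI hI hN ha hx, ite_mul, zero_mul]
    simp only [Finset.sum_ite_eq, Finset.mem_univ, if_true]
    refine Fin.cases ?_ (fun i => ?_) μ
    · simp only [Fin.sum_univ_succ, chr, invDiag_zero, invDiag_succ, hubble_zero, hubble_succ,
        diagOf_zero, diagOf_succ, dragCoeff, Fin.succ_ne_zero, (Fin.succ_ne_zero _).symm]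
      simp
      field_simp
      ring
    · simp only [Fin.sum_univ_succ, chr, Fin.succ_ne_zero]
      simp
  unfold kgH
  simp_rw [hd, hs, ite_mul, zero_mul]
  simp

/-- The derivative of the Klein-Gordon operator along a tangent vector of the jet space. -/
lemma fderiv_kgH (hI : IsOpen I) (hJ : ∀ i, IsOpen (J i)) (hN : IsScaleFactorOn I N)
    (ha : ∀ i, IsScaleFactorOn I (a i)) (hV : ContDiffOn ℝ ∞ V (box I J)) {x : Pt 4}
    (hx : x ∈ box I J) (u : ℝ) (p : Pt 4) (q : Fin 4 → Fin 4 → ℝ) (v : Pt 4) (w : ℝ) (r : Pt 4)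
    (z : Fin 4 → Fin 4 → ℝ) :
    fderiv ℝ (kgH (bianchiI N a) V) (x, u, p, q) (v, w, r, z) =
      ∑ μ, (-(2 * hubble N a μ (x 0) * invDiag N a μ (x 0)) * v 0 * q μ μ
          + invDiag N a μ (x 0) * z μ μ)
        - (deriv (dragCoeff N a) (x 0) * v 0 * p 0 + dragCoeff N a (x 0) * r 0)
        - (fderiv ℝ V x v * u + V x * w) := by
  have hΩ := isOpen_box hI hJ
  have hdV : DifferentiableAt ℝ V x := differentiableAt_of_smooth hΩ hV hx
  have hev : kgH (bianchiI N a) V =ᶠ[nhds (x, u, p, q)] fun j : Jet2 4 =>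
      ∑ μ, invDiag N a μ (j.1 0) * j.2.2.2 μ μ - dragCoeff N a (j.1 0) * j.2.2.1 0 - V j.1 * j.2.1 := by
    have hc : ContinuousAt (fun j : Jet2 4 => j.1) (x, u, p, q) := by fun_prop
    filter_upwards [hc.preimage_mem_nhds (hΩ.mem_nhds hx)] with j hj
    exact kgH_bianchiI hI hN ha hj.1 j.2.1 j.2.2.1 j.2.2.2
  rw [hev.fderiv_eq]
  have ht : HasFDerivAt (fun j : Jet2 4 => j.1 0)
      ((ContinuousLinearMap.proj (R := ℝ) (φ := fun _ : Fin 4 => ℝ) 0).comp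
        (ContinuousLinearMap.fst ℝ (Pt 4) (ℝ × Pt 4 × (Fin 4 → Fin 4 → ℝ)))) (x, u, p, q) :=
    ((ContinuousLinearMap.proj (R := ℝ) (φ := fun _ : Fin 4 => ℝ) 0).comp
      (ContinuousLinearMap.fst ℝ (Pt 4) (ℝ × Pt 4 × (Fin 4 → Fin 4 → ℝ)))).hasFDerivAt
  have htc : ∀ f : ℝ → ℝ, ∀ f' : ℝ, HasDerivAt f f' (x 0) →
      HasFDerivAt (fun j : Jet2 4 => f (j.1 0))
        (f' • ((ContinuousLinearMap.proj (R := ℝ) (φ := fun _ : Fin 4 => ℝ) 0).comp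
        (ContinuousLinearMap.fst ℝ (Pt 4) (ℝ × Pt 4 × (Fin 4 → Fin 4 → ℝ))))) (x, u, p, q) :=
    fun f f' hf => HasDerivAt.comp_hasFDerivAt (x, u, p, q) (f := fun j : Jet2 4 => j.1 0) hf ht
  have hs := fun μ => htc _ _ (hasDerivAt_invDiag hI hN ha hx.1 μ)
  have hG := htc _ _ (differentiableAt_of_smooth hI (smooth_dragCoeff hI hN ha) hx.1).hasDerivAt
  have hVV : HasFDerivAt (fun j : Jet2 4 => V j.1) ((fderiv ℝ V x).comp
      (ContinuousLinearMap.fst ℝ (Pt 4) (ℝ × Pt 4 × (Fin 4 → Fin 4 → ℝ)))) (x, u, p, q) :=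
    HasFDerivAt.comp (x, u, p, q) (g := V) (f := fun j : Jet2 4 => j.1) hdV.hasFDerivAt
      hasFDerivAt_fst
  have hu : HasFDerivAt (fun j : Jet2 4 => j.2.1)
      ((ContinuousLinearMap.fst ℝ _ _).comp (ContinuousLinearMap.snd ℝ _ _)) (x, u, p, q) :=
    (((ContinuousLinearMap.fst ℝ _ _).comp
      (ContinuousLinearMap.snd ℝ (Pt 4) (ℝ × Pt 4 × (Fin 4 → Fin 4 → ℝ))))).hasFDerivAt
  have hp : HasFDerivAt (fun j : Jet2 4 => j.2.2.1 0) _ (x, u, p, q) :=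
    ((ContinuousLinearMap.proj (R := ℝ) (φ := fun _ : Fin 4 => ℝ) 0).comp
      ((ContinuousLinearMap.fst ℝ _ _).comp ((ContinuousLinearMap.snd ℝ _ _).comp
        (ContinuousLinearMap.snd ℝ (Pt 4) (ℝ × Pt 4 × (Fin 4 → Fin 4 → ℝ)))))).hasFDerivAt
  have hq : ∀ μ, HasFDerivAt (fun j : Jet2 4 => j.2.2.2 μ μ) _ (x, u, p, q) := fun μ =>
    ((ContinuousLinearMap.proj (R := ℝ) (φ := fun _ : Fin 4 => ℝ) μ).comp
      ((ContinuousLinearMap.proj (R := ℝ) (φ := fun _ : Fin 4 => Fin 4 → ℝ) μ).comp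
      ((ContinuousLinearMap.snd ℝ _ _).comp ((ContinuousLinearMap.snd ℝ _ _).comp
        (ContinuousLinearMap.snd ℝ (Pt 4) (ℝ × Pt 4 × (Fin 4 → Fin 4 → ℝ))))))).hasFDerivAt
  have := ((HasFDerivAt.fun_sum (u := Finset.univ) fun μ _ => (hs μ).mul (hq μ)).sub
    (hG.mul hp)).sub (hVV.mul hu)
  refine (DFunLike.congr_fun this.fderiv _).trans ?_
  simp
  have e : ∀ A B C D E F G H : ℝ, A = E → B = F → C = G → A - B - C = E - F - G := by
    intros; subst_vars; rfl
  refine e _ _ _ 0 _ _ _ 0 (Finset.sum_congr rfl fun μ _ => by ring) (by ring) (by ring)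


/-- Evaluates the quadratic sum at the symmetric test matrix with one off-diagonal pair. -/
lemma sum_sum_offdiag (F : Fin 4 → Fin 4 → ℝ) {μ₀ ν₀ : Fin 4} (h : μ₀ ≠ ν₀) :
    ∑ μ, ∑ κ, F μ κ * (if (μ = μ₀ ∧ κ = ν₀) ∨ (μ = ν₀ ∧ κ = μ₀) then (1 : ℝ) else 0) =
      F μ₀ ν₀ + F ν₀ μ₀ := by
  have : ∀ μ κ, F μ κ * (if (μ = μ₀ ∧ κ = ν₀) ∨ (μ = ν₀ ∧ κ = μ₀) then (1 : ℝ) else 0) =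
      (if μ = μ₀ then (if κ = ν₀ then F μ κ else 0) else 0)
      + (if μ = ν₀ then (if κ = μ₀ then F μ κ else 0) else 0) := by
    intro μ κ
    by_cases h1 : μ = μ₀ <;> by_cases h2 : κ = ν₀ <;> by_cases h3 : μ = ν₀ <;>
      by_cases h4 : κ = μ₀ <;> simp_all
  simp_rw [this, Finset.sum_add_distrib]
  simp

/-- An affine function that vanishes on an affine hyperplane is a multiple of its defining function.
Off-diagonal entries do not enter the hyperplane, so their symmetrised coefficients vanish. On the
diagonal the coefficients are proportional to `s`, and the multiplier is read off at the entry (0,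
0). -/
lemma affine_on_hyperplane_iff {s : Fin 4 → ℝ} (hs : ∀ μ, s μ ≠ 0) (P c : ℝ) (Q : Fin 4 → ℝ)
    (W : Fin 4 → Fin 4 → ℝ) :
    (∀ q : Fin 4 → Fin 4 → ℝ, (∀ μ ν, q μ ν = q ν μ) → ∑ μ, s μ * q μ μ = c →
      P + ∑ μ, Q μ * q μ μ - 2 * ∑ μ, ∑ κ, s μ * W μ κ * q μ κ = 0) ↔
    (∀ μ κ, μ ≠ κ → s μ * W μ κ + s κ * W κ μ = 0) ∧
      (∀ μ, Q μ - 2 * s μ * W μ μ = (Q 0 - 2 * s 0 * W 0 0) / s 0 * s μ) ∧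
      P + (Q 0 - 2 * s 0 * W 0 0) / s 0 * c = 0 := by
  have hdiag : ∀ d : Fin 4 → ℝ, ∑ μ, ∑ κ, s μ * W μ κ * (if μ = κ then d μ else 0) =
      ∑ μ, s μ * W μ μ * d μ := by
    intro d; simp
  constructor
  · intro h
    have hd : ∀ d : Fin 4 → ℝ, ∑ μ, s μ * d μ = c →
        P + ∑ μ, Q μ * d μ - 2 * ∑ μ, s μ * W μ μ * d μ = 0 := by
      intro d hd
      have := h (fun μ κ => if μ = κ then d μ else 0)
        (fun μ ν => by by_cases e : μ = ν <;> simp [e, eq_comm]) (by simpa using hd)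
      rw [hdiag] at this
      simpa using this
    have h0 := hs 0
    -- The matrix whose only nonzero entry is q_00 = c / s_0 lies on the hyperplane and yields the
    -- constant term.
    have hP : P + (Q 0 - 2 * s 0 * W 0 0) / s 0 * c = 0 := by
      have := hd (Fin.cons (c / s 0) 0) (by simp [Fin.sum_univ_succ]; field_simp)
      simp [Fin.sum_univ_succ] at this
      rw [← this]; field_simp; ring
    refine ⟨fun μ₀ κ₀ hne => ?_, fun μ => ?_, hP⟩
    · have h1 := hd (Fin.cons (c / s 0) 0) (by simp [Fin.sum_univ_succ]; field_simp)
      -- The same point with an off-diagonal pair added is still on the hyperplane; the difference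
      -- isolates the two coefficients.
      have h2 := h (fun μ κ => (if μ = κ then (Fin.cons (c / s 0) 0 : Fin 4 → ℝ) μ else 0)
          + (if (μ = μ₀ ∧ κ = κ₀) ∨ (μ = κ₀ ∧ κ = μ₀) then (1 : ℝ) else 0))
        (fun μ ν => by
          congr 1
          · by_cases e : μ = ν <;> simp [e, eq_comm]
          · congr 1; apply propext; tauto) (by
          have : ∀ μ : Fin 4, ¬((μ = μ₀ ∧ μ = κ₀) ∨ (μ = κ₀ ∧ μ = μ₀)) := by
            rintro μ (⟨h1, h2⟩ | ⟨h1, h2⟩)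
            · exact hne (h1.symm.trans h2)
            · exact hne (h2.symm.trans h1)
          simp [this, Fin.sum_univ_succ]; field_simp)
      have hz : ∀ μ : Fin 4, ¬((μ = μ₀ ∧ μ = κ₀) ∨ (μ = κ₀ ∧ μ = μ₀)) := by
        rintro μ (⟨h1, h2⟩ | ⟨h1, h2⟩)
        · exact hne (h1.symm.trans h2)
        · exact hne (h2.symm.trans h1)
      simp only [mul_add, Finset.sum_add_distrib, sum_sum_offdiag (fun μ κ => s μ * W μ κ) hne,
        hdiag, hz, if_false, if_true, mul_zero, Finset.sum_const_zero] at h2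
      linarith
    · refine Fin.cases ?_ (fun i => ?_) μ
      · field_simp
      -- A unit entry at the position `i.succ` is compensated at (0, 0) so as to stay on the
      -- hyperplane.
      · have := hd (Fin.cons ((c - s i.succ) / s 0) (Pi.single i 1)) (by
          simp [Fin.sum_univ_succ, Pi.single_apply]
          fin_cases i <;> simp <;> field_simp <;> ring)
        have h3 : P + (Q 0 * ((c - s i.succ) / s 0) + Q i.succ)
            - 2 * (s 0 * W 0 0 * ((c - s i.succ) / s 0) + s i.succ * W i.succ i.succ) = 0 := by
          rw [← this]
          rw [Fin.sum_univ_succ, Fin.sum_univ_succ (n := 3)]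
          simp [Pi.single_apply]
        field_simp at h3 hP ⊢
        linarith
  · rintro ⟨hoff, hdg, hP⟩ q hq hc
    have h1 : ∑ μ, ∑ κ, s μ * W μ κ * q μ κ = ∑ μ, s μ * W μ μ * q μ μ := by
      have o := hoff
      have e01 := o 0 1 (by decide)
      have e02 := o 0 2 (by decide)
      have e03 := o 0 3 (by decide)
      have e12 := o 1 2 (by decide)
      have e13 := o 1 3 (by decide)
      have e23 := o 2 3 (by decide)
      simp only [Fin.sum_univ_four]
      rw [hq 1 0, hq 2 0, hq 3 0, hq 2 1, hq 3 1, hq 3 2]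
      linear_combination q 0 1 * e01 + q 0 2 * e02 + q 0 3 * e03 + q 1 2 * e12 + q 1 3 * e13
        + q 2 3 * e23
    have h2 : ∑ μ, Q μ * q μ μ - 2 * ∑ μ, s μ * W μ μ * q μ μ =
        (Q 0 - 2 * s 0 * W 0 0) / s 0 * ∑ μ, s μ * q μ μ := by
      rw [Finset.mul_sum, Finset.mul_sum, ← Finset.sum_sub_distrib]
      refine Finset.sum_congr rfl fun μ _ => ?_
      linear_combination q μ μ * hdg μ
    rw [h1]
    rw [hc] at h2
    linarith

/-- Sorts the Lie condition by its dependence on `q`, in the shape required by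
`affine_on_hyperplane_iff`. -/
lemma sum_affine_split (s A h : Fin 4 → ℝ) (c : ℝ) (W q : Fin 4 → Fin 4 → ℝ) :
    ∑ μ, s μ * (A μ + c * q μ μ - 2 * ∑ κ, W μ κ * q μ κ) + ∑ μ, h μ * q μ μ =
      ∑ μ, s μ * A μ + ∑ μ, (h μ + s μ * c) * q μ μ - 2 * ∑ μ, ∑ κ, s μ * W μ κ * q μ κ := by
  simp only [Fin.sum_univ_four]; ring

lemma prolong2_diag (hΩ : IsOpen (box I J)) {X : PointField 4} (hX : X.SmoothOn (box I J))
    {x : Pt 4} (hx : x ∈ box I J) (u : ℝ) (p : Pt 4) (q : Fin 4 → Fin 4 → ℝ) (μ : Fin 4) :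
    prolong2 X x u p q μ μ =
      (totalD (dX μ X.η) μ x u p + p μ * totalD (dU X.η) μ x u p
        - ∑ κ, (totalD (dX μ fun y => X.ξ y κ) μ x u p
          + p μ * totalD (dU fun y => X.ξ y κ) μ x u p) * p κ)
      + (dU X.η (x, u) - ∑ κ, dU (fun y => X.ξ y κ) (x, u) * p κ) * q μ μ
      - 2 * ∑ κ, (dX μ (fun y => X.ξ y κ) (x, u) + p μ * dU (fun y => X.ξ y κ) (x, u)) * q μ κ := by
  unfold prolong2
  rw [totalD1_prolong1 hΩ hX hx]
  simp only [totalD_eq (fun y => X.ξ y _), Finset.sum_add_distrib, add_mul]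
  have e : ∀ κ, q μ μ * dU (fun y => X.ξ y κ) (x, u) * p κ =
    dU (fun y => X.ξ y κ) (x, u) * p κ * q μ μ := fun κ => by ring
  simp only [e, sub_mul, Finset.sum_mul]
  ring

lemma mem_offdiag_exists (κ : Fin 4) : ∃ μ : Fin 4, μ ≠ κ := ⟨κ + 1, by fin_cases κ <;> decide⟩

/-- The Lie condition at a point, in terms of the first and second partial derivatives. -/
lemma lie_condition (hI : IsOpen I) (hJ : ∀ i, IsOpen (J i)) (hN : IsScaleFactorOn I N)
    (ha : ∀ i, IsScaleFactorOn I (a i)) (hV : ContDiffOn ℝ ∞ V (box I J)) {X : PointField 4}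
    (hX : IsLieSymmetry (bianchiI N a) V (box I J) X) {x : Pt 4} (hx : x ∈ box I J) (u : ℝ)
    (p : Pt 4) (q : Fin 4 → Fin 4 → ℝ) (hq : ∀ μ ν, q μ ν = q ν μ)
    (hc : ∑ μ, invDiag N a μ (x 0) * q μ μ = dragCoeff N a (x 0) * p 0 + V x * u) :
    (∑ μ, invDiag N a μ (x 0) * prolong2 X x u p q μ μ
        - (deriv (dragCoeff N a) (x 0) * X.ξ (x, u) 0 * p 0
          + dragCoeff N a (x 0) * prolong1 X (x, u, p) 0)
        - (fderiv ℝ V x (X.ξ (x, u)) * u + V x * X.η (x, u)))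
      + ∑ μ, -(2 * hubble N a μ (x 0) * invDiag N a μ (x 0)) * X.ξ (x, u) 0 * q μ μ = 0 := by
  have h := hX.2 x hx u p q hq (by rw [kgH_bianchiI hI hN ha hx.1, hc]; ring)
  rw [fderiv_kgH hI hJ hN ha hV hx, Finset.sum_add_distrib] at h
  linarith

/-- Applied before anything is known about X: `P` collects the terms free of `q` and `lam` is the
multiplier. The dependence of both on `p` is what forces X to be affine in `u`. -/
lemma lie_offdiag (hI : IsOpen I) (hJ : ∀ i, IsOpen (J i)) (hN : IsScaleFactorOn I N)
    (ha : ∀ i, IsScaleFactorOn I (a i)) (hV : ContDiffOn ℝ ∞ V (box I J)) {X : PointField 4}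
    (hX : IsLieSymmetry (bianchiI N a) V (box I J) X) {x : Pt 4} (hx : x ∈ box I J) (u : ℝ)
    (p : Pt 4) :
    ∃ lam P : ℝ, P + lam * (dragCoeff N a (x 0) * p 0 + V x * u) = 0 ∧
    P = ∑ μ, invDiag N a μ (x 0) * (totalD (dX μ X.η) μ x u p + p μ * totalD (dU X.η) μ x u p
        - ∑ κ, (totalD (dX μ fun y => X.ξ y κ) μ x u p
          + p μ * totalD (dU fun y => X.ξ y κ) μ x u p) * p κ)
        - (deriv (dragCoeff N a) (x 0) * X.ξ (x, u) 0 * p 0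
          + dragCoeff N a (x 0) * prolong1 X (x, u, p) 0)
        - (fderiv ℝ V x (X.ξ (x, u)) * u + V x * X.η (x, u)) ∧
    lam = (dU X.η (x, u) - ∑ κ, dU (fun y => X.ξ y κ) (x, u) * p κ)
        - 2 * (hubble N a 0 (x 0) * X.ξ (x, u) 0
          + (dX 0 (fun y => X.ξ y 0) (x, u) + p 0 * dU (fun y => X.ξ y 0) (x, u))) ∧
    ∀ μ κ, μ ≠ κ → invDiag N a μ (x 0) * (dX μ (fun y => X.ξ y κ) (x, u)
        + p μ * dU (fun y => X.ξ y κ) (x, u))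
      + invDiag N a κ (x 0) * (dX κ (fun y => X.ξ y μ) (x, u)
        + p κ * dU (fun y => X.ξ y μ) (x, u)) = 0 := by
  have hs := invDiag_ne_zero hN ha hx.1
  have key := (affine_on_hyperplane_iff hs
    (∑ μ, invDiag N a μ (x 0) * (totalD (dX μ X.η) μ x u p + p μ * totalD (dU X.η) μ x u p
        - ∑ κ, (totalD (dX μ fun y => X.ξ y κ) μ x u p
          + p μ * totalD (dU fun y => X.ξ y κ) μ x u p) * p κ)
        - (deriv (dragCoeff N a) (x 0) * X.ξ (x, u) 0 * p 0
          + dragCoeff N a (x 0) * prolong1 X (x, u, p) 0)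
        - (fderiv ℝ V x (X.ξ (x, u)) * u + V x * X.η (x, u)))
    (dragCoeff N a (x 0) * p 0 + V x * u)
    (fun μ => -(2 * hubble N a μ (x 0) * invDiag N a μ (x 0)) * X.ξ (x, u) 0
      + invDiag N a μ (x 0) * (dU X.η (x, u) - ∑ κ, dU (fun y => X.ξ y κ) (x, u) * p κ))
    (fun μ κ => dX μ (fun y => X.ξ y κ) (x, u) + p μ * dU (fun y => X.ξ y κ) (x, u))).1 (by
      intro q hq hc
      rw [← lie_condition hI hJ hN ha hV hX hx u p q hq hc]
      simp only [prolong2_diag (isOpen_box hI hJ) hX.1 hx]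
      have := sum_affine_split (fun μ => invDiag N a μ (x 0))
        (fun μ => totalD (dX μ X.η) μ x u p + p μ * totalD (dU X.η) μ x u p
          - ∑ κ, (totalD (dX μ fun y => X.ξ y κ) μ x u p
            + p μ * totalD (dU fun y => X.ξ y κ) μ x u p) * p κ)
        (fun μ => -(2 * hubble N a μ (x 0) * invDiag N a μ (x 0)) * X.ξ (x, u) 0)
        (dU X.η (x, u) - ∑ κ, dU (fun y => X.ξ y κ) (x, u) * p κ)
        (fun μ κ => dX μ (fun y => X.ξ y κ) (x, u) + p μ * dU (fun y => X.ξ y κ) (x, u)) q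
      linear_combination -this)
  obtain ⟨h1, -, h3⟩ := key
  refine ⟨_, _, h3, rfl, ?_, h1⟩
  have := hs 0
  field_simp
  ring

/-- The off-diagonal condition is affine in `p`. For μ ≠ κ the coefficient of p_μ is g^{μμ}∂_uξ^κ,
isolated by comparing p = 0 with p = e_μ; such a μ exists because the dimension exceeds one. -/
lemma lie_dU_ξ (hI : IsOpen I) (hJ : ∀ i, IsOpen (J i)) (hN : IsScaleFactorOn I N)
    (ha : ∀ i, IsScaleFactorOn I (a i)) (hV : ContDiffOn ℝ ∞ V (box I J)) {X : PointField 4}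
    (hX : IsLieSymmetry (bianchiI N a) V (box I J) X) {x : Pt 4} (hx : x ∈ box I J) (u : ℝ)
    (κ : Fin 4) : dU (fun y => X.ξ y κ) (x, u) = 0 := by
  obtain ⟨μ, hμ⟩ := mem_offdiag_exists κ
  obtain ⟨_, _, -, -, -, h0⟩ := lie_offdiag hI hJ hN ha hV hX hx u 0
  obtain ⟨_, _, -, -, -, h1⟩ := lie_offdiag hI hJ hN ha hV hX hx u (Pi.single μ 1)
  have e0 := h0 μ κ hμ
  have e1 := h1 μ κ hμ
  simp only [Pi.single_eq_same, Pi.single_eq_of_ne hμ.symm, Pi.zero_apply] at e0 e1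
  have := invDiag_ne_zero hN ha hx.1 μ
  have h2 : invDiag N a μ (x 0) * dU (fun y => X.ξ y κ) (x, u) = 0 := by linarith
  exact (mul_eq_zero.1 h2).resolve_left this

/-- A function of `(x, u)` with vanishing `u`-derivative does not depend on `u`. -/
lemma eq_of_dU_eq_zero {n : ℕ} {Ω : Set (Pt n)} (hΩ : IsOpen Ω) {F : Pt n × ℝ → ℝ}
    (hF : ContDiffOn ℝ ∞ F (Ω ×ˢ Set.univ)) {x : Pt n} (hx : x ∈ Ω)
    (h : ∀ u, dU F (x, u) = 0) (u : ℝ) : F (x, u) = F (x, 0) := by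
  have hd : ∀ u, HasDerivAt (fun u => F (x, u)) 0 u := by
    intro u
    have h1 := (differentiableAt_of_smooth (isOpen_prod_univ hΩ) hF
      (show (x, u) ∈ _ from ⟨hx, trivial⟩)).hasFDerivAt
    have h2 : HasDerivAt (fun u : ℝ => ((x, u) : Pt n × ℝ)) (0, 1) u :=
      (hasDerivAt_const u x).prodMk (hasDerivAt_id u)
    have := h1.comp_hasDerivAt u h2
    have h3 := h u
    unfold dU at h3
    rwa [h3] at this
  exact is_const_of_deriv_eq_zero (fun u => (hd u).differentiableAt) (fun u => (hd u).deriv) u 0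

/-- Once ξ is free of `u`, the only term quadratic in p_1 is g^{11}η_{uu}p_1². A second difference
in p_1 extracts it. -/
lemma lie_dU_dU_η (hI : IsOpen I) (hJ : ∀ i, IsOpen (J i)) (hN : IsScaleFactorOn I N)
    (ha : ∀ i, IsScaleFactorOn I (a i)) (hV : ContDiffOn ℝ ∞ V (box I J)) {X : PointField 4}
    (hX : IsLieSymmetry (bianchiI N a) V (box I J) X) {x : Pt 4} (hx : x ∈ box I J) (u : ℝ) :
    dU (dU X.η) (x, u) = 0 := by
  have hΩ := isOpen_box hI hJ
  have hξ : ∀ κ, ∀ y ∈ box I J, ∀ v, X.ξ (y, v) κ = X.ξ (y, 0) κ := fun κ y hy v =>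
    eq_of_dU_eq_zero hΩ (hX.1.comp_ξ κ) hy (fun u => lie_dU_ξ hI hJ hN ha hV hX hy u κ) v
  have hζ : ∀ κ, ContDiffOn ℝ ∞ (fun y => X.ξ (y, 0) κ) (box I J) := fun κ =>
    (hX.1.comp_ξ κ).comp (contDiff_id.prodMk contDiff_const).contDiffOn
      fun y hy => ⟨hy, trivial⟩
  have e3 : ∀ μ κ, ∀ y ∈ box I J, ∀ v, dX μ (fun y => X.ξ y κ) (y, v) =
      pd μ (fun y => X.ξ (y, 0) κ) y := fun μ κ y hy v => by
    rw [dX_congr hΩ (G := fun z => X.ξ (z.1, 0) κ) (fun y hy u => hξ κ y hy u) hy,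
      dX_base (b := fun y => X.ξ (y, 0) κ) (differentiableAt_of_smooth hΩ (hζ κ) hy)]
  have f3 : ∀ μ κ p, totalD (dX μ fun y => X.ξ y κ) μ x u p =
      pd μ (pd μ fun y => X.ξ (y, 0) κ) x := fun μ κ p => by
    have hd : DifferentiableAt ℝ (pd μ fun y => X.ξ (y, 0) κ) x :=
      differentiableAt_of_smooth hΩ (smooth_pd hΩ (hζ κ) μ) hx
    rw [totalD_eq, dX_congr hΩ (G := fun z => pd μ (fun y => X.ξ (y, 0) κ) z.1) (e3 μ κ) hx,
      dU_congr hΩ (G := fun z => pd μ (fun y => X.ξ (y, 0) κ) z.1) (e3 μ κ) hx, dX_base hd,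
      dU_base hd]
    ring
  have f4 : ∀ μ κ p, totalD (dU fun y => X.ξ y κ) μ x u p = 0 := fun μ κ p => by
    have hc : DifferentiableAt ℝ (fun _ : Pt 4 => (0 : ℝ)) x := differentiableAt_const 0
    have e4 : ∀ y ∈ box I J, ∀ v, dU (fun y => X.ξ y κ) (y, v) = 0 := fun y hy v =>
      lie_dU_ξ hI hJ hN ha hV hX hy v κ
    rw [totalD_eq, dX_congr hΩ (G := fun z => (fun _ => (0 : ℝ)) z.1) e4 hx,
      dU_congr hΩ (G := fun z => (fun _ => (0 : ℝ)) z.1) e4 hx, dX_base hc, dU_base hc]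
    simp
  have eU : ∀ κ, dU (fun y => X.ξ y κ) (x, u) = 0 := fun κ => lie_dU_ξ hI hJ hN ha hV hX hx u κ
  -- The direction is spatial, so p_0 = 0 and the right-hand side of the hyperplane equation is the
  -- same for r = 1, −1, 0.
  have key : ∀ r : ℝ, _ := fun r =>
    lie_offdiag hI hJ hN ha hV hX hx u (Pi.single (1 : Fin 4) r)
  obtain ⟨l1, P1, h1, k1, m1, -⟩ := key 1
  obtain ⟨l2, P2, h2, k2, m2, -⟩ := key (-1)
  obtain ⟨l3, P3, h3, k3, m3, -⟩ := key 0
  simp only [eU, zero_mul, mul_zero, Finset.sum_const_zero, add_zero] at m1 m2 m3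
  simp only [f3, f4, totalD_eq, prolong1_eq, eU, Fin.sum_univ_four] at k1 k2 k3
  simp at k1 k2 k3 h1 h2 h3
  have hs := invDiag_ne_zero hN ha hx.1 1
  have : 2 * (invDiag N a 1 (x 0) * dU (dU X.η) (x, u)) = 0 := by
    rw [m1] at h1; rw [m2] at h2; rw [m3] at h3
    linear_combination h1 + h2 - 2 * h3 - k1 - k2 + 2 * k3
  exact (mul_eq_zero.1 ((mul_eq_zero.1 this).resolve_left two_ne_zero)).resolve_left hs

end determining


/-! ### Fields affine in the unknown -/

section affine

variable {I : Set ℝ} {J : Fin 3 → Set ℝ} {N : ℝ → ℝ} {a : Fin 3 → ℝ → ℝ} {V : Pt 4 → ℝ}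

/-- `X = ζ(x) ∂ + (α(x) u + b(x)) ∂_u` on `Ω`, with smooth coefficients. -/
structure IsAffineField {n : ℕ} (Ω : Set (Pt n)) (X : PointField n) (ζ : Pt n → Pt n)
    (α b : Pt n → ℝ) : Prop where
  smooth_ζ : ∀ κ, ContDiffOn ℝ ∞ (fun y => ζ y κ) Ω
  smooth_α : ContDiffOn ℝ ∞ α Ω
  smooth_b : ContDiffOn ℝ ∞ b Ω
  ξ_eq : ∀ y ∈ Ω, ∀ u, X.ξ (y, u) = ζ y
  η_eq : ∀ y ∈ Ω, ∀ u, X.η (y, u) = α y * u + b y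

lemma IsAffineField.smoothOn {n : ℕ} {Ω : Set (Pt n)} {X : PointField n} {ζ : Pt n → Pt n}
    {α b : Pt n → ℝ} (h : IsAffineField Ω X ζ α b) : X.SmoothOn Ω := by
  have hfst : Set.MapsTo (Prod.fst : Pt n × ℝ → Pt n) (Ω ×ˢ Set.univ) Ω := fun z hz => hz.1
  constructor
  · have : ContDiffOn ℝ ∞ (fun z : Pt n × ℝ => ζ z.1) (Ω ×ˢ Set.univ) :=
      contDiffOn_pi.2 fun κ => (h.smooth_ζ κ).comp contDiff_fst.contDiffOn hfst
    exact this.congr fun z hz => h.ξ_eq z.1 hz.1 z.2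
  · have : ContDiffOn ℝ ∞ (fun z : Pt n × ℝ => α z.1 * z.2 + b z.1) (Ω ×ˢ Set.univ) :=
      ((h.smooth_α.comp contDiff_fst.contDiffOn hfst).mul contDiff_snd.contDiffOn).add
        (h.smooth_b.comp contDiff_fst.contDiffOn hfst)
    exact this.congr fun z hz => h.η_eq z.1 hz.1 z.2

/-- The part of the Lie condition that is free of second derivatives of the unknown. -/
noncomputable def lieRest (N : ℝ → ℝ) (a : Fin 3 → ℝ → ℝ) (V : Pt 4 → ℝ) (ζ : Pt 4 → Pt 4)
    (α b : Pt 4 → ℝ) (x : Pt 4) (u : ℝ) (p : Pt 4) : ℝ :=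
  ∑ μ, invDiag N a μ (x 0) * (pd μ (pd μ α) x * u + pd μ (pd μ b) x + 2 * p μ * pd μ α x
      - ∑ κ, pd μ (pd μ fun y => ζ y κ) x * p κ)
    - (deriv (dragCoeff N a) (x 0) * ζ x 0 * p 0
      + dragCoeff N a (x 0) * (pd 0 α x * u + pd 0 b x + p 0 * α x
        - ∑ κ, pd 0 (fun y => ζ y κ) x * p κ))
    - (fderiv ℝ V x (ζ x) * u + V x * (α x * u + b x))

/-- `affine_on_hyperplane_iff` at each (x, u, p). The off-diagonal and diagonal conditions together
are the conformal Killing equations, with factor ψ = (N'/N)ζ⁰ + ∂_0ζ⁰, and the multiplier becomes α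
− 2ψ. -/
lemma isLieSymmetry_affine_iff (hI : IsOpen I) (hJ : ∀ i, IsOpen (J i)) (hN : IsScaleFactorOn I N)
    (ha : ∀ i, IsScaleFactorOn I (a i)) (hV : ContDiffOn ℝ ∞ V (box I J)) {X : PointField 4}
    {ζ : Pt 4 → Pt 4} {α b : Pt 4 → ℝ} (hX : IsAffineField (box I J) X ζ α b) :
    IsLieSymmetry (bianchiI N a) V (box I J) X ↔ ∀ x ∈ box I J,
      (∀ μ κ, μ ≠ κ → invDiag N a μ (x 0) * pd μ (fun y => ζ y κ) x
        + invDiag N a κ (x 0) * pd κ (fun y => ζ y μ) x = 0) ∧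
      (∀ μ, hubble N a μ (x 0) * ζ x 0 + pd μ (fun y => ζ y μ) x =
        hubble N a 0 (x 0) * ζ x 0 + pd 0 (fun y => ζ y 0) x) ∧
      ∀ u p, lieRest N a V ζ α b x u p
        + (α x - 2 * (hubble N a 0 (x 0) * ζ x 0 + pd 0 (fun y => ζ y 0) x))
          * (dragCoeff N a (x 0) * p 0 + V x * u) = 0 := by
  have hΩ := isOpen_box hI hJ
  have hsm := hX.smoothOn
  have pt : ∀ x ∈ box I J, ∀ (u : ℝ) (p : Pt 4),
      (∀ q : Fin 4 → Fin 4 → ℝ, (∀ μ ν, q μ ν = q ν μ) →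
        kgH (bianchiI N a) V (x, u, p, q) = 0 →
          fderiv ℝ (kgH (bianchiI N a) V) (x, u, p, q)
            (X.ξ (x, u), X.η (x, u), prolong1 X (x, u, p), prolong2 X x u p q) = 0) ↔
      (∀ μ κ, μ ≠ κ → invDiag N a μ (x 0) * pd μ (fun y => ζ y κ) x
        + invDiag N a κ (x 0) * pd κ (fun y => ζ y μ) x = 0) ∧
      (∀ μ, hubble N a μ (x 0) * ζ x 0 + pd μ (fun y => ζ y μ) x =
        hubble N a 0 (x 0) * ζ x 0 + pd 0 (fun y => ζ y 0) x) ∧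
      lieRest N a V ζ α b x u p
        + (α x - 2 * (hubble N a 0 (x 0) * ζ x 0 + pd 0 (fun y => ζ y 0) x))
          * (dragCoeff N a (x 0) * p 0 + V x * u) = 0 := by
    intro x hx u p
    have hs := invDiag_ne_zero hN ha hx.1
    have key := affine_on_hyperplane_iff hs (lieRest N a V ζ α b x u p)
      (dragCoeff N a (x 0) * p 0 + V x * u)
      (fun μ => -(2 * hubble N a μ (x 0) * invDiag N a μ (x 0)) * ζ x 0
        + invDiag N a μ (x 0) * α x) (fun μ κ => pd μ (fun y => ζ y κ) x)
    have hlam : (-(2 * hubble N a 0 (x 0) * invDiag N a 0 (x 0)) * ζ x 0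
        + invDiag N a 0 (x 0) * α x
        - 2 * invDiag N a 0 (x 0) * pd 0 (fun y => ζ y 0) x) / invDiag N a 0 (x 0)
        = α x - 2 * (hubble N a 0 (x 0) * ζ x 0 + pd 0 (fun y => ζ y 0) x) := by
      have := hs 0
      field_simp
      ring
    simp only [hlam] at key
    have hd : ∀ μ, (-(2 * hubble N a μ (x 0) * invDiag N a μ (x 0)) * ζ x 0
        + invDiag N a μ (x 0) * α x - 2 * invDiag N a μ (x 0) * pd μ (fun y => ζ y μ) x =
        (α x - 2 * (hubble N a 0 (x 0) * ζ x 0 + pd 0 (fun y => ζ y 0) x)) * invDiag N a μ (x 0)) ↔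
        hubble N a μ (x 0) * ζ x 0 + pd μ (fun y => ζ y μ) x =
        hubble N a 0 (x 0) * ζ x 0 + pd 0 (fun y => ζ y 0) x := by
      intro μ
      constructor
      · intro h
        apply mul_left_cancel₀ (hs μ)
        linear_combination (-1 / 2) * h
      · intro h
        linear_combination (-2 * invDiag N a μ (x 0)) * h
    simp only [hd] at key
    rw [← key]
    refine forall_congr' fun q => imp_congr_right fun hq => ?_
    rw [kgH_bianchiI hI hN ha hx.1, fderiv_kgH hI hJ hN ha hV hx, hX.ξ_eq x hx, hX.η_eq x hx,
      prolong1_affine hΩ hX.smooth_ζ hX.smooth_α hX.smooth_b hX.ξ_eq hX.η_eq hx]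
    simp only [prolong2_affine hΩ hX.smooth_ζ hX.smooth_α hX.smooth_b hsm hX.ξ_eq hX.η_eq hx]
    have hc : (∑ μ, invDiag N a μ (x 0) * q μ μ - dragCoeff N a (x 0) * p 0 - V x * u = 0) ↔
        ∑ μ, invDiag N a μ (x 0) * q μ μ = dragCoeff N a (x 0) * p 0 + V x * u := by
      constructor <;> intro h <;> linarith
    rw [hc]
    refine imp_congr_right fun _ => ?_
    have e : ∀ A B : ℝ, A = B → (A = 0 ↔ B = 0) := by rintro A B rfl; rfl
    apply e
    have := sum_affine_split (fun μ => invDiag N a μ (x 0))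
      (fun μ => pd μ (pd μ α) x * u + pd μ (pd μ b) x + 2 * p μ * pd μ α x
        - ∑ κ, pd μ (pd μ fun y => ζ y κ) x * p κ)
      (fun μ => -(2 * hubble N a μ (x 0) * invDiag N a μ (x 0)) * ζ x 0) (α x)
      (fun μ κ => pd μ (fun y => ζ y κ) x) q
    unfold lieRest
    have h2 : ∑ μ, (-(2 * hubble N a μ (x 0) * invDiag N a μ (x 0)) * ζ x 0 * q μ μ
          + invDiag N a μ (x 0) * (pd μ (pd μ α) x * u + pd μ (pd μ b) x + 2 * p μ * pd μ α x
            + q μ μ * α x - ∑ κ, (pd μ (pd μ fun y => ζ y κ) x * p κ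
              + 2 * pd μ (fun y => ζ y κ) x * q μ κ))) =
        ∑ μ, invDiag N a μ (x 0) * ((pd μ (pd μ α) x * u + pd μ (pd μ b) x + 2 * p μ * pd μ α x
        - ∑ κ, pd μ (pd μ fun y => ζ y κ) x * p κ) + α x * q μ μ
          - 2 * ∑ κ, pd μ (fun y => ζ y κ) x * q μ κ)
        + ∑ μ, -(2 * hubble N a μ (x 0) * invDiag N a μ (x 0)) * ζ x 0 * q μ μ := by
      rw [← Finset.sum_add_distrib]
      refine Finset.sum_congr rfl fun μ _ => ?_
      rw [Finset.sum_add_distrib, Finset.mul_sum]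
      simp only [mul_assoc]
      ring
    rw [h2, this]
    ring
  constructor
  · intro h x hx
    have h1 := fun u p => (pt x hx u p).1 fun q hq hc => h.2 x hx u p q hq hc
    exact ⟨(h1 0 0).1, (h1 0 0).2.1, fun u p => (h1 u p).2.2⟩
  · intro h
    refine ⟨hsm, fun x hx u p => ?_⟩
    obtain ⟨h1, h2, h3⟩ := h x hx
    exact (pt x hx u p).2 ⟨h1, h2, h3 u p⟩

/-- Lie point symmetries of the Klein-Gordon equation are affine in the unknown. -/
lemma IsLieSymmetry.exists_affine (hI : IsOpen I) (hJ : ∀ i, IsOpen (J i))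
    (hN : IsScaleFactorOn I N) (ha : ∀ i, IsScaleFactorOn I (a i))
    (hV : ContDiffOn ℝ ∞ V (box I J)) {X : PointField 4}
    (hX : IsLieSymmetry (bianchiI N a) V (box I J) X) :
    ∃ ζ α b, IsAffineField (box I J) X ζ α b := by
  have hΩ := isOpen_box hI hJ
  have hsec : ∀ F : Pt 4 × ℝ → ℝ, ContDiffOn ℝ ∞ F (box I J ×ˢ Set.univ) →
      ContDiffOn ℝ ∞ (fun y => F (y, 0)) (box I J) := fun F hF =>
    hF.comp (contDiff_id.prodMk contDiff_const).contDiffOn fun y hy => ⟨hy, trivial⟩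
  refine ⟨fun y => X.ξ (y, 0), fun y => dU X.η (y, 0), fun y => X.η (y, 0),
    fun κ => hsec _ (hX.1.comp_ξ κ), hsec _ (smooth_dU hΩ hX.1.2), hsec _ hX.1.2, ?_, ?_⟩
  · intro y hy u
    ext κ
    exact eq_of_dU_eq_zero hΩ (hX.1.comp_ξ κ) hy (fun u => lie_dU_ξ hI hJ hN ha hV hX hy u κ) u
  · intro y hy u
    have h1 : ∀ u, dU X.η (y, u) = dU X.η (y, 0) :=
      eq_of_dU_eq_zero hΩ (smooth_dU hΩ hX.1.2) hy fun u => lie_dU_dU_η hI hJ hN ha hV hX hy u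
    -- Since η_u is constant in `u`, subtracting its linear part from η leaves a function with zero
    -- derivative.
    have hd : ∀ u, HasDerivAt (fun u => X.η (y, u) - dU X.η (y, 0) * u) 0 u := by
      intro u
      have h2 := (differentiableAt_of_smooth (isOpen_prod_univ hΩ) hX.1.2
        (show (y, u) ∈ _ from ⟨hy, trivial⟩)).hasFDerivAt
      have h3 : HasDerivAt (fun u : ℝ => ((y, u) : Pt 4 × ℝ)) (0, 1) u :=
        (hasDerivAt_const u y).prodMk (hasDerivAt_id u)
      have h4 := (h2.comp_hasDerivAt u h3).sub ((hasDerivAt_id u).const_mul (dU X.η (y, 0)))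
      refine h4.congr_deriv ?_
      have := h1 u
      unfold dU at this ⊢
      rw [this]; ring
    have := is_const_of_deriv_eq_zero (fun u => (hd u).differentiableAt) (fun u => (hd u).deriv) u 0
    simp only [mul_zero, sub_zero] at this
    linarith

end affine


/-! ### Dilations, translations and the equation of the potential -/

section criterion

variable {I : Set ℝ} {J : Fin 3 → Set ℝ} {N : ℝ → ℝ} {a : Fin 3 → ℝ → ℝ} {V : Pt 4 → ℝ}

/-- The field `T(t) ∂_t + (lᵢ xᵢ + mᵢ) ∂ᵢ`. -/
def affField (T : ℝ → ℝ) (l m : Fin 3 → ℝ) : Pt 4 → Pt 4 := fun p =>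
  Fin.cons (T (p 0)) (fun i => l i * p i.succ + m i)

@[simp] lemma affField_zero (T : ℝ → ℝ) (l m : Fin 3 → ℝ) (p : Pt 4) :
    affField T l m p 0 = T (p 0) := rfl

@[simp] lemma affField_succ (T : ℝ → ℝ) (l m : Fin 3 → ℝ) (p : Pt 4) (i : Fin 3) :
    affField T l m p i.succ = l i * p i.succ + m i := rfl

/-- `T(t) ∂_t + lᵢ xᵢ ∂ᵢ` is a conformal Killing vector with factor `ψ(t)`. -/
structure IsDilation (I : Set ℝ) (N : ℝ → ℝ) (a : Fin 3 → ℝ → ℝ) (T : ℝ → ℝ) (l : Fin 3 → ℝ)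
    (ψ : ℝ → ℝ) : Prop where
  smooth_T : ContDiffOn ℝ ∞ T I
  smooth_ψ : ContDiffOn ℝ ∞ ψ I
  time : ∀ t ∈ I, deriv T t + logDeriv N t * T t = ψ t
  space : ∀ t ∈ I, ∀ i, l i + logDeriv (a i) t * T t = ψ t

/-- The wave operator on functions of time. -/
noncomputable def waveTime (N : ℝ → ℝ) (a : Fin 3 → ℝ → ℝ) (ψ : ℝ → ℝ) (t : ℝ) : ℝ :=
  -(1 / N t ^ 2) * (deriv (deriv ψ) t
    + (logDeriv (a 0) t + logDeriv (a 1) t + logDeriv (a 2) t - logDeriv N t) * deriv ψ t)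

/-- The equation `ξ(V) + 2ψV + Δψ = 0`. -/
def PotentialEq (N : ℝ → ℝ) (a : Fin 3 → ℝ → ℝ) (V : Pt 4 → ℝ) (T : ℝ → ℝ) (l m : Fin 3 → ℝ)
    (ψ : ℝ → ℝ) (Ω : Set (Pt 4)) : Prop :=
  ∀ x ∈ Ω, fderiv ℝ V x (affField T l m x) + 2 * ψ (x 0) * V x + waveTime N a ψ (x 0) = 0

lemma smooth_affField {T : ℝ → ℝ} (hT : ContDiffOn ℝ ∞ T I) (l m : Fin 3 → ℝ) (κ : Fin 4) :
    ContDiffOn ℝ ∞ (fun y => affField T l m y κ) (box I J) := by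
  refine Fin.cases ?_ (fun i => ?_) κ
  · exact smooth_time hT
  · simp only [affField_succ]
    exact ((contDiff_const.mul (contDiff_apply ℝ ℝ i.succ)).add contDiff_const).contDiffOn

lemma pd_affField_zero {T : ℝ → ℝ} (hI : IsOpen I) (hT : ContDiffOn ℝ ∞ T I) (l m : Fin 3 → ℝ)
    {x : Pt 4} (hx : x 0 ∈ I) (μ : Fin 4) :
    pd μ (fun y => affField T l m y 0) x = if μ = 0 then deriv T (x 0) else 0 :=
  pd_time (differentiableAt_of_smooth hI hT hx) μ

lemma pd_affField_succ (T : ℝ → ℝ) (l m : Fin 3 → ℝ) (x : Pt 4) (i : Fin 3) (μ : Fin 4) :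
    pd μ (fun y => affField T l m y i.succ) x = if μ = i.succ then l i else 0 := by
  have h : HasFDerivAt (fun y : Pt 4 => l i * y i.succ + m i)
      (l i • (ContinuousLinearMap.proj (R := ℝ) (φ := fun _ : Fin 4 => ℝ) i.succ)) x :=
    ((hasFDerivAt_apply i.succ x).const_mul (l i)).add_const (m i)
  simp only [affField_succ]
  unfold pd
  rw [h.fderiv]
  by_cases hμ : μ = i.succ
  · subst hμ; simp
  · simp [hμ, Ne.symm hμ]

lemma pd_pd_affField_zero {T : ℝ → ℝ} (hI : IsOpen I) (hJ : ∀ i, IsOpen (J i))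
    (hT : ContDiffOn ℝ ∞ T I) (l m : Fin 3 → ℝ) {x : Pt 4} (hx : x ∈ box I J) (μ : Fin 4) :
    pd μ (pd μ fun y => affField T l m y 0) x = if μ = 0 then deriv (deriv T) (x 0) else 0 := by
  by_cases hμ : μ = 0
  · subst hμ
    rw [pd_congr (isOpen_box hI hJ) (g := fun y : Pt 4 => deriv T (y 0))
      (fun y hy => by rw [pd_affField_zero hI hT l m hy.1]; simp) hx,
      pd_time (differentiableAt_of_smooth hI (smooth_deriv hI hT) hx.1)]
  · rw [pd_congr (isOpen_box hI hJ) (g := fun _ => (0 : ℝ))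
      (fun y hy => by rw [pd_affField_zero hI hT l m hy.1]; simp [hμ]) hx]
    simp [hμ]

lemma pd_pd_affField_succ (T : ℝ → ℝ) (l m : Fin 3 → ℝ) (x : Pt 4) (i : Fin 3) (μ : Fin 4) :
    pd μ (pd μ fun y => affField T l m y i.succ) x = 0 := by
  have : (pd μ fun y => affField T l m y i.succ) = fun _ => if μ = i.succ then l i else 0 :=
    funext fun y => pd_affField_succ T l m y i μ
  rw [this]; simp

/-- The differentiated conformal equations, here and in `IsDilation.deriv_space`, remove T'' and the
derivatives of the Hubble rates from the Lie condition. -/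
lemma IsDilation.deriv_time (hI : IsOpen I) (hN : IsScaleFactorOn I N) {T ψ : ℝ → ℝ}
    {l : Fin 3 → ℝ} (h : IsDilation I N a T l ψ) {t : ℝ} (ht : t ∈ I) :
    deriv (deriv T) t + deriv (logDeriv N) t * T t + logDeriv N t * deriv T t = deriv ψ t := by
  have h1 : (fun t => deriv T t + logDeriv N t * T t) =ᶠ[nhds t] ψ := by
    filter_upwards [hI.mem_nhds ht] with s hs using h.time s hs
  rw [← h1.deriv_eq]
  have d1 := (differentiableAt_of_smooth hI (smooth_deriv hI h.smooth_T) ht).hasDerivAt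
  have d2 := (differentiableAt_of_smooth hI (smooth_logDeriv hI hN) ht).hasDerivAt
  have d3 := (differentiableAt_of_smooth hI h.smooth_T ht).hasDerivAt
  exact ((d1.add (d2.mul d3)).deriv.trans (by ring)).symm

lemma IsDilation.deriv_space (hI : IsOpen I) (ha : ∀ i, IsScaleFactorOn I (a i)) {T ψ : ℝ → ℝ}
    {l : Fin 3 → ℝ} (h : IsDilation I N a T l ψ) {t : ℝ} (ht : t ∈ I) (i : Fin 3) :
    deriv (logDeriv (a i)) t * T t + logDeriv (a i) t * deriv T t = deriv ψ t := by
  have h1 : (fun t => l i + logDeriv (a i) t * T t) =ᶠ[nhds t] ψ := by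
    filter_upwards [hI.mem_nhds ht] with s hs using h.space s hs i
  rw [← h1.deriv_eq]
  have d2 := (differentiableAt_of_smooth hI (smooth_logDeriv hI (ha i)) ht).hasDerivAt
  have d3 := (differentiableAt_of_smooth hI h.smooth_T ht).hasDerivAt
  exact (((d2.mul d3).const_add (l i)).deriv.trans (by ring)).symm

lemma deriv_dragCoeff (hI : IsOpen I) (hN : IsScaleFactorOn I N)
    (ha : ∀ i, IsScaleFactorOn I (a i)) {t : ℝ} (ht : t ∈ I) :
    deriv (dragCoeff N a) t = -2 * logDeriv N t * dragCoeff N a t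
      + 1 / N t ^ 2 * (deriv (logDeriv (a 0)) t + deriv (logDeriv (a 1)) t
        + deriv (logDeriv (a 2)) t - deriv (logDeriv N) t) := by
  have hd : ∀ i, HasDerivAt (logDeriv (a i)) (deriv (logDeriv (a i)) t) t := fun i =>
    (differentiableAt_of_smooth hI (smooth_logDeriv hI (ha i)) ht).hasDerivAt
  have hn : HasDerivAt (logDeriv N) (deriv (logDeriv N) t) t :=
    (differentiableAt_of_smooth hI (smooth_logDeriv hI hN) ht).hasDerivAt
  have h0 := (hasDerivAt_invDiag hI hN ha ht 0).neg.mul ((((hd 0).add (hd 1)).add (hd 2)).sub hn)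
  have : dragCoeff N a = (-invDiag N a 0) *
      (logDeriv (a 0) + logDeriv (a 1) + logDeriv (a 2) - logDeriv N) := by
    funext t; simp [dragCoeff]
  rw [this, h0.deriv]
  simp
  ring

/-- All contributions of T to the coefficient of p_0 collapse to 2g^{00}ψ': the three differentiated
spatial equations minus the one in time leave 2ψ'. This is where dimension four gives the weight −ψ
for the unknown. -/
lemma lieRest_affField (hI : IsOpen I) (hJ : ∀ i, IsOpen (J i)) (hN : IsScaleFactorOn I N)
    (ha : ∀ i, IsScaleFactorOn I (a i)) {T ψ : ℝ → ℝ} {l m : Fin 3 → ℝ}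
    (hK : IsDilation I N a T l ψ) {α b : Pt 4 → ℝ} {x : Pt 4} (hx : x ∈ box I J) (u : ℝ)
    (p : Pt 4) :
    lieRest N a V (affField T l m) α b x u p
        + (α x - 2 * ψ (x 0)) * (dragCoeff N a (x 0) * p 0 + V x * u) =
      (∑ μ, invDiag N a μ (x 0) * pd μ (pd μ α) x - dragCoeff N a (x 0) * pd 0 α x
        - fderiv ℝ V x (affField T l m x) - 2 * ψ (x 0) * V x) * u
      + (∑ μ, invDiag N a μ (x 0) * pd μ (pd μ b) x - dragCoeff N a (x 0) * pd 0 b x - V x * b x)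
      + 2 * invDiag N a 0 (x 0) * (pd 0 α x + deriv ψ (x 0)) * p 0
      + ∑ i : Fin 3, 2 * invDiag N a i.succ (x 0) * pd i.succ α x * p i.succ := by
  have e1 := hK.deriv_time hI hN hx.1
  have e2 := hK.deriv_space hI ha hx.1
  have e3 := hK.time _ hx.1
  unfold lieRest
  simp only [Fin.sum_univ_succ (n := 3), pd_pd_affField_zero hI hJ hK.smooth_T l m hx,
    pd_pd_affField_succ, pd_affField_zero hI hK.smooth_T l m hx.1, pd_affField_succ,
    deriv_dragCoeff hI hN ha hx.1, invDiag_zero, Fin.succ_ne_zero, (Fin.succ_ne_zero _).symm]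
  simp only [Fin.sum_univ_three, if_true, if_false, affField_zero]
  have e20 := e2 0
  have e21 := e2 1
  have e22 := e2 2
  unfold dragCoeff
  linear_combination (1 / N (x 0) ^ 2 * p 0) * (e1 - e20 - e21 - e22
    + 2 * (logDeriv (a 0) (x 0) + logDeriv (a 1) (x 0) + logDeriv (a 2) (x 0)
      - logDeriv N (x 0)) * e3)

end criterion


/-! ### Lie and Noether criteria for a dilation -/

section symmetry

variable {I : Set ℝ} {J : Fin 3 → Set ℝ} {N : ℝ → ℝ} {a : Fin 3 → ℝ → ℝ} {V : Pt 4 → ℝ}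

/-- The conformal Killing equations hold by assumption. The remainder is affine in `(u, p)`, so its
coefficients vanish separately: those of p_μ say that the gradients of α and −ψ agree, that of `u`
is the equation of the potential, and the free term says that `b` solves the Klein-Gordon equation.
-/
lemma isLieSymmetry_dilation_iff (hI : IsOpen I) (hJ : ∀ i, IsOpen (J i))
    (hN : IsScaleFactorOn I N) (ha : ∀ i, IsScaleFactorOn I (a i))
    (hV : ContDiffOn ℝ ∞ V (box I J)) {T ψ : ℝ → ℝ} {l m : Fin 3 → ℝ}
    (hK : IsDilation I N a T l ψ) {X : PointField 4} {α b : Pt 4 → ℝ}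
    (hX : IsAffineField (box I J) X (affField T l m) α b) :
    IsLieSymmetry (bianchiI N a) V (box I J) X ↔ ∀ x ∈ box I J,
      (pd 0 α x + deriv ψ (x 0) = 0 ∧ ∀ i : Fin 3, pd i.succ α x = 0) ∧
      ∑ μ, invDiag N a μ (x 0) * pd μ (pd μ α) x - dragCoeff N a (x 0) * pd 0 α x
        - fderiv ℝ V x (affField T l m x) - 2 * ψ (x 0) * V x = 0 ∧
      kgH (bianchiI N a) V (x, b x, fun μ => pd μ b x, fun μ ν => pd ν (pd μ b) x) = 0 := by
  rw [isLieSymmetry_affine_iff hI hJ hN ha hV hX]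
  refine forall₂_congr fun x hx => ?_
  have hs := invDiag_ne_zero hN ha hx.1
  have hψ : hubble N a 0 (x 0) * affField T l m x 0 + pd 0 (fun y => affField T l m y 0) x
      = ψ (x 0) := by
    rw [pd_affField_zero hI hK.smooth_T l m hx.1, ← hK.time _ hx.1]; simp; ring
  rw [hψ]
  have h1 : ∀ μ κ : Fin 4, μ ≠ κ → invDiag N a μ (x 0) * pd μ (fun y => affField T l m y κ) x
        + invDiag N a κ (x 0) * pd κ (fun y => affField T l m y μ) x = 0 := by
    intro μ κ hne
    have h : ∀ μ κ : Fin 4, μ ≠ κ → pd μ (fun y => affField T l m y κ) x = 0 := by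
      intro μ κ
      refine Fin.cases (fun h => ?_) (fun i h => ?_) κ
      · rw [pd_affField_zero hI hK.smooth_T l m hx.1, if_neg h]
      · rw [pd_affField_succ, if_neg h]
    rw [h μ κ hne, h κ μ hne.symm]; ring
  have h2 : ∀ μ : Fin 4, hubble N a μ (x 0) * affField T l m x 0
      + pd μ (fun y => affField T l m y μ) x = ψ (x 0) := by
    intro μ
    refine Fin.cases hψ (fun i => ?_) μ
    rw [pd_affField_succ, ← hK.space _ hx.1 i]; simp; ring
  simp only [lieRest_affField hI hJ hN ha hK hx]
  rw [kgH_bianchiI hI hN ha hx.1]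
  have e0 := hs 0
  constructor
  · rintro ⟨-, -, h⟩
    -- The values (0, 0), (1, 0) and (0, e_μ) of (u, p) separate the coefficients.
    have c1 := h 0 0
    have c2 := h 1 0
    simp only [Pi.zero_apply, mul_zero, Finset.sum_const_zero, add_zero, zero_add, mul_one] at c1 c2
    refine ⟨⟨?_, fun i => ?_⟩, ?_, c1⟩
    · have := h 0 (Pi.single 0 1)
      simp only [mul_zero, c1, Pi.single_eq_same, Pi.single_eq_of_ne (Fin.succ_ne_zero _),
        Finset.sum_const_zero, add_zero, zero_add, mul_one] at this
      rcases mul_eq_zero.1 this with h' | h'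
      · exact absurd ((mul_eq_zero.1 h').resolve_left two_ne_zero) e0
      · exact h'
    · have := h 0 (Pi.single i.succ 1)
      simp only [mul_zero, c1, Pi.single_eq_of_ne (Fin.succ_ne_zero _).symm, add_zero, zero_add]
        at this
      rw [Finset.sum_eq_single i (fun j _ hj => by
        rw [Pi.single_eq_of_ne (by simpa using hj)]; ring) (by simp)] at this
      simp only [Pi.single_eq_same, mul_one] at this
      rcases mul_eq_zero.1 this with h' | h'
      · exact absurd ((mul_eq_zero.1 h').resolve_left two_ne_zero) (hs _)
      · exact h'
    · linarith
  · rintro ⟨⟨c0, ci⟩, c2, c1⟩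
    refine ⟨h1, h2, fun u p => ?_⟩
    rw [c2, c1, c0]
    simp [ci]

/-- The volume density. -/
noncomputable def volTime (N : ℝ → ℝ) (a : Fin 3 → ℝ → ℝ) (t : ℝ) : ℝ :=
  Real.sqrt ((N t * a 0 t * a 1 t * a 2 t) ^ 2)

/-- The determinant is minus a square. Keeping the root of this square makes the density smooth
without a choice of sign for the product. -/
lemma sqrt_det_bianchiI (x : Pt 4) :
    Real.sqrt |(bianchiI N a x).det| = volTime N a (x 0) := by
  rw [bianchiI_eq, Matrix.det_diagonal, Fin.prod_univ_succ, Fin.prod_univ_three]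
  simp only [diagOf_zero, diagOf_succ, volTime]
  congr 1
  rw [show -(N (x 0)) ^ 2 * (a 0 (x 0) ^ 2 * a 1 (x 0) ^ 2 * a 2 (x 0) ^ 2) =
    -((N (x 0) * a 0 (x 0) * a 1 (x 0) * a 2 (x 0)) ^ 2) by ring, abs_neg, abs_of_nonneg (sq_nonneg _)]

lemma smooth_volTime (hN : IsScaleFactorOn I N) (ha : ∀ i, IsScaleFactorOn I (a i)) :
    ContDiffOn ℝ ∞ (volTime N a) I := by
  refine ContDiffOn.sqrt ((((hN.1.mul (ha 0).1).mul (ha 1).1).mul (ha 2).1).pow 2) fun t ht => ?_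
  exact pow_ne_zero _ (mul_ne_zero (mul_ne_zero (mul_ne_zero (hN.2 t ht) ((ha 0).2 t ht))
    ((ha 1).2 t ht)) ((ha 2).2 t ht))

lemma hasDerivAt_volTime (hI : IsOpen I) (hN : IsScaleFactorOn I N)
    (ha : ∀ i, IsScaleFactorOn I (a i)) {t : ℝ} (ht : t ∈ I) :
    HasDerivAt (volTime N a) ((logDeriv N t + logDeriv (a 0) t + logDeriv (a 1) t
      + logDeriv (a 2) t) * volTime N a t) t := by
  have n0 := hN.2 t ht
  have n1 := (ha 0).2 t ht
  have n2 := (ha 1).2 t ht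
  have n3 := (ha 2).2 t ht
  have hne : N t * a 0 t * a 1 t * a 2 t ≠ 0 :=
    mul_ne_zero (mul_ne_zero (mul_ne_zero n0 n1) n2) n3
  have hw : volTime N a t ≠ 0 := by
    unfold volTime; rw [Real.sqrt_sq_eq_abs]; exact abs_ne_zero.2 hne
  have hsq : volTime N a t ^ 2 = (N t * a 0 t * a 1 t * a 2 t) ^ 2 := Real.sq_sqrt (sq_nonneg _)
  have h1 := ((((hN.diff hI ht).hasDerivAt.mul ((ha 0).diff hI ht).hasDerivAt).mul
    ((ha 1).diff hI ht).hasDerivAt).mul ((ha 2).diff hI ht).hasDerivAt).pow 2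
  have h2 := h1.sqrt (by simpa using hne)
  refine h2.congr_deriv ?_
  have : Real.sqrt (((N * a 0 * a 1 * a 2) ^ 2) t) = volTime N a t := rfl
  rw [this]
  simp only [logDeriv_apply, Pi.mul_apply]
  rw [div_eq_iff (by positivity)]
  have e : ∀ y, y * volTime N a t * (2 * volTime N a t) = 2 * y * volTime N a t ^ 2 := fun y => by ring
  rw [e, hsq]
  field_simp
  simp
  ring

lemma kgL_bianchiI (hN : IsScaleFactorOn I N) (ha : ∀ i, IsScaleFactorOn I (a i)) {x : Pt 4}
    (hx : x 0 ∈ I) (u : ℝ) (p : Pt 4) :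
    kgL (bianchiI N a) V (x, u, p) = 1 / 2 * volTime N a (x 0) *
      (∑ μ, invDiag N a μ (x 0) * p μ ^ 2 + V x * u ^ 2) := by
  unfold kgL
  rw [sqrt_det_bianchiI]
  have hs : ∀ μ ν : Fin 4, (bianchiI N a x)⁻¹ μ ν = if μ = ν then invDiag N a μ (x 0) else 0 :=
    fun μ ν => by rw [inv_bianchiI hN ha hx, Matrix.diagonal_apply]
  simp_rw [hs, ite_mul, zero_mul]
  simp only [Finset.sum_ite_eq, Finset.mem_univ, if_true]
  simp only [pow_two, mul_assoc, mul_add]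

lemma fderiv_kgL (hI : IsOpen I) (hJ : ∀ i, IsOpen (J i)) (hN : IsScaleFactorOn I N)
    (ha : ∀ i, IsScaleFactorOn I (a i)) (hV : ContDiffOn ℝ ∞ V (box I J)) {x : Pt 4}
    (hx : x ∈ box I J) (u : ℝ) (p : Pt 4) (v : Pt 4) (w : ℝ) (r : Pt 4) :
    fderiv ℝ (kgL (bianchiI N a) V) (x, u, p) (v, w, r) =
      1 / 2 * volTime N a (x 0) * ((logDeriv N (x 0) + logDeriv (a 0) (x 0)
          + logDeriv (a 1) (x 0) + logDeriv (a 2) (x 0)) * v 0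
          * (∑ μ, invDiag N a μ (x 0) * p μ ^ 2 + V x * u ^ 2)
        + ∑ μ, (-(2 * hubble N a μ (x 0) * invDiag N a μ (x 0)) * v 0 * p μ ^ 2
          + 2 * invDiag N a μ (x 0) * p μ * r μ)
        + (fderiv ℝ V x v * u ^ 2 + 2 * V x * u * w)) := by
  have hΩ := isOpen_box hI hJ
  have hdV : DifferentiableAt ℝ V x := differentiableAt_of_smooth hΩ hV hx
  have hev : kgL (bianchiI N a) V =ᶠ[nhds (x, u, p)] fun j : Jet1 4 =>
      1 / 2 * volTime N a (j.1 0) * (∑ μ, invDiag N a μ (j.1 0) * (j.2.2 μ * j.2.2 μ)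
        + V j.1 * (j.2.1 * j.2.1)) := by
    have hc : ContinuousAt (fun j : Jet1 4 => j.1) (x, u, p) := by fun_prop
    filter_upwards [hc.preimage_mem_nhds (hΩ.mem_nhds hx)] with j hj
    have := kgL_bianchiI (V := V) hN ha hj.1 j.2.1 j.2.2
    simp only [pow_two] at this
    exact this
  rw [hev.fderiv_eq]
  have ht : HasFDerivAt (fun j : Jet1 4 => j.1 0)
      ((ContinuousLinearMap.proj (R := ℝ) (φ := fun _ : Fin 4 => ℝ) 0).comp
        (ContinuousLinearMap.fst ℝ (Pt 4) (ℝ × Pt 4))) (x, u, p) :=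
    ((ContinuousLinearMap.proj (R := ℝ) (φ := fun _ : Fin 4 => ℝ) 0).comp
      (ContinuousLinearMap.fst ℝ (Pt 4) (ℝ × Pt 4))).hasFDerivAt
  have htc : ∀ f : ℝ → ℝ, ∀ f' : ℝ, HasDerivAt f f' (x 0) →
      HasFDerivAt (fun j : Jet1 4 => f (j.1 0))
        (f' • ((ContinuousLinearMap.proj (R := ℝ) (φ := fun _ : Fin 4 => ℝ) 0).comp
        (ContinuousLinearMap.fst ℝ (Pt 4) (ℝ × Pt 4)))) (x, u, p) :=
    fun f f' hf => HasDerivAt.comp_hasFDerivAt (x, u, p) (f := fun j : Jet1 4 => j.1 0) hf ht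
  have hs := fun μ => htc _ _ (hasDerivAt_invDiag hI hN ha hx.1 μ)
  have hG := htc _ _ (hasDerivAt_volTime hI hN ha hx.1)
  have hVV : HasFDerivAt (fun j : Jet1 4 => V j.1) ((fderiv ℝ V x).comp
      (ContinuousLinearMap.fst ℝ (Pt 4) (ℝ × Pt 4))) (x, u, p) :=
    HasFDerivAt.comp (x, u, p) (g := V) (f := fun j : Jet1 4 => j.1) hdV.hasFDerivAt
      hasFDerivAt_fst
  have hu : HasFDerivAt (fun j : Jet1 4 => j.2.1)
      ((ContinuousLinearMap.fst ℝ _ _).comp (ContinuousLinearMap.snd ℝ _ _)) (x, u, p) :=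
    (((ContinuousLinearMap.fst ℝ _ _).comp
      (ContinuousLinearMap.snd ℝ (Pt 4) (ℝ × Pt 4)))).hasFDerivAt
  have hp : ∀ μ, HasFDerivAt (fun j : Jet1 4 => j.2.2 μ) _ (x, u, p) := fun μ =>
    ((ContinuousLinearMap.proj (R := ℝ) (φ := fun _ : Fin 4 => ℝ) μ).comp
      ((ContinuousLinearMap.snd ℝ _ _).comp
        (ContinuousLinearMap.snd ℝ (Pt 4) (ℝ × Pt 4)))).hasFDerivAt
  have := (hG.const_mul (1 / 2)).mul ((HasFDerivAt.fun_sum (u := Finset.univ) fun μ _ =>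
    (hs μ).mul ((hp μ).mul (hp μ))).add (hVV.mul (hu.mul hu)))
  refine (DFunLike.congr_fun this.fderiv _).trans ?_
  simp only [Fin.sum_univ_four]
  simp
  ring

/-- A potential that satisfies the determining equation has the conformal field as a Noether
symmetry. -/
lemma isNoetherSymmetry_dilation (hI : IsOpen I) (hJ : ∀ i, IsOpen (J i))
    (hN : IsScaleFactorOn I N) (ha : ∀ i, IsScaleFactorOn I (a i))
    (hV : ContDiffOn ℝ ∞ V (box I J)) {T ψ : ℝ → ℝ} {l m : Fin 3 → ℝ}
    (hK : IsDilation I N a T l ψ) {X : PointField 4}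
    (hX : IsAffineField (box I J) X (affField T l m) (fun p => -ψ (p 0)) 0)
    (hP : PotentialEq N a V T l m ψ (box I J)) :
    IsNoetherSymmetry (bianchiI N a) V (box I J) X := by
  have hΩ := isOpen_box hI hJ
  have dψ : ∀ t ∈ I, DifferentiableAt ℝ ψ t := fun t ht => differentiableAt_of_smooth hI hK.smooth_ψ ht
  have dψ' : ∀ t ∈ I, DifferentiableAt ℝ (deriv ψ) t := fun t ht =>
    differentiableAt_of_smooth hI (smooth_deriv hI hK.smooth_ψ) ht
  have pα : ∀ x ∈ box I J, ∀ μ, pd μ (fun p : Pt 4 => -ψ (p 0)) x =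
      if μ = 0 then -deriv ψ (x 0) else 0 := fun x hx μ => by
    rw [pd_neg, pd_time (dψ _ hx.1)]; split_ifs <;> simp
  have ppα : ∀ x ∈ box I J, ∀ μ, pd μ (pd μ (fun p : Pt 4 => -ψ (p 0))) x =
      if μ = 0 then -deriv (deriv ψ) (x 0) else 0 := fun x hx μ => by
    by_cases h : μ = 0
    · subst h
      rw [pd_congr hΩ (g := fun p : Pt 4 => -(deriv ψ) (p 0)) (fun y hy => by simp [pα y hy]) hx,
        pd_neg, pd_time (dψ' _ hx.1)]
      simp
    · rw [pd_congr hΩ (g := fun p : Pt 4 => (0 : ℝ)) (fun y hy => by simp [pα y hy, h]) hx]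
      simp [h]
  refine ⟨(isLieSymmetry_dilation_iff hI hJ hN ha hV hK hX).2 fun x hx => ⟨⟨?_, fun i => ?_⟩, ?_, ?_⟩,
    -- The gauge vector is −½√|g| g^{μν}ψ_{,ν}u². Only its time component survives, and g^{00} =
    -- −1/N² makes the sign positive.
    fun z => Fin.cons (1 / 2 * (volTime N a (z.1 0) * (1 / N (z.1 0) ^ 2) * deriv ψ (z.1 0))
      * z.2 ^ 2) 0, ?_, ?_⟩
  · rw [pα x hx]; simp
  · rw [pα x hx]; simp
  · have := hP x hx
    simp only [ppα x hx, pα x hx]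
    simp only [mul_ite, mul_zero, Finset.sum_ite_eq', Finset.mem_univ, if_true, invDiag_zero]
    unfold waveTime at this
    unfold dragCoeff
    linear_combination -this
  · rw [kgH_bianchiI hI hN ha hx.1]
    have h0 : ∀ μ y, pd μ (0 : Pt 4 → ℝ) y = 0 := fun μ y => pd_const 0 μ
    have h1 : ∀ μ, pd μ (0 : Pt 4 → ℝ) = 0 := fun μ => funext fun y => h0 μ y
    simp [h1, h0]
  · refine contDiffOn_pi.2 fun μ => ?_
    refine Fin.cases ?_ (fun i => ?_) μ
    · simp only [Fin.cons_zero]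
      have : ContDiffOn ℝ ∞ (fun t => volTime N a t * (1 / N t ^ 2) * deriv ψ t) I :=
        ((smooth_volTime hN ha).mul (contDiffOn_const.div (hN.1.pow 2)
          fun t ht => pow_ne_zero _ (hN.2 t ht))).mul (smooth_deriv hI hK.smooth_ψ)
      exact (contDiffOn_const.mul (this.comp
        (((contDiff_apply ℝ ℝ (0 : Fin 4)).comp contDiff_fst).contDiffOn)
          fun z hz => hz.1.1)).mul (contDiff_snd.pow 2).contDiffOn
    · simp only [Fin.cons_succ]; exact contDiffOn_const
  · intro x hx u p
    have hw := hasDerivAt_volTime hI hN ha hx.1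
    have hn := (hasDerivAt_invDiag hI hN ha hx.1 0).neg
    have hdd := (dψ' _ hx.1).hasDerivAt
    set f : ℝ → ℝ := fun t => volTime N a t * (1 / N t ^ 2) * deriv ψ t with hf
    -- The wave operator in divergence form: (√|g| N⁻² ψ')' = −√|g| Δψ.
    have hfd : HasDerivAt f (-volTime N a (x 0) * waveTime N a ψ (x 0)) (x 0) := by
      have h := (hw.mul hn).mul hdd
      have e : f = (volTime N a * -invDiag N a 0) * deriv ψ := by
        funext t; simp [hf]
      rw [e]
      refine h.congr_deriv ?_
      simp [waveTime]
      ring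
    have hA : HasFDerivAt (fun z : Pt 4 × ℝ => 1 / 2 * f (z.1 0) * z.2 ^ 2)
        ((1 / 2 * f (x 0)) • ((2 * u) • ContinuousLinearMap.snd ℝ (Pt 4) ℝ)
          + u ^ 2 • ((1 / 2 : ℝ) • ((-volTime N a (x 0) * waveTime N a ψ (x 0)) •
          ((ContinuousLinearMap.proj (R := ℝ) (φ := fun _ : Fin 4 => ℝ) 0).comp
            (ContinuousLinearMap.fst ℝ (Pt 4) ℝ))))) (x, u) := by
      have h1 : HasFDerivAt (fun z : Pt 4 × ℝ => z.1 0)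
          ((ContinuousLinearMap.proj (R := ℝ) (φ := fun _ : Fin 4 => ℝ) 0).comp
            (ContinuousLinearMap.fst ℝ (Pt 4) ℝ)) (x, u) :=
        ((ContinuousLinearMap.proj (R := ℝ) (φ := fun _ : Fin 4 => ℝ) 0).comp
            (ContinuousLinearMap.fst ℝ (Pt 4) ℝ)).hasFDerivAt
      have h2 : HasFDerivAt (fun z : Pt 4 × ℝ => z.2) (ContinuousLinearMap.snd ℝ (Pt 4) ℝ) (x, u) :=
        (ContinuousLinearMap.snd ℝ (Pt 4) ℝ).hasFDerivAt
      have h3 := (HasDerivAt.comp_hasFDerivAt (x, u) (f := fun z : Pt 4 × ℝ => z.1 0) hfd h1)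
      have h4 := (h3.const_mul (1 / 2)).mul (h2.pow 2)
      refine h4.congr_fderiv ?_
      simp only [Function.comp_apply, nsmul_eq_mul, Nat.cast_ofNat, Nat.add_one_sub_one, pow_one]
    have hA0 : totalD (fun z : Pt 4 × ℝ => 1 / 2 * f (z.1 0) * z.2 ^ 2) 0 x u p =
        -(1 / 2) * volTime N a (x 0) * waveTime N a ψ (x 0) * u ^ 2
          + volTime N a (x 0) * (1 / N (x 0) ^ 2) * deriv ψ (x 0) * u * p 0 := by
      unfold totalD
      rw [hA.fderiv]
      simp [hf]
      ring
    have hz : ∀ i : Fin 3, totalD (fun _ : Pt 4 × ℝ => (0 : ℝ)) i.succ x u p = 0 := fun i => by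
      unfold totalD; simp
    have hdiv : ∀ μ, totalD (fun y => X.ξ y μ) μ x u p = pd μ (fun y => affField T l m y μ) x := by
      intro μ
      have hd : DifferentiableAt ℝ (fun y => affField T l m y μ) x :=
        differentiableAt_of_smooth hΩ (hX.smooth_ζ μ) hx
      rw [totalD_eq, dX_congr hΩ (G := fun z => affField T l m z.1 μ)
        (fun y hy u => by rw [hX.ξ_eq y hy]) hx, dU_congr hΩ (G := fun z => affField T l m z.1 μ)
        (fun y hy u => by rw [hX.ξ_eq y hy]) hx, dX_base (b := fun y => affField T l m y μ) hd,
        dU_base (b := fun y => affField T l m y μ) hd]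
      ring
    rw [fderiv_kgL hI hJ hN ha hV hx, kgL_bianchiI hN ha hx.1, hX.ξ_eq x hx, hX.η_eq x hx]
    simp only [hdiv, prolong1_affine hΩ hX.smooth_ζ hX.smooth_α hX.smooth_b hX.ξ_eq hX.η_eq hx,
      pα x hx]
    have hb : ∀ μ, pd μ (0 : Pt 4 → ℝ) x = 0 := fun μ => pd_const 0 μ
    rw [Fin.sum_univ_succ (f := fun μ => totalD (fun y => (Fin.cons (1 / 2 * (volTime N a (y.1 0) *
      (1 / N (y.1 0) ^ 2) * deriv ψ (y.1 0)) * y.2 ^ 2) 0 : Pt 4) μ) μ x u p)]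
    simp only [Fin.cons_zero, Fin.cons_succ, Pi.zero_apply, hz, Finset.sum_const_zero, add_zero]
    refine Eq.trans ?_ hA0.symm
    simp only [hb, Fin.sum_univ_succ (n := 3), pd_affField_zero hI hK.smooth_T l m hx.1,
      pd_affField_succ, Fin.succ_ne_zero, (Fin.succ_ne_zero _).symm, Fin.succ_inj]
    simp only [Fin.sum_univ_three, affField_zero, if_true, if_false, hubble_zero, hubble_succ,
      invDiag_zero]
    have e1 := hK.time _ hx.1
    have e2 := hK.space _ hx.1
    have e20 := e2 0
    have e21 := e2 1
    have e22 := e2 2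
    have := hP x hx
    simp only [show ((0 : Fin 3) = 1) = False by simp, show ((0 : Fin 3) = 2) = False by simp,
      show ((1 : Fin 3) = 0) = False by simp, show ((1 : Fin 3) = 2) = False by simp,
      show ((2 : Fin 3) = 0) = False by simp, show ((2 : Fin 3) = 1) = False by simp, if_false]
    -- The kinetic terms cancel by the conformal equations, one for each direction; the u² terms
    -- cancel by the equation of the potential.
    linear_combination (1 / 2 * volTime N a (x 0)) * ((-(1 / N (x 0) ^ 2) * p 0 ^ 2
      + invDiag N a (Fin.succ 0) (x 0) * p (Fin.succ 0) ^ 2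
      + invDiag N a (Fin.succ 1) (x 0) * p (Fin.succ 1) ^ 2
      + invDiag N a (Fin.succ 2) (x 0) * p (Fin.succ 2) ^ 2 + V x * u ^ 2) * (e1 + e20 + e21 + e22)
      + 2 * (1 / N (x 0) ^ 2) * p 0 ^ 2 * e1
      - 2 * invDiag N a (Fin.succ 0) (x 0) * p (Fin.succ 0) ^ 2 * e20
      - 2 * invDiag N a (Fin.succ 1) (x 0) * p (Fin.succ 1) ^ 2 * e21
      - 2 * invDiag N a (Fin.succ 2) (x 0) * p (Fin.succ 2) ^ 2 * e22 + u ^ 2 * this)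

end symmetry


/-! ### Conformal Killing vectors of Bianchi I line elements -/

section ckv

variable {I : Set ℝ} {J : Fin 3 → Set ℝ} {N : ℝ → ℝ} {a : Fin 3 → ℝ → ℝ}

/-- Logarithmic derivative of `aᵢ / N`. -/
noncomputable def relHubble (N : ℝ → ℝ) (a : Fin 3 → ℝ → ℝ) (i : Fin 3) (t : ℝ) : ℝ :=
  logDeriv (a i) t - logDeriv N t

/-- The square of `aᵢ / N`. -/
noncomputable def ratioSq (N : ℝ → ℝ) (a : Fin 3 → ℝ → ℝ) (i : Fin 3) (t : ℝ) : ℝ :=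
  (a i t / N t) ^ 2

/-- Difference of two eigenvalues of the electric part of the Weyl tensor, up to a factor. -/
noncomputable def weylGap (N : ℝ → ℝ) (a : Fin 3 → ℝ → ℝ) (i j k : Fin 3) (t : ℝ) : ℝ :=
  deriv (relHubble N a j) t + relHubble N a j t ^ 2 - relHubble N a i t * relHubble N a j t
    - (deriv (relHubble N a k) t + relHubble N a k t ^ 2 - relHubble N a i t * relHubble N a k t)

lemma smooth_relHubble (hI : IsOpen I) (hN : IsScaleFactorOn I N)
    (ha : ∀ i, IsScaleFactorOn I (a i)) (i : Fin 3) : ContDiffOn ℝ ∞ (relHubble N a i) I :=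
  (smooth_logDeriv hI (ha i)).sub (smooth_logDeriv hI hN)

lemma hasDerivAt_ratio {f g : ℝ → ℝ} (hI : IsOpen I) (hf : IsScaleFactorOn I f)
    (hg : IsScaleFactorOn I g) {t : ℝ} (ht : t ∈ I) :
    HasDerivAt (fun t => f t / g t) ((logDeriv f t - logDeriv g t) * (f t / g t)) t := by
  have h := (hf.diff hI ht).hasDerivAt.div (hg.diff hI ht).hasDerivAt (hg.2 t ht)
  have h1 := hf.2 t ht
  have h2 := hg.2 t ht
  refine h.congr_deriv ?_
  simp only [logDeriv_apply]
  field_simp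

lemma hasDerivAt_ratioSq (hI : IsOpen I) (hN : IsScaleFactorOn I N)
    (ha : ∀ i, IsScaleFactorOn I (a i)) (i : Fin 3) {t : ℝ} (ht : t ∈ I) :
    HasDerivAt (ratioSq N a i) (2 * relHubble N a i t * ratioSq N a i t) t := by
  have h := (hasDerivAt_ratio hI (ha i) hN ht).pow 2
  refine h.congr_deriv ?_
  simp only [ratioSq, relHubble]
  simp
  ring

lemma ratioSq_ne_zero (hN : IsScaleFactorOn I N)
    (ha : ∀ i, IsScaleFactorOn I (a i)) (i : Fin 3) {t : ℝ} (ht : t ∈ I) : ratioSq N a i t ≠ 0 :=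
  pow_ne_zero _ (div_ne_zero ((ha i).2 t ht) (hN.2 t ht))

/-- If no two scale factors are proportional, their Hubble rates differ somewhere. -/
lemma exists_relHubble_ne (hI : IsOpen I) (hIc : I.OrdConnected) (hIne : I.Nonempty)
    (ha : ∀ i, IsScaleFactorOn I (a i)) (hL : ¬ IsLRSOn I a) {i j : Fin 3} (hij : i ≠ j) :
    ∃ t ∈ I, relHubble N a i t ≠ relHubble N a j t := by
  by_contra! h
  apply hL
  obtain ⟨t₀, ht₀⟩ := hIne
  refine ⟨i, j, hij, a i t₀ / a j t₀, fun t ht => ?_⟩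
  have hd : ∀ s ∈ I, HasDerivAt (fun t => a i t / a j t) 0 s := fun s hs => by
    have h1 := hasDerivAt_ratio hI (ha i) (ha j) hs
    have h2 := h s hs
    unfold relHubble at h2
    rwa [show logDeriv (a i) s - logDeriv (a j) s = 0 by linarith, zero_mul] at h1
  have : a i t / a j t = a i t₀ / a j t₀ := by
    refine hIc.convex.is_const_of_fderivWithin_eq_zero (𝕜 := ℝ)
      (fun s hs => (hd s hs).differentiableAt.differentiableWithinAt) (fun s hs => ?_) ht ht₀
    have h3 := (hd s hs).hasFDerivAt.hasFDerivWithinAt (s := I)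
    rw [h3.fderivWithin (hI.uniqueDiffWithinAt hs)]
    ext; simp
  rw [← this]
  field_simp [(ha j).2 t ht]

section pdtime

variable {f : ℝ → ℝ} {f' : ℝ} {g : Pt 4 → ℝ} {x : Pt 4}

lemma pd_time_mul_zero (hf : HasDerivAt f f' (x 0)) (hg : DifferentiableAt ℝ g x) :
    pd 0 (fun y => f (y 0) * g y) x = f (x 0) * pd 0 g x + f' * g x := by
  have hd : DifferentiableAt ℝ (fun y : Pt 4 => f (y 0)) x :=
    DifferentiableAt.comp x (f := fun y : Pt 4 => y 0) (g := f) hf.differentiableAt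
      (differentiableAt_apply 0 x)
  rw [pd_mul hd hg, pd_time hf.differentiableAt, hf.deriv]
  simp

lemma pd_time_mul_succ (hf : DifferentiableAt ℝ f (x 0)) (hg : DifferentiableAt ℝ g x)
    (i : Fin 3) : pd i.succ (fun y => f (y 0) * g y) x = f (x 0) * pd i.succ g x := by
  have hd : DifferentiableAt ℝ (fun y : Pt 4 => f (y 0)) x :=
    DifferentiableAt.comp x (f := fun y : Pt 4 => y 0) (g := f) hf
      (differentiableAt_apply 0 x)
  rw [pd_mul hd hg, pd_time hf, if_neg (Fin.succ_ne_zero i)]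
  ring

end pdtime

lemma eq_of_pd_eq_zero_or {n : ℕ} {Ω : Set (Pt n)} {f : Pt n → ℝ} (hΩ : IsOpen Ω)
    (hc : Convex ℝ Ω) (hf : ContDiffOn ℝ ∞ f Ω) {x y : Pt n} (hx : x ∈ Ω) (hy : y ∈ Ω)
    (h : ∀ μ, x μ = y μ ∨ ∀ z ∈ Ω, pd μ f z = 0) : f x = f y := by
  refine eq_of_pd_eq_zero hΩ hc (hf.differentiableOn (by simp)) hx hy fun z hz => ?_
  rw [fderiv_eq_sum_pd]
  refine Finset.sum_eq_zero fun μ _ => ?_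
  rcases h μ with h | h
  · simp [h]
  · simp [h z hz]

/-- The conformal Killing equations of a Bianchi I line element. -/
structure IsConformalField (I : Set ℝ) (J : Fin 3 → Set ℝ) (N : ℝ → ℝ) (a : Fin 3 → ℝ → ℝ)
    (T : Pt 4 → ℝ) (Z : Fin 3 → Pt 4 → ℝ) : Prop where
  smooth_T : ContDiffOn ℝ ∞ T (box I J)
  smooth_Z : ∀ i, ContDiffOn ℝ ∞ (Z i) (box I J)
  time_space : ∀ x ∈ box I J, ∀ i : Fin 3, pd i.succ T x = ratioSq N a i (x 0) * pd 0 (Z i) x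
  space_space : ∀ x ∈ box I J, ∀ i j : Fin 3, i ≠ j →
    ratioSq N a i (x 0) * pd j.succ (Z i) x + ratioSq N a j (x 0) * pd i.succ (Z j) x = 0
  diag : ∀ x ∈ box I J, ∀ i : Fin 3,
    pd i.succ (Z i) x + relHubble N a i (x 0) * T x = pd 0 T x

namespace IsConformalField

variable {T : Pt 4 → ℝ} {Z : Fin 3 → Pt 4 → ℝ}

/-- The diagonal equation differentiated along a spatial axis, where the Hubble rate is constant. -/
lemma pd_diag (h : IsConformalField I J N a T Z) (hI : IsOpen I) (hJ : ∀ i, IsOpen (J i))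
    (hN : IsScaleFactorOn I N) (ha : ∀ i, IsScaleFactorOn I (a i)) {x : Pt 4} (hx : x ∈ box I J)
    (i j : Fin 3) :
    pd i.succ (pd j.succ (Z j)) x =
      pd 0 (pd i.succ T) x - relHubble N a j (x 0) * pd i.succ T x := by
  have hΩ := isOpen_box hI hJ
  have dk := differentiableAt_of_smooth hI (smooth_relHubble hI hN ha j) hx.1
  have dT := differentiableAt_of_smooth hΩ h.smooth_T hx
  have dT0 := differentiableAt_of_smooth hΩ (smooth_pd hΩ h.smooth_T 0) hx
  rw [pd_congr hΩ (g := fun y => pd 0 T y - relHubble N a j (y 0) * T y)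
    (fun y hy => by rw [← h.diag y hy j]; ring) hx, pd_sub dT0, pd_time_mul_succ dk dT,
    pd_comm hΩ h.smooth_T hx]
  exact DifferentiableAt.mul (DifferentiableAt.comp x (f := fun y : Pt 4 => y 0) dk
      (differentiableAt_apply 0 x)) dT

/-- The integrability condition of the conformal Killing equations. -/
lemma integrability (h : IsConformalField I J N a T Z) (hI : IsOpen I) (hJ : ∀ i, IsOpen (J i))
    (hN : IsScaleFactorOn I N) (ha : ∀ i, IsScaleFactorOn I (a i)) {x : Pt 4} (hx : x ∈ box I J)
    {i j : Fin 3} (hij : i ≠ j) :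
    pd 0 (pd 0 (pd i.succ T)) x - relHubble N a j (x 0) * pd 0 (pd i.succ T) x
      - deriv (relHubble N a j) (x 0) * pd i.succ T x
      + (relHubble N a j (x 0) - relHubble N a i (x 0)) *
        (pd 0 (pd i.succ T) x - relHubble N a j (x 0) * pd i.succ T x) = 0 := by
  have hΩ := isOpen_box hI hJ
  set G := pd i.succ T with hG
  have sG : ContDiffOn ℝ ∞ G (box I J) := smooth_pd hΩ h.smooth_T _
  have dk : ∀ y ∈ box I J, HasDerivAt (relHubble N a j) (deriv (relHubble N a j) (y 0)) (y 0) :=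
    fun y hy => (differentiableAt_of_smooth hI (smooth_relHubble hI hN ha j) hy.1).hasDerivAt
  have dk' : ∀ y ∈ box I J, DifferentiableAt ℝ (deriv (relHubble N a j)) (y 0) :=
    fun y hy => differentiableAt_of_smooth hI (smooth_deriv hI (smooth_relHubble hI hN ha j)) hy.1
  have dB : ∀ l, ∀ y ∈ box I J, HasDerivAt (ratioSq N a l) _ (y 0) := fun l y hy =>
    hasDerivAt_ratioSq hI hN ha l hy.1
  have D : ∀ {f : Pt 4 → ℝ}, ContDiffOn ℝ ∞ f (box I J) → ∀ y ∈ box I J, DifferentiableAt ℝ f y :=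
    fun hf y hy => differentiableAt_of_smooth hΩ hf hy
  have S : ∀ {f : Pt 4 → ℝ} (μ), ContDiffOn ℝ ∞ f (box I J) → ContDiffOn ℝ ∞ (pd μ f) (box I J) :=
    fun μ hf => smooth_pd hΩ hf μ
  have Dk : ∀ {f : Pt 4 → ℝ}, ContDiffOn ℝ ∞ f (box I J) → ∀ y ∈ box I J,
      DifferentiableAt ℝ (fun z => relHubble N a j (z 0) * f z) y := fun hf y hy =>
    DifferentiableAt.mul (DifferentiableAt.comp y (f := fun y : Pt 4 => y 0)
      (dk y hy).differentiableAt (differentiableAt_apply 0 y)) (D hf y hy)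
  have sT := h.smooth_T
  have sZ := h.smooth_Z
  -- second spatial derivative of `T`
  have d1 : ∀ y ∈ box I J, pd j.succ (pd j.succ T) y = ratioSq N a j (y 0) *
      (pd 0 (pd 0 T) y - relHubble N a j (y 0) * pd 0 T y - deriv (relHubble N a j) (y 0) * T y) := by
    intro y hy
    rw [pd_congr hΩ (fun z hz => h.time_space z hz j) hy,
      pd_time_mul_succ (dB j y hy).differentiableAt (D (S 0 (sZ j)) y hy), pd_comm hΩ (sZ j) hy,
      pd_congr hΩ (g := fun y => pd 0 T y - relHubble N a j (y 0) * T y)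
        (fun y hy => by rw [← h.diag y hy j]; ring) hy, pd_sub (D (S 0 sT) y hy) (Dk sT y hy),
      pd_time_mul_zero (dk y hy) (D sT y hy)]
    ring
  -- One more derivative along the axis `i` turns the identity for T into one for G.
  have d2 : pd i.succ (pd j.succ (pd j.succ T)) x = ratioSq N a j (x 0) *
      (pd 0 (pd 0 G) x - relHubble N a j (x 0) * pd 0 G x - deriv (relHubble N a j) (x 0) * G x) := by
    have sk' : DifferentiableAt ℝ (fun z : Pt 4 => deriv (relHubble N a j) (z 0) * T z) x :=
      DifferentiableAt.mul (DifferentiableAt.comp x (f := fun y : Pt 4 => y 0)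
        (dk' x hx) (differentiableAt_apply 0 x)) (D sT x hx)
    have c1 : pd i.succ (pd 0 T) x = pd 0 G x := pd_comm hΩ sT hx _ _
    have c2 : pd i.succ (pd 0 (pd 0 T)) x = pd 0 (pd 0 G) x := by
      rw [pd_comm hΩ (S 0 sT) hx]
      exact pd_congr hΩ (fun y hy => pd_comm hΩ sT hy _ _) hx _
    have s1 : DifferentiableAt ℝ (fun y => pd 0 (pd 0 T) y - relHubble N a j (y 0) * pd 0 T y) x :=
      (D (S 0 (S 0 sT)) x hx).sub (Dk (S 0 sT) x hx)
    have s2 : DifferentiableAt ℝ (fun y => pd 0 (pd 0 T) y - relHubble N a j (y 0) * pd 0 T y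
      - deriv (relHubble N a j) (y 0) * T y) x := s1.sub sk'
    rw [pd_congr hΩ d1 hx, pd_time_mul_succ (dB j x hx).differentiableAt s2, pd_sub s1 sk',
      pd_sub (D (S 0 (S 0 sT)) x hx) (Dk (S 0 sT) x hx),
      pd_time_mul_succ (dk x hx).differentiableAt (D (S 0 sT) x hx),
      pd_time_mul_succ (dk' x hx) (D sT x hx), c1, c2]
  -- Differentiating the mixed spatial equation along `j` produces ∂_i∂_jZ_j, which the diagonal
  -- equation expresses through G.
  have d3 : ∀ y ∈ box I J, ratioSq N a i (y 0) * pd j.succ (pd j.succ (Z i)) y =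
      -(ratioSq N a j (y 0) * (pd 0 G y - relHubble N a j (y 0) * G y)) := by
    intro y hy
    have e := pd_congr hΩ (fun z hz => h.space_space z hz i j hij) hy j.succ
    have DB : ∀ l μ, DifferentiableAt ℝ (fun z => ratioSq N a l (z 0) * pd μ (Z i) z) y :=
      fun l μ => DifferentiableAt.mul (DifferentiableAt.comp y (f := fun y : Pt 4 => y 0)
        (dB l y hy).differentiableAt (differentiableAt_apply 0 y)) (D (S μ (sZ i)) y hy)
    have DB' : ∀ l μ, DifferentiableAt ℝ (fun z => ratioSq N a l (z 0) * pd μ (Z j) z) y :=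
      fun l μ => DifferentiableAt.mul (DifferentiableAt.comp y (f := fun y : Pt 4 => y 0)
        (dB l y hy).differentiableAt (differentiableAt_apply 0 y)) (D (S μ (sZ j)) y hy)
    rw [pd_add (DB _ _) (DB' _ _), pd_time_mul_succ (dB i y hy).differentiableAt
      (D (S _ (sZ i)) y hy), pd_time_mul_succ (dB j y hy).differentiableAt (D (S _ (sZ j)) y hy),
      pd_const, pd_comm hΩ (sZ j) hy j.succ i.succ, h.pd_diag hI hJ hN ha hy] at e
    linarith
  -- The same third derivative of T, now computed from the time-space equation for the axis `i`.
  have d4 : ratioSq N a i (x 0) * pd 0 (pd j.succ (pd j.succ (Z i))) x =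
      pd i.succ (pd j.succ (pd j.succ T)) x := by
    have c1 : pd 0 (pd j.succ (pd j.succ (Z i))) x = pd j.succ (pd j.succ (pd 0 (Z i))) x := by
      rw [pd_comm hΩ (S _ (sZ i)) hx]
      exact pd_congr hΩ (fun y hy => pd_comm hΩ (sZ i) hy _ _) hx _
    have c2 : pd i.succ (pd j.succ (pd j.succ T)) x = pd j.succ (pd j.succ G) x := by
      rw [pd_comm hΩ (S _ sT) hx]
      exact pd_congr hΩ (fun y hy => pd_comm hΩ sT hy _ _) hx _
    have c3 : ∀ y ∈ box I J, pd j.succ G y = ratioSq N a i (y 0) * pd j.succ (pd 0 (Z i)) y :=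
      fun y hy => by
        rw [pd_congr hΩ (fun z hz => h.time_space z hz i) hy,
          pd_time_mul_succ (dB i y hy).differentiableAt (D (S 0 (sZ i)) y hy)]
    rw [c1, c2, pd_congr hΩ c3 hx, pd_time_mul_succ (dB i x hx).differentiableAt
      (D (S _ (S 0 (sZ i))) x hx)]
  -- The time derivative of `d3` meets `d4` and `d2`. Eliminating ∂_j²Z_i by `d3` leaves twice the
  -- squared ratio of axis `j` times the claim.
  have d5 := pd_congr hΩ d3 hx 0
  have Dd : DifferentiableAt ℝ (fun y => pd 0 G y - relHubble N a j (y 0) * G y) x :=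
    (D (S 0 sG) x hx).sub (Dk sG x hx)
  rw [pd_neg, pd_time_mul_zero (dB i x hx) (D (S _ (S _ (sZ i))) x hx),
    pd_time_mul_zero (dB j x hx) Dd, pd_sub (D (S 0 sG) x hx) (Dk sG x hx),
    pd_time_mul_zero (dk x hx) (D sG x hx), d4, d2] at d5
  have d3x := d3 x hx
  have hB := ratioSq_ne_zero hN ha j hx.1
  apply mul_left_cancel₀ (mul_ne_zero two_ne_zero hB)
  linear_combination d5 - 2 * relHubble N a i (x 0) * d3x

end IsConformalField

end ckv


section ckv

variable {I : Set ℝ} {J : Fin 3 → Set ℝ} {N : ℝ → ℝ} {a : Fin 3 → ℝ → ℝ}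

lemma update_mem_box {x : Pt 4} (hx : x ∈ box I J) {t : ℝ} (ht : t ∈ I) :
    Function.update x 0 t ∈ box I J :=
  ⟨by simpa using ht, fun i => by
    rw [Function.update_of_ne (Fin.succ_ne_zero i)]; exact hx.2 i⟩

namespace IsConformalField

variable {T : Pt 4 → ℝ} {Z : Fin 3 → Pt 4 → ℝ}

/-- For G = ∂_iT the integrability condition reads G'' − k_iG' − (k_j' + k_j² − k_ik_j)G = 0. Only
the coefficient of G depends on `j`, so the equations for `j` and `k` differ by `weylGap` times G.
-/
lemma weylGap_mul (h : IsConformalField I J N a T Z) (hI : IsOpen I) (hJ : ∀ i, IsOpen (J i))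
    (hN : IsScaleFactorOn I N) (ha : ∀ i, IsScaleFactorOn I (a i)) {x : Pt 4} (hx : x ∈ box I J)
    {i j k : Fin 3} (hij : i ≠ j) (hik : i ≠ k) :
    weylGap N a i j k (x 0) * pd i.succ T x = 0 := by
  have h1 := h.integrability hI hJ hN ha hx hij
  have h2 := h.integrability hI hJ hN ha hx hik
  unfold weylGap
  linear_combination h2 - h1

/-- A spatial derivative of the time component vanishes everywhere if it vanishes on a slab. -/
lemma pd_succ_eq_zero_of_slab (h : IsConformalField I J N a T Z) (hI : IsOpen I)
    (hIc : I.OrdConnected) (hJ : ∀ i, IsOpen (J i)) (hJc : ∀ i, (J i).OrdConnected)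
    (hN : IsScaleFactorOn I N) (ha : ∀ i, IsScaleFactorOn I (a i)) {U : Set ℝ} (hU : IsOpen U)
    {t₀ : ℝ} (ht₀ : t₀ ∈ I) (htU : t₀ ∈ U) {i : Fin 3}
    (hG : ∀ x ∈ box I J, x 0 ∈ U → pd i.succ T x = 0) {x : Pt 4} (hx : x ∈ box I J) :
    pd i.succ T x = 0 := by
  have hΩ := isOpen_box hI hJ
  have hc := convex_box hIc hJc
  obtain ⟨j, hij⟩ : ∃ j : Fin 3, i ≠ j := ⟨i + 1, by fin_cases i <;> decide⟩
  set G := pd i.succ T with hGdef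
  have sG : ContDiffOn ℝ ∞ G (box I J) := smooth_pd hΩ h.smooth_T _
  have dG : ∀ y ∈ box I J, DifferentiableAt ℝ G y := fun y hy => differentiableAt_of_smooth hΩ sG hy
  have dG0 : ∀ y ∈ box I J, DifferentiableAt ℝ (pd 0 G) y := fun y hy =>
    differentiableAt_of_smooth hΩ (smooth_pd hΩ sG 0) hy
  have sk := smooth_relHubble hI hN ha j
  have dk : ∀ y ∈ box I J, HasDerivAt (relHubble N a j) (deriv (relHubble N a j) (y 0)) (y 0) :=
    fun y hy => (differentiableAt_of_smooth hI sk hy.1).hasDerivAt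
  -- the first integral `w` of the second order equation
  set c : ℝ → ℝ := fun t => a j t / a i t with hcdef
  set w : Pt 4 → ℝ := fun y => c (y 0) * (pd 0 G y - relHubble N a j (y 0) * G y) with hw
  have skG : ContDiffOn ℝ ∞ (fun y : Pt 4 => pd 0 G y - relHubble N a j (y 0) * G y) (box I J) :=
    (smooth_pd hΩ sG 0).sub ((smooth_time sk).mul sG)
  have sw : ContDiffOn ℝ ∞ w (box I J) :=
    (smooth_time ((ha j).1.div (ha i).1 (ha i).2)).mul skG
  -- The logarithmic derivative of a_j/a_i is k_j − k_i, so the integrability condition says exactly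
  -- that `w` is constant in time; on the slab it is zero.
  have hw0 : ∀ y ∈ box I J, pd 0 w y = 0 := by
    intro y hy
    have e := h.integrability hI hJ hN ha hy hij
    have hcd : HasDerivAt c _ (y 0) := hasDerivAt_ratio hI (ha j) (ha i) hy.1
    have dkG : DifferentiableAt ℝ (fun z : Pt 4 => relHubble N a j (z 0) * G z) y :=
      differentiableAt_of_smooth hΩ ((smooth_time sk).mul sG) hy
    rw [hw, pd_time_mul_zero hcd (differentiableAt_of_smooth hΩ skG hy), pd_sub (dG0 y hy) dkG,
      pd_time_mul_zero (dk y hy) (dG y hy)]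
    unfold relHubble at e ⊢
    linear_combination c (y 0) * e
  have hw1 : ∀ y ∈ box I J, w y = 0 := by
    intro y hy
    have hm := update_mem_box hy ht₀
    rw [eq_of_pd_eq_zero_or hΩ hc sw hy hm fun μ => ?_]
    · have hz : pd 0 G (Function.update y 0 t₀) = 0 := by
        have hopen : IsOpen (box I J ∩ {y : Pt 4 | y 0 ∈ U}) :=
          hΩ.inter (hU.preimage (continuous_apply 0))
        rw [pd_congr hopen (g := fun _ => (0 : ℝ)) (fun z hz => hG z hz.1 hz.2)
          ⟨hm, by simpa using htU⟩, pd_const]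
      simp only [hw]
      rw [hz, hG _ hm (by simpa using htU)]
      ring
    · by_cases hμ : μ = 0
      · right; subst hμ; exact hw0
      · left; simp [hμ]
  -- From w = 0 follows G' = k_jG, and N/a_j has logarithmic derivative −k_j, so `v` is constant in
  -- time as well.
  set v : Pt 4 → ℝ := fun y => (N (y 0) / a j (y 0)) * G y with hv
  have sv : ContDiffOn ℝ ∞ v (box I J) :=
    (smooth_time (hN.1.div (ha j).1 (ha j).2)).mul sG
  have hv0 : ∀ y ∈ box I J, pd 0 v y = 0 := by
    intro y hy
    have h1 := hw1 y hy
    have hcd := hasDerivAt_ratio hI hN (ha j) hy.1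
    have hne : c (y 0) ≠ 0 := div_ne_zero ((ha j).2 _ hy.1) ((ha i).2 _ hy.1)
    have h2 := (mul_eq_zero.1 h1).resolve_left hne
    rw [hv, pd_time_mul_zero (f := fun t => N t / a j t) hcd (dG y hy)]
    unfold relHubble at h2
    linear_combination (N (y 0) / a j (y 0)) * h2
  have hm := update_mem_box hx ht₀
  have hvx : v x = 0 := by
    rw [eq_of_pd_eq_zero_or hΩ hc sv hx hm fun μ => ?_]
    · simp only [hv]
      rw [hG _ hm (by simpa using htU), mul_zero]
    · by_cases hμ : μ = 0
      · right; subst hμ; exact hv0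
      · left; simp [hμ]
  exact (mul_eq_zero.1 hvx).resolve_left (div_ne_zero (hN.2 _ hx.1) ((ha j).2 _ hx.1))

/-- Two spatial components decouple when the scale factors are not proportional. -/
lemma pd_succ_space_eq_zero (h : IsConformalField I J N a T Z) (hI : IsOpen I)
    (hIc : I.OrdConnected) (hIne : I.Nonempty) (hJ : ∀ i, IsOpen (J i))
    (hJc : ∀ i, (J i).OrdConnected)
    (hN : IsScaleFactorOn I N) (ha : ∀ i, IsScaleFactorOn I (a i)) (hL : ¬ IsLRSOn I a)
    {i j : Fin 3} (hij : i ≠ j)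
    (hT : ∀ x ∈ box I J, pd i.succ (pd j.succ T) x = 0) {x : Pt 4} (hx : x ∈ box I J) :
    pd i.succ (Z j) x = 0 := by
  have hΩ := isOpen_box hI hJ
  have hc := convex_box hIc hJc
  -- The time-space equation turns a vanishing mixed derivative of T into a time-independent ∂_iZ_j.
  have key : ∀ i j : Fin 3, (∀ x ∈ box I J, pd i.succ (pd j.succ T) x = 0) → ∀ y ∈ box I J,
      pd 0 (pd i.succ (Z j)) y = 0 := by
    intro i j hT y hy
    have e := hT y hy
    have dZ := differentiableAt_of_smooth hΩ (smooth_pd hΩ (h.smooth_Z j) 0) hy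
    rw [pd_congr hΩ (fun z hz => h.time_space z hz j) hy,
      pd_time_mul_succ (hasDerivAt_ratioSq hI hN ha j hy.1).differentiableAt dZ,
      pd_comm hΩ (h.smooth_Z j) hy] at e
    exact (mul_eq_zero.1 e).resolve_left (ratioSq_ne_zero hN ha j hy.1)
  have k1 := key i j hT
  have k2 := key j i fun x hx => by rw [pd_comm hΩ h.smooth_T hx]; exact hT x hx
  obtain ⟨t₁, ht₁, hne⟩ := exists_relHubble_ne (N := N) hI hIc hIne ha hL hij
  have hm := update_mem_box hx ht₁
  rw [eq_of_pd_eq_zero_or hΩ hc (smooth_pd hΩ (h.smooth_Z j) _) hx hm fun μ => ?_]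
  -- At a time where the two rates differ, the mixed spatial equation and its time derivative are
  -- two linear equations for ∂_jZ_i and ∂_iZ_j whose determinant is a nonzero multiple of k_j −
  -- k_i.
  · set y := Function.update x 0 t₁ with hy
    have hy0 : y 0 = t₁ := by simp [hy]
    have e1 := h.space_space y hm i j hij
    have e2 := pd_congr hΩ (fun z hz => h.space_space z hz i j hij) hm 0
    have sB : ∀ l, DifferentiableAt ℝ (fun z : Pt 4 => ratioSq N a l (z 0)) y := fun l =>
      DifferentiableAt.comp y (f := fun y : Pt 4 => y 0)
        (hasDerivAt_ratioSq hI hN ha l hm.1).differentiableAt (differentiableAt_apply 0 y)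
    have D1 := differentiableAt_of_smooth hΩ (smooth_pd hΩ (h.smooth_Z i) j.succ) hm
    have D2 := differentiableAt_of_smooth hΩ (smooth_pd hΩ (h.smooth_Z j) i.succ) hm
    have M1 : DifferentiableAt ℝ (fun z => ratioSq N a i (z 0) * pd j.succ (Z i) z) y := (sB i).mul D1
    have M2 : DifferentiableAt ℝ (fun z => ratioSq N a j (z 0) * pd i.succ (Z j) z) y := (sB j).mul D2
    rw [pd_add M1 M2, pd_time_mul_zero (hasDerivAt_ratioSq hI hN ha i hm.1) D1,
      pd_time_mul_zero (hasDerivAt_ratioSq hI hN ha j hm.1) D2, k1 y hm, k2 y hm, pd_const] at e2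
    rw [hy0] at e1 e2
    have hB := ratioSq_ne_zero hN ha j ht₁
    have h3 : (relHubble N a j t₁ - relHubble N a i t₁) * (ratioSq N a j t₁ * pd i.succ (Z j) y) = 0 := by
      linear_combination (1 / 2) * e2 - relHubble N a i t₁ * e1
    exact (mul_eq_zero.1 ((mul_eq_zero.1 h3).resolve_left (sub_ne_zero.2 hne.symm))).resolve_left hB
  · by_cases hμ : μ = 0
    · right; subst hμ; exact k1
    · left; simp [hμ]

/-- The time component of a conformal Killing vector depends on time only. -/
lemma pd_succ_time_eq_zero (h : IsConformalField I J N a T Z) (hI : IsOpen I)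
    (hIc : I.OrdConnected) (hIne : I.Nonempty) (hJ : ∀ i, IsOpen (J i))
    (hJc : ∀ i, (J i).OrdConnected)
    (hN : IsScaleFactorOn I N) (ha : ∀ i, IsScaleFactorOn I (a i)) (hL : ¬ IsLRSOn I a)
    {t₀ : ℝ} (ht₀ : t₀ ∈ I) {p q r : Fin 3} (hpq : p ≠ q) (hpr : p ≠ r) (hqr : q ≠ r)
    (hp : weylGap N a p q r t₀ ≠ 0) (hq : weylGap N a q p r t₀ ≠ 0) (i : Fin 3) {x : Pt 4}
    (hx : x ∈ box I J) : pd i.succ T x = 0 := by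
  have hΩ := isOpen_box hI hJ
  have sgap : ∀ i j k, ContDiffOn ℝ ∞ (weylGap N a i j k) I := by
    intro i j k
    have s := fun i => smooth_relHubble hI hN ha i
    have s' := fun i => smooth_deriv hI (s i)
    exact (((s' j).add ((s j).pow 2)).sub ((s i).mul (s j))).sub
      (((s' k).add ((s k).pow 2)).sub ((s i).mul (s k)))
  -- A gap nonzero at t₀ is nonzero on an open set of times, where it forces the derivative to
  -- vanish; uniqueness extends this to all times.
  have slab : ∀ i j k : Fin 3, i ≠ j → i ≠ k → weylGap N a i j k t₀ ≠ 0 →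
      ∀ x ∈ box I J, pd i.succ T x = 0 := by
    intro i j k hij hik hne x hx
    have hU : IsOpen (I ∩ weylGap N a i j k ⁻¹' {0}ᶜ) :=
      (sgap i j k).continuousOn.isOpen_inter_preimage hI isOpen_compl_singleton
    refine h.pd_succ_eq_zero_of_slab hI hIc hJ hJc hN ha hU ht₀ ⟨ht₀, hne⟩ (fun y hy hyU => ?_) hx
    exact (mul_eq_zero.1 (h.weylGap_mul hI hJ hN ha hy hij hik)).resolve_left hyU.2
  have Gp := slab p q r hpq hpr hp
  have Gq := slab q p r hpq.symm hqr hq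
  -- Nothing is known about the gap of the axis `r`. The components along `p` and `q` do not depend
  -- on x_r, so the x_r-derivatives of their diagonal equations give G' = k_pG and G' = k_qG; hence
  -- G = 0 wherever k_p ≠ k_q.
  have Gr : ∀ x ∈ box I J, pd r.succ T x = 0 := by
    intro x hx
    have hT : ∀ s : Fin 3, (∀ x ∈ box I J, pd s.succ T x = 0) → ∀ x ∈ box I J,
        pd r.succ (pd s.succ T) x = 0 := fun s hs x hx => by
      rw [pd_congr hΩ hs hx, pd_const]
    have Xp := fun x hx => h.pd_succ_space_eq_zero hI hIc hIne hJ hJc hN ha hL hpr.symm (hT p Gp)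
      (x := x) hx
    have Xq := fun x hx => h.pd_succ_space_eq_zero hI hIc hIne hJ hJc hN ha hL hqr.symm (hT q Gq)
      (x := x) hx
    obtain ⟨t₁, ht₁, hne⟩ := exists_relHubble_ne (N := N) hI hIc hIne ha hL hpq
    have hU : IsOpen (I ∩ (fun t => relHubble N a p t - relHubble N a q t) ⁻¹' {0}ᶜ) :=
      ((smooth_relHubble hI hN ha p).sub
        (smooth_relHubble hI hN ha q)).continuousOn.isOpen_inter_preimage hI isOpen_compl_singleton
    refine h.pd_succ_eq_zero_of_slab hI hIc hJ hJc hN ha hU ht₁ ⟨ht₁, sub_ne_zero.2 hne⟩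
      (fun y hy hyU => ?_) hx
    have e1 := h.pd_diag hI hJ hN ha hy r p
    have e2 := h.pd_diag hI hJ hN ha hy r q
    rw [pd_comm hΩ (h.smooth_Z p) hy, pd_congr hΩ Xp hy, pd_const] at e1
    rw [pd_comm hΩ (h.smooth_Z q) hy, pd_congr hΩ Xq hy, pd_const] at e2
    have e3 : (relHubble N a p (y 0) - relHubble N a q (y 0)) * pd r.succ T y = 0 := by
      linear_combination e1 - e2
    exact (mul_eq_zero.1 e3).resolve_left hyU.2
  have : i = p ∨ i = q ∨ i = r := by
    revert hpq hpr hqr; clear * -; revert i p q r; decide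
  rcases this with rfl | rfl | rfl
  · exact Gp x hx
  · exact Gq x hx
  · exact Gr x hx

/-- Conformal Killing vectors of Bianchi I line elements that are neither locally rotationally
symmetric nor conformally flat are dilations and translations. -/
lemma exists_affField (h : IsConformalField I J N a T Z) (hI : IsOpen I)
    (hIc : I.OrdConnected) (hIne : I.Nonempty) (hJ : ∀ i, IsOpen (J i))
    (hJc : ∀ i, (J i).OrdConnected) (hJne : ∀ i, (J i).Nonempty)
    (hN : IsScaleFactorOn I N) (ha : ∀ i, IsScaleFactorOn I (a i)) (hL : ¬ IsLRSOn I a)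
    {t₀ : ℝ} (ht₀ : t₀ ∈ I) {p q r : Fin 3} (hpq : p ≠ q) (hpr : p ≠ r) (hqr : q ≠ r)
    (hp : weylGap N a p q r t₀ ≠ 0) (hq : weylGap N a q p r t₀ ≠ 0) :
    ∃ (S : ℝ → ℝ) (l m : Fin 3 → ℝ), (∀ x ∈ box I J, T x = S (x 0) ∧
      ∀ i, Z i x = l i * x i.succ + m i) ∧
      IsDilation I N a S l (fun t => deriv S t + logDeriv N t * S t) := by
  have hΩ := isOpen_box hI hJ
  have hc := convex_box hIc hJc
  have hG : ∀ i : Fin 3, ∀ x ∈ box I J, pd i.succ T x = 0 := fun i x hx =>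
    h.pd_succ_time_eq_zero hI hIc hIne hJ hJc hN ha hL ht₀ hpq hpr hqr hp hq i hx
  have hGG : ∀ i : Fin 3, ∀ μ, ∀ x ∈ box I J, pd μ (pd i.succ T) x = 0 := fun i μ x hx => by
    rw [pd_congr hΩ (hG i) hx, pd_const]
  have hZ0 : ∀ i : Fin 3, ∀ x ∈ box I J, pd 0 (Z i) x = 0 := fun i x hx => by
    have := h.time_space x hx i
    rw [hG i x hx] at this
    exact (mul_eq_zero.1 this.symm).resolve_left (ratioSq_ne_zero hN ha i hx.1)
  have hZij : ∀ i j : Fin 3, i ≠ j → ∀ x ∈ box I J, pd i.succ (Z j) x = 0 := fun i j hij x hx =>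
    h.pd_succ_space_eq_zero hI hIc hIne hJ hJc hN ha hL hij (hGG j _) hx
  choose y hy using hJne
  set x₀ : Pt 4 := Fin.cons t₀ y with hx₀
  have hx₀m : x₀ ∈ box I J := ⟨by simpa [hx₀] using ht₀, fun i => by simpa [hx₀] using hy i⟩
  -- The derivative ∂_iZ_i has zero gradient: in time and across the other axes by commuting
  -- derivatives, along its own axis because T is free of x_i.
  have hdiag : ∀ i : Fin 3, ∀ x ∈ box I J, pd i.succ (Z i) x = pd i.succ (Z i) x₀ := by
    intro i x hx
    refine eq_of_pd_eq_zero_or hΩ hc (smooth_pd hΩ (h.smooth_Z i) _) hx hx₀m fun μ => Or.inr ?_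
    intro z hz
    refine Fin.cases ?_ (fun j => ?_) μ
    · rw [pd_comm hΩ (h.smooth_Z i) hz, pd_congr hΩ (hZ0 i) hz, pd_const]
    · by_cases hij : j = i
      · subst hij
        rw [h.pd_diag hI hJ hN ha hz, hGG _ _ z hz, hG _ z hz]; ring
      · rw [pd_comm hΩ (h.smooth_Z i) hz, pd_congr hΩ (hZij j i hij) hz, pd_const]
  have hTt : ∀ x ∈ box I J, T x = T (Function.update x₀ 0 (x 0)) := by
    intro x hx
    refine eq_of_pd_eq_zero_or hΩ hc h.smooth_T hx (update_mem_box hx₀m hx.1) fun μ => ?_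
    refine Fin.cases (Or.inl (by simp)) (fun i => Or.inr (hG i)) μ
  have hupd : ∀ t ∈ I, HasDerivAt (fun t => Function.update x₀ 0 t) (Pi.single 0 1) t := fun t _ =>
    hasDerivAt_update x₀ 0 t
  have hS' : ∀ t ∈ I, HasDerivAt (fun t => T (Function.update x₀ 0 t))
      (pd 0 T (Function.update x₀ 0 t)) t := fun t ht =>
    (differentiableAt_of_smooth hΩ h.smooth_T (update_mem_box hx₀m ht)).hasFDerivAt.comp_hasDerivAt t
      (hupd t ht)
  have hSs : ContDiffOn ℝ ∞ (fun t => T (Function.update x₀ 0 t)) I :=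
    h.smooth_T.comp (contDiff_update ∞ x₀ 0).contDiffOn fun t ht => update_mem_box hx₀m ht
  -- T is read off on the time line through a base point, and `l` and `m` are the slope and the
  -- intercept there. The factor is defined by the time equation, so only the spatial equations need
  -- proof.
  refine ⟨fun t => T (Function.update x₀ 0 t), fun i => pd i.succ (Z i) x₀,
    fun i => Z i x₀ - pd i.succ (Z i) x₀ * x₀ i.succ, fun x hx => ⟨hTt x hx, fun i => ?_⟩,
    hSs, (smooth_deriv hI hSs).add ((smooth_logDeriv hI hN).mul hSs), fun t _ => rfl,
    fun t ht i => ?_⟩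
  · have hsm : ContDiffOn ℝ ∞ (fun x => Z i x - pd i.succ (Z i) x₀ * x i.succ) (box I J) :=
      (h.smooth_Z i).sub (contDiff_const.mul (contDiff_apply ℝ ℝ i.succ)).contDiffOn
    have := eq_of_pd_eq_zero_or hΩ hc hsm hx hx₀m fun μ => Or.inr ?_
    · linarith
    · intro z hz
      have dl : DifferentiableAt ℝ (fun x : Pt 4 => pd i.succ (Z i) x₀ * x i.succ) z := by fun_prop
      have e := pd_affField_succ 0 (fun i => pd i.succ (Z i) x₀) 0 z i μ
      simp only [affField_succ, Pi.zero_apply, add_zero] at e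
      rw [pd_sub (differentiableAt_of_smooth hΩ (h.smooth_Z i) hz) dl, e]
      refine Fin.cases ?_ (fun j => ?_) μ
      · rw [hZ0 i z hz, if_neg (Fin.succ_ne_zero i).symm]; ring
      · by_cases hij : j = i
        · subst hij; rw [hdiag j z hz]; simp
        · rw [hZij j i hij z hz, if_neg (by simpa using hij)]; ring
  · have hm := update_mem_box hx₀m ht
    have e := h.diag _ hm i
    rw [hdiag i _ hm] at e
    rw [(hS' t ht).deriv]
    simp only [Function.update_self, relHubble] at e
    linarith

end IsConformalField

/-- A symmetry generates a conformal field. -/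
lemma isConformalField_of_isLieSymmetry {V : Pt 4 → ℝ} (hI : IsOpen I) (hJ : ∀ i, IsOpen (J i))
    (hN : IsScaleFactorOn I N) (ha : ∀ i, IsScaleFactorOn I (a i))
    (hV : ContDiffOn ℝ ∞ V (box I J)) {X : PointField 4} {ζ : Pt 4 → Pt 4} {α b : Pt 4 → ℝ}
    (hX : IsAffineField (box I J) X ζ α b)
    (hL : IsLieSymmetry (bianchiI N a) V (box I J) X) :
    IsConformalField I J N a (fun y => ζ y 0) (fun i y => ζ y i.succ) := by
  have key := (isLieSymmetry_affine_iff hI hJ hN ha hV hX).1 hL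
  refine ⟨hX.smooth_ζ 0, fun i => hX.smooth_ζ i.succ, fun x hx i => ?_, fun x hx i j hij => ?_,
    fun x hx i => ?_⟩
  · have e := (key x hx).1 0 i.succ (Fin.succ_ne_zero i).symm
    have h1 := hN.2 _ hx.1
    have h2 := (ha i).2 _ hx.1
    simp only [invDiag_zero, invDiag_succ] at e
    unfold ratioSq
    field_simp at e ⊢
    linarith
  · have e := (key x hx).1 j.succ i.succ (by simpa using hij.symm)
    have h1 := hN.2 _ hx.1
    have h2 := (ha i).2 _ hx.1
    have h3 := (ha j).2 _ hx.1
    simp only [invDiag_succ] at e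
    unfold ratioSq
    field_simp at e ⊢
    linarith
  · have e := (key x hx).2.1 i.succ
    simp only [hubble_zero, hubble_succ] at e
    unfold relHubble
    linarith

end ckv


/-! ### The Weyl tensor -/

section weyl

/-- Christoffel symbols of a diagonal metric, in terms of Hubble rates and metric ratios. -/
noncomputable def chrAlg (e M : Fin 4 → ℝ) (κ μ ν : Fin 4) : ℝ :=
  (if μ = 0 ∧ κ = ν then e κ else 0) + (if ν = 0 ∧ κ = μ then e κ else 0)
    - (if κ = 0 ∧ μ = ν then e μ * M μ else 0)

/-- Time derivatives of the Christoffel symbols. -/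
noncomputable def chrAlg' (e e' M : Fin 4 → ℝ) (κ μ ν : Fin 4) : ℝ :=
  (if μ = 0 ∧ κ = ν then e' κ else 0) + (if ν = 0 ∧ κ = μ then e' κ else 0)
    - (if κ = 0 ∧ μ = ν then M μ * (e' μ + 2 * e μ ^ 2 - 2 * e 0 * e μ) else 0)

/-- Sectional components of the Riemann tensor. -/
noncomputable def secAlg (e e' M : Fin 4 → ℝ) (κ l : Fin 4) : ℝ :=
  if κ = 0 then -(M l * (e' l + e l ^ 2 - e 0 * e l))
  else if l = 0 then -(e' κ + e κ ^ 2 - e 0 * e κ)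
  else -(M l * e κ * e l)

set_option maxHeartbeats 4000000 in
-- A finite check over all index values: for a diagonal metric depending on time only, the curvature
-- has nothing but sectional components. The condition M 0 = 1 expresses that the ratios are taken
-- relative to the lapse entry.
lemma riemann_alg (e e' M : Fin 4 → ℝ) (hM : M 0 = 1) (κ l μ ν : Fin 4) :
    (if μ = 0 then chrAlg' e e' M κ ν l else 0) - (if ν = 0 then chrAlg' e e' M κ μ l else 0)
      + ∑ ρ, (chrAlg e M κ μ ρ * chrAlg e M ρ ν l - chrAlg e M κ ν ρ * chrAlg e M ρ μ l) =
    secAlg e e' M κ l * ((if κ = μ ∧ l = ν then 1 else 0) - (if κ = ν ∧ l = μ then 1 else 0)) := by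
  simp only [Fin.sum_univ_four]
  unfold chrAlg chrAlg' secAlg
  fin_cases κ <;> fin_cases l <;> fin_cases μ <;> fin_cases ν <;> simp [hM] <;> ring

end weyl


section weyl

variable {I : Set ℝ} {J : Fin 3 → Set ℝ} {N : ℝ → ℝ} {a : Fin 3 → ℝ → ℝ}

/-- Ratios of metric components to the lapse component. -/
noncomputable def metricRatio (N : ℝ → ℝ) (a : Fin 3 → ℝ → ℝ) (t : ℝ) (μ : Fin 4) : ℝ :=
  invDiag N a 0 t * diagOf N a μ t

lemma chr_eq_chrAlg (t : ℝ) (κ μ ν : Fin 4) :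
    chr N a κ μ ν t = chrAlg (fun μ => hubble N a μ t) (metricRatio N a t) κ μ ν := by
  unfold chr chrAlg metricRatio
  congr 1
  split_ifs <;> ring

lemma hasDerivAt_chr (hI : IsOpen I) (hN : IsScaleFactorOn I N)
    (ha : ∀ i, IsScaleFactorOn I (a i)) {t : ℝ} (ht : t ∈ I) (κ μ ν : Fin 4) :
    HasDerivAt (chr N a κ μ ν) (chrAlg' (fun μ => hubble N a μ t)
      (fun μ => deriv (hubble N a μ) t) (metricRatio N a t) κ μ ν) t := by
  have hh : ∀ μ, HasDerivAt (hubble N a μ) (deriv (hubble N a μ) t) t := fun μ =>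
    (differentiableAt_of_smooth hI (smooth_hubble hI hN ha μ) ht).hasDerivAt
  have hite : ∀ (P : Prop) [Decidable P] (f : ℝ → ℝ) (f' : ℝ), HasDerivAt f f' t →
      HasDerivAt (fun t => if P then f t else 0) (if P then f' else 0) t := by
    intro P _ f f' hf
    split_ifs
    · exact hf
    · exact hasDerivAt_const t 0
  have h3 := (hasDerivAt_invDiag hI hN ha ht 0).mul ((hh μ).mul (hasDerivAt_diagOf hI hN ha ht μ))
  have h := ((hite (μ = 0 ∧ κ = ν) _ _ (hh κ)).add (hite (ν = 0 ∧ κ = μ) _ _ (hh κ))).sub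
    (hite (κ = 0 ∧ μ = ν) _ _ h3)
  refine h.congr_deriv ?_
  unfold chrAlg' metricRatio
  congr 1
  split_ifs
  · simp only [Pi.mul_apply]; ring
  · rfl

lemma riemann_bianchiI (hI : IsOpen I) (hJ : ∀ i, IsOpen (J i)) (hN : IsScaleFactorOn I N)
    (ha : ∀ i, IsScaleFactorOn I (a i)) {x : Pt 4} (hx : x ∈ box I J) (κ l μ ν : Fin 4) :
    riemann (bianchiI N a) κ l μ ν x =
      secAlg (fun μ => hubble N a μ (x 0)) (fun μ => deriv (hubble N a μ) (x 0))
        (metricRatio N a (x 0)) κ l *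
      ((if κ = μ ∧ l = ν then 1 else 0) - (if κ = ν ∧ l = μ then 1 else 0)) := by
  have hΩ := isOpen_box hI hJ
  have hpd : ∀ ρ κ μ ν, pd ρ (christoffel (bianchiI N a) κ μ ν) x =
      if ρ = 0 then chrAlg' (fun μ => hubble N a μ (x 0)) (fun μ => deriv (hubble N a μ) (x 0))
        (metricRatio N a (x 0)) κ μ ν else 0 := by
    intro ρ κ μ ν
    have hd := hasDerivAt_chr hI hN ha hx.1 κ μ ν
    rw [pd_congr hΩ (fun y hy => christoffel_bianchiI hI hN ha hy.1 κ μ ν) hx,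
      pd_time hd.differentiableAt, hd.deriv]
  have hM : metricRatio N a (x 0) 0 = 1 := by
    unfold metricRatio
    rw [invDiag_eq_inv]; exact inv_mul_cancel₀ (diagOf_ne_zero hN ha hx.1 0)
  rw [← riemann_alg _ _ _ hM]
  unfold riemann
  simp only [hpd, christoffel_bianchiI hI hN ha hx.1, chr_eq_chrAlg]

lemma ricci_bianchiI (hI : IsOpen I) (hJ : ∀ i, IsOpen (J i)) (hN : IsScaleFactorOn I N)
    (ha : ∀ i, IsScaleFactorOn I (a i)) {x : Pt 4} (hx : x ∈ box I J) (l ν : Fin 4) :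
    ricci (bianchiI N a) l ν x = if l = ν then
      ∑ κ, (if κ = l then 0 else secAlg (fun μ => hubble N a μ (x 0))
        (fun μ => deriv (hubble N a μ) (x 0)) (metricRatio N a (x 0)) κ l) else 0 := by
  unfold ricci
  simp only [riemann_bianchiI hI hJ hN ha hx]
  by_cases h : l = ν
  · subst h
    rw [if_pos rfl]
    refine Finset.sum_congr rfl fun κ _ => ?_
    by_cases hκ : κ = l
    · simp [hκ]
    · simp [hκ, Ne.symm hκ]
  · rw [if_neg h]
    refine Finset.sum_eq_zero fun κ _ => ?_
    have : ¬(κ = ν ∧ l = κ) := fun h' => h (h'.2.trans h'.1)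
    simp [h, this]

lemma deriv_relHubble (hI : IsOpen I) (hN : IsScaleFactorOn I N)
    (ha : ∀ i, IsScaleFactorOn I (a i)) {t : ℝ} (ht : t ∈ I) (i : Fin 3) :
    deriv (relHubble N a i) t = deriv (hubble N a i.succ) t - deriv (hubble N a 0) t := by
  have h1 := (differentiableAt_of_smooth hI (smooth_hubble hI hN ha i.succ) ht).hasDerivAt
  have h2 := (differentiableAt_of_smooth hI (smooth_hubble hI hN ha 0) ht).hasDerivAt
  exact (h1.sub h2).deriv

set_option maxHeartbeats 1000000 in
/-- The Weyl tensor vanishes with the differences of its eigenvalues. -/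
lemma conformallyFlatOn_of_weylGap (hI : IsOpen I) (hJ : ∀ i, IsOpen (J i))
    (hN : IsScaleFactorOn I N) (ha : ∀ i, IsScaleFactorOn I (a i))
    (h : ∀ t ∈ I, weylGap N a 2 0 1 t = 0 ∧ weylGap N a 0 1 2 t = 0) :
    ConformallyFlatOn (bianchiI N a) (box I J) := by
  intro x hx κ l μ ν
  set e : Fin 4 → ℝ := fun μ => hubble N a μ (x 0) with he
  set e' : Fin 4 → ℝ := fun μ => deriv (hubble N a μ) (x 0) with he'
  set M := metricRatio N a (x 0) with hMdef
  have hM0 : ∀ μ, M μ ≠ 0 := fun μ =>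
    mul_ne_zero (invDiag_ne_zero hN ha hx.1 0) (diagOf_ne_zero hN ha hx.1 μ)
  have hM1 : M 0 = 1 := by
    simp only [hMdef]; unfold metricRatio
    rw [invDiag_eq_inv]; exact inv_mul_cancel₀ (diagOf_ne_zero hN ha hx.1 0)
  obtain ⟨g1, g2⟩ := h _ hx.1
  have hg : ∀ μ ν, bianchiI N a x μ ν = if μ = ν then diagOf N a 0 (x 0) * M μ else 0 := by
    intro μ ν
    rw [bianchiI_eq, Matrix.diagonal_apply]
    have : diagOf N a 0 (x 0) * M μ = diagOf N a μ (x 0) := by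
      simp only [hMdef]; unfold metricRatio
      rw [← mul_assoc, invDiag_eq_inv, mul_inv_cancel₀ (diagOf_ne_zero hN ha hx.1 0), one_mul]
    rw [this]
  have hginv : ∀ μ ν, (bianchiI N a x)⁻¹ μ ν =
      if μ = ν then (diagOf N a 0 (x 0))⁻¹ * (M μ)⁻¹ else 0 := by
    intro μ ν
    rw [inv_bianchiI hN ha hx.1, Matrix.diagonal_apply, invDiag_eq_inv, ← mul_inv]
    have := hg μ μ
    rw [bianchiI_eq, Matrix.diagonal_apply_eq, if_pos rfl] at this
    rw [this]
  set d := diagOf N a 0 (x 0) with hd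
  have hd0 : d ≠ 0 := diagOf_ne_zero hN ha hx.1 0
  set ric : Fin 4 → ℝ := fun l => ∑ κ, (if κ = l then 0 else secAlg e e' M κ l) with hric
  have hricci : ∀ l ν, ricci (bianchiI N a) l ν x = if l = ν then ric l else 0 := fun l ν =>
    ricci_bianchiI hI hJ hN ha hx l ν
  have hlow : riemannLow (bianchiI N a) κ l μ ν x = d * M κ * secAlg e e' M κ l *
      ((if κ = μ ∧ l = ν then 1 else 0) - (if κ = ν ∧ l = μ then 1 else 0)) := by
    unfold riemannLow
    simp only [riemann_bianchiI hI hJ hN ha hx, hg, ite_mul, zero_mul, Finset.sum_ite_eq,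
      Finset.mem_univ, if_true]
    ring
  have hsc : scalarCurv (bianchiI N a) x = ∑ μ, d⁻¹ * (M μ)⁻¹ * ric μ := by
    unfold scalarCurv
    simp only [hginv, hricci, ite_mul, zero_mul, Finset.sum_ite_eq, Finset.mem_univ, if_true]
  -- Riemann, Ricci and metric are diagonal in pairs of indices, so only the components with {κ, l}
  -- = {μ, ν} can be nonzero, and they are ± this expression.
  have hW : κ ≠ l → d * M κ * secAlg e e' M κ l - 1 / 2 * (d * M κ * ric l + d * M l * ric κ)
      + (∑ μ, d⁻¹ * (M μ)⁻¹ * ric μ) / 6 * (d * M κ * (d * M l)) = 0 := by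
    have m1 := hM0 1
    have m2 := hM0 2
    have m3 := hM0 3
    have r0 : relHubble N a 0 (x 0) = e 1 - e 0 := rfl
    have r1 : relHubble N a 1 (x 0) = e 2 - e 0 := rfl
    have r2 : relHubble N a 2 (x 0) = e 3 - e 0 := rfl
    have s0 : deriv (relHubble N a 0) (x 0) = e' 1 - e' 0 := deriv_relHubble hI hN ha hx.1 0
    have s1 : deriv (relHubble N a 1) (x 0) = e' 2 - e' 0 := deriv_relHubble hI hN ha hx.1 1
    have s2 : deriv (relHubble N a 2) (x 0) = e' 3 - e' 0 := deriv_relHubble hI hN ha hx.1 2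
    unfold weylGap at g1 g2
    rw [r0, r1, r2, s0, s1] at g1
    rw [r0, r1, r2, s1, s2] at g2
    have hr0 : ric 0 = -(e' 1 + e 1 ^ 2 - e 0 * e 1) - (e' 2 + e 2 ^ 2 - e 0 * e 2)
        - (e' 3 + e 3 ^ 2 - e 0 * e 3) := by
      simp [hric, Fin.sum_univ_four, secAlg]; ring
    have hr1 : ric 1 = -M 1 * (e' 1 + e 1 ^ 2 - e 0 * e 1 + e 1 * e 2 + e 1 * e 3) := by
      simp [hric, Fin.sum_univ_four, secAlg]; ring
    have hr2 : ric 2 = -M 2 * (e' 2 + e 2 ^ 2 - e 0 * e 2 + e 2 * e 1 + e 2 * e 3) := by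
      simp [hric, Fin.sum_univ_four, secAlg]; ring
    have hr3 : ric 3 = -M 3 * (e' 3 + e 3 ^ 2 - e 0 * e 3 + e 3 * e 1 + e 3 * e 2) := by
      simp [hric, Fin.sum_univ_four, secAlg]; ring
    have hsum : (∑ μ, d⁻¹ * (M μ)⁻¹ * ric μ) = d⁻¹ * (-2 * (e' 1 + e 1 ^ 2 - e 0 * e 1
        + (e' 2 + e 2 ^ 2 - e 0 * e 2) + (e' 3 + e 3 ^ 2 - e 0 * e 3)
        + e 1 * e 2 + e 1 * e 3 + e 2 * e 3)) := by
      rw [Fin.sum_univ_four, hr0, hr1, hr2, hr3, hM1]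
      field_simp
      ring
    rw [hsum]
    have hdd : ∀ R A B : ℝ, d⁻¹ * R / 6 * (d * A * (d * B)) = d * (R / 6 * A * B) := by
      intro R A B; field_simp
    rw [hdd]
    intro hκl
    have hsplit : ∀ A B C : ℝ, A - 1 / 2 * B + C = 0 → d * A - 1 / 2 * (d * B) + d * C = 0 := by
      intro A B C h; linear_combination d * h
    have : M κ * secAlg e e' M κ l - 1 / 2 * (M κ * ric l + M l * ric κ)
      + (-2 * (e' 1 + e 1 ^ 2 - e 0 * e 1
        + (e' 2 + e 2 ^ 2 - e 0 * e 2) + (e' 3 + e 3 ^ 2 - e 0 * e 3)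
        + e 1 * e 2 + e 1 * e 3 + e 2 * e 3)) / 6 * M κ * M l = 0 := by
      -- The rates, ratios and Ricci entries become atoms. Each of the six components is then an
      -- explicit combination of the two vanishing gaps.
      clear_value e e' M ric
      have z : ∀ κ l : Fin 4, κ < l → M κ * secAlg e e' M κ l
          - 1 / 2 * (M κ * ric l + M l * ric κ)
          + (-2 * (e' 1 + e 1 ^ 2 - e 0 * e 1
            + (e' 2 + e 2 ^ 2 - e 0 * e 2) + (e' 3 + e 3 ^ 2 - e 0 * e 3)
            + e 1 * e 2 + e 1 * e 3 + e 2 * e 3)) / 6 * M κ * M l = 0 := by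
        intro κ l hlt
        fin_cases κ <;> fin_cases l <;> first
          | (exact absurd hlt (by decide))
          | skip
        · simp [secAlg, hr0, hr1, hM1]
          linear_combination (-M 1 / 6) * (2 * g1 + g2)
        · simp [secAlg, hr0, hr2, hM1]
          linear_combination (-M 2 / 6) * (-g1 + g2)
        · simp [secAlg, hr0, hr3, hM1]
          linear_combination (-M 3 / 6) * (-g1 - 2 * g2)
        · simp [secAlg, hr1, hr2]
          linear_combination (M 1 * M 2 / 6) * (g1 + 2 * g2)
        · simp [secAlg, hr1, hr3]
          linear_combination (M 1 * M 3 / 6) * (g1 - g2)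
        · simp [secAlg, hr2, hr3]
          linear_combination (M 2 * M 3 / 6) * (-2 * g1 - g2)
      rcases lt_or_gt_of_ne hκl with hlt | hlt
      · exact z κ l hlt
      · have := z l κ hlt
        -- The pair symmetry of the lowered Riemann tensor reduces the remaining case to κ < l.
        have sy : M κ * secAlg e e' M κ l = M l * secAlg e e' M l κ := by
          have hs : ∀ κ l : Fin 4, l < κ → M κ * secAlg e e' M κ l = M l * secAlg e e' M l κ := by
            intro κ l hlt
            have hκ : κ ≠ 0 := (lt_of_le_of_lt (Fin.zero_le l) hlt).ne'
            unfold secAlg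
            rw [if_neg hκ]
            by_cases hl : l = 0
            · rw [if_pos hl, if_pos hl, hl, hM1]; ring
            · rw [if_neg hl, if_neg hl, if_neg hκ]; ring
          exact hs κ l hlt
        rw [sy]
        linear_combination this
    have := hsplit _ _ _ this
    linear_combination this
  unfold weyl
  rw [hlow, hsc]
  simp only [hg, hricci]
  set R := (∑ μ, d⁻¹ * (M μ)⁻¹ * ric μ) with hR
  by_cases hκl : κ = l
  · subst hκl
    by_cases h1 : κ = μ <;> by_cases h2 : κ = ν <;> simp [h1, h2]
  · have hw := hW hκl
    by_cases h1 : κ = μ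
    · subst h1
      have hlκ : l ≠ κ := Ne.symm hκl
      by_cases h2 : l = ν
      · subst h2
        simp [hκl, hlκ]
        linear_combination hw
      · by_cases h3 : κ = ν
        · subst h3; simp [hlκ]
        · simp [h2, h3]
    · by_cases h2 : κ = ν
      · subst h2
        have hlκ : l ≠ κ := Ne.symm hκl
        by_cases h3 : l = μ
        · subst h3
          simp [hκl, hlκ]
          linear_combination -hw
        · simp [h1, h3]
      · simp [h1, h2]

/-- The gaps are cyclic differences of three eigenvalues, up to a common factor. -/
lemma weylGap_cyclic (i j k : Fin 3) (t : ℝ) :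
    weylGap N a i j k t + weylGap N a j k i t + weylGap N a k i j t = 0 := by
  unfold weylGap; ring

lemma weylGap_antisymm (i j k : Fin 3) (t : ℝ) : weylGap N a i k j t = - weylGap N a i j k t := by
  unfold weylGap; ring

/-- Where one difference of eigenvalues is nonzero, two of them are. -/
lemma exists_two_weylGap {i j k : Fin 3} (hij : i ≠ j) (hik : i ≠ k) (hjk : j ≠ k) {t : ℝ}
    (h : weylGap N a i j k t ≠ 0) : ∃ p q r : Fin 3, p ≠ q ∧ p ≠ r ∧ q ≠ r ∧
      weylGap N a p q r t ≠ 0 ∧ weylGap N a q p r t ≠ 0 := by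
  have hc := weylGap_cyclic (N := N) (a := a) i j k t
  -- If the gap of `j` vanishes, that of `k` is minus that of `i`, hence nonzero.
  by_cases h1 : weylGap N a j k i t = 0
  · refine ⟨i, k, j, hik, hij, hjk.symm, ?_, ?_⟩
    · rw [weylGap_antisymm]; exact neg_ne_zero.2 h
    · intro h2; apply h; linarith
  · refine ⟨i, j, k, hij, hik, hjk, h, ?_⟩
    rw [weylGap_antisymm]; exact neg_ne_zero.2 h1

lemma exists_weylGap_of_not_flat (hI : IsOpen I) (hJ : ∀ i, IsOpen (J i))
    (hN : IsScaleFactorOn I N) (ha : ∀ i, IsScaleFactorOn I (a i))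
    (h : ¬ ConformallyFlatOn (bianchiI N a) (box I J)) :
    ∃ t ∈ I, ∃ p q r : Fin 3, p ≠ q ∧ p ≠ r ∧ q ≠ r ∧
      weylGap N a p q r t ≠ 0 ∧ weylGap N a q p r t ≠ 0 := by
  by_contra! hcon
  apply h
  refine conformallyFlatOn_of_weylGap hI hJ hN ha fun t ht => ⟨?_, ?_⟩
  · by_contra hne
    obtain ⟨p, q, r, h1, h2, h3, h4, h5⟩ :=
      exists_two_weylGap (i := 2) (j := 0) (k := 1) (by decide) (by decide) (by decide) hne
    exact h5 (hcon t ht p q r h1 h2 h3 h4)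
  · by_contra hne
    obtain ⟨p, q, r, h1, h2, h3, h4, h5⟩ :=
      exists_two_weylGap (i := 0) (j := 1) (k := 2) (by decide) (by decide) (by decide) hne
    exact h5 (hcon t ht p q r h1 h2 h3 h4)

end weyl


/-! ### From symmetries to the equation of the potential and back -/

section admits

variable {I : Set ℝ} {J : Fin 3 → Set ℝ} {N : ℝ → ℝ} {a : Fin 3 → ℝ → ℝ} {V : Pt 4 → ℝ}

/-- The gradient of α is that of −ψ, so every derivative of α in the criterion can be rewritten in
ψ. The constant part of α and the solution `b` leave no trace. -/
lemma potentialEq_of_isLieSymmetry (hI : IsOpen I) (hJ : ∀ i, IsOpen (J i))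
    (hN : IsScaleFactorOn I N) (ha : ∀ i, IsScaleFactorOn I (a i))
    (hV : ContDiffOn ℝ ∞ V (box I J)) {T ψ : ℝ → ℝ} {l m : Fin 3 → ℝ}
    (hK : IsDilation I N a T l ψ) {X : PointField 4} {α b : Pt 4 → ℝ}
    (hX : IsAffineField (box I J) X (affField T l m) α b)
    (hL : IsLieSymmetry (bianchiI N a) V (box I J) X) :
    PotentialEq N a V T l m ψ (box I J) := by
  have hΩ := isOpen_box hI hJ
  intro x hx
  have key := (isLieSymmetry_dilation_iff hI hJ hN ha hV hK hX).1 hL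
  have h0 : pd 0 (pd 0 α) x = -deriv (deriv ψ) (x 0) := by
    rw [pd_congr hΩ (g := fun y => -(deriv ψ (y 0))) (fun y hy => by linarith [(key y hy).1.1]) hx,
      pd_neg, pd_time (differentiableAt_of_smooth hI (smooth_deriv hI hK.smooth_ψ) hx.1)]
    simp
  have hi : ∀ i : Fin 3, pd i.succ (pd i.succ α) x = 0 := fun i => by
    rw [pd_congr hΩ (fun y hy => (key y hy).1.2 i) hx, pd_const]
  obtain ⟨⟨k1, -⟩, k2, -⟩ := key x hx
  rw [Fin.sum_univ_succ, h0] at k2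
  simp only [hi, mul_zero, Finset.sum_const_zero, add_zero, invDiag_zero] at k2
  have k3 : pd 0 α x = -deriv ψ (x 0) := by linarith
  rw [k3] at k2
  unfold dragCoeff at k2
  unfold waveTime
  linear_combination -k2

lemma isAffineField_conformalLift {T ψ : ℝ → ℝ}
    {l m : Fin 3 → ℝ} (hK : IsDilation I N a T l ψ) {ξ : Pt 4 → Pt 4} {Ψ : Pt 4 → ℝ}
    (hξ : ∀ p ∈ box I J, ξ p = affField T l m p) (hΨ : ∀ p ∈ box I J, Ψ p = ψ (p 0)) :
    IsAffineField (box I J) (conformalLift ξ Ψ) (affField T l m) (fun p => -ψ (p 0)) 0 where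
  smooth_ζ κ := smooth_affField hK.smooth_T l m κ
  smooth_α := (smooth_time hK.smooth_ψ).neg
  smooth_b := contDiffOn_const
  ξ_eq y hy _ := hξ y hy
  η_eq y hy u := by simp [conformalLift, hΨ y hy]

/-- Lie symmetry ⇒ equation of the potential ⇒ Noether symmetry ⇒ Lie symmetry: the cycle proves
both equivalences. -/
lemma symmetryIff_dilation (hI : IsOpen I) (hJ : ∀ i, IsOpen (J i))
    (hN : IsScaleFactorOn I N) (ha : ∀ i, IsScaleFactorOn I (a i))
    (hV : ContDiffOn ℝ ∞ V (box I J)) {T ψ : ℝ → ℝ} {l m : Fin 3 → ℝ}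
    (hK : IsDilation I N a T l ψ) {ξ : Pt 4 → Pt 4} {Ψ : Pt 4 → ℝ}
    (hξ : ∀ p ∈ box I J, ξ p = affField T l m p) (hΨ : ∀ p ∈ box I J, Ψ p = ψ (p 0)) {P : Prop}
    (hP : PotentialEq N a V T l m ψ (box I J) ↔ P) :
    SymmetryIff (bianchiI N a) V (box I J) (conformalLift ξ Ψ) P := by
  have hX := isAffineField_conformalLift (J := J) hK hξ hΨ
  have h1 := potentialEq_of_isLieSymmetry hI hJ hN ha hV hK hX
  have h2 := isNoetherSymmetry_dilation hI hJ hN ha hV hK hX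
  rw [← hP]
  exact ⟨⟨h1, fun h => (h2 h).1⟩, ⟨fun h => h1 h.1, h2⟩⟩

lemma admitsNoether_of_potentialEq (hI : IsOpen I) (hJ : ∀ i, IsOpen (J i))
    (hN : IsScaleFactorOn I N) (ha : ∀ i, IsScaleFactorOn I (a i))
    (hV : ContDiffOn ℝ ∞ V (box I J)) {T ψ : ℝ → ℝ} {l m : Fin 3 → ℝ}
    (hK : IsDilation I N a T l ψ) (hP : PotentialEq N a V T l m ψ (box I J))
    (hne : ∃ p ∈ box I J, affField T l m p ≠ 0) :
    AdmitsNoether (bianchiI N a) V (box I J) := by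
  refine ⟨conformalLift (affField T l m) (fun p => ψ (p 0)),
    isNoetherSymmetry_dilation hI hJ hN ha hV hK (isAffineField_conformalLift hK
      (fun _ _ => rfl) (fun _ _ => rfl)) hP, fun h => ?_⟩
  obtain ⟨p, hp, hne⟩ := hne
  exact hne (h.1 p hp 0)

/-- A non-trivial symmetry comes from a dilation or a translation. -/
lemma exists_dilation_of_admitsLie (hI : IsOpen I) (hIc : I.OrdConnected) (hIne : I.Nonempty)
    (hJ : ∀ i, IsOpen (J i)) (hJc : ∀ i, (J i).OrdConnected) (hJne : ∀ i, (J i).Nonempty)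
    (hN : IsScaleFactorOn I N) (ha : ∀ i, IsScaleFactorOn I (a i)) (hL : ¬ IsLRSOn I a)
    (hW : ∃ t ∈ I, ∃ p q r : Fin 3, p ≠ q ∧ p ≠ r ∧ q ≠ r ∧
      weylGap N a p q r t ≠ 0 ∧ weylGap N a q p r t ≠ 0)
    (hV : ContDiffOn ℝ ∞ V (box I J)) (h : AdmitsLie (bianchiI N a) V (box I J)) :
    ∃ T l m ψ, IsDilation I N a T l ψ ∧ PotentialEq N a V T l m ψ (box I J) ∧
      ¬ ((∀ t ∈ I, T t = 0) ∧ l = 0 ∧ m = 0) := by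
  have hΩ := isOpen_box hI hJ
  obtain ⟨X, hX, hnt⟩ := h
  obtain ⟨ζ, α, b, hA⟩ := hX.exists_affine hI hJ hN ha hV
  obtain ⟨t, ht, p, q, r, hpq, hpr, hqr, hp, hq⟩ := hW
  obtain ⟨S, l, m, hζ, hK⟩ := (isConformalField_of_isLieSymmetry hI hJ hN ha hV hA
    hX).exists_affField hI hIc hIne hJ hJc hJne hN ha hL ht hpq hpr hqr hp hq
  have hζ' : ∀ x ∈ box I J, ζ x = affField S l m x := by
    intro x hx
    ext κ
    refine Fin.cases ?_ (fun i => ?_) κ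
    · exact (hζ x hx).1
    · exact (hζ x hx).2 i
  have hA' : IsAffineField (box I J) X (affField S l m) α b :=
    ⟨smooth_affField hK.smooth_T l m, hA.smooth_α, hA.smooth_b,
      fun y hy u => (hA.ξ_eq y hy u).trans (hζ' y hy), hA.η_eq⟩
  refine ⟨S, l, m, _, hK, potentialEq_of_isLieSymmetry hI hJ hN ha hV hK hA' hX, ?_⟩
  -- With a vanishing base field the factor vanishes, so α is constant and `b` a solution: the
  -- symmetry would be trivial.
  rintro ⟨hS, rfl, rfl⟩
  apply hnt
  have key := (isLieSymmetry_dilation_iff hI hJ hN ha hV hK hA').1 hX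
  have hψ : ∀ s ∈ I, deriv S s + logDeriv N s * S s = 0 := by
    intro s hs
    have : S =ᶠ[nhds s] fun _ => (0 : ℝ) := by
      filter_upwards [hI.mem_nhds hs] with r hr using hS r hr
    rw [this.deriv_eq, hS s hs]; simp
  have hψ' : ∀ s ∈ I, deriv (fun t => deriv S t + logDeriv N t * S t) s = 0 := by
    intro s hs
    have : (fun t => deriv S t + logDeriv N t * S t) =ᶠ[nhds s] fun _ => (0 : ℝ) := by
      filter_upwards [hI.mem_nhds hs] with r hr using hψ r hr
    rw [this.deriv_eq]; simp
  choose y hy using hJne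
  have hm : (Fin.cons t y : Pt 4) ∈ box I J := ⟨ht, fun i => hy i⟩
  refine ⟨fun x hx u => ?_, α (Fin.cons t y), b, ⟨hA.smooth_b, fun x hx => (key x hx).2.2⟩,
    fun x hx u => ?_⟩
  · rw [hA'.ξ_eq x hx u]
    ext κ
    refine Fin.cases ?_ (fun i => ?_) κ
    · exact hS _ hx.1
    · simp
  · rw [hA.η_eq x hx u]
    congr 2
    refine eq_of_pd_eq_zero_or hΩ (convex_box hIc hJc) hA.smooth_α hx hm fun μ => Or.inr fun z hz => ?_
    refine Fin.cases ?_ (fun i => ?_) μ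
    · have := (key z hz).1.1
      rw [hψ' _ hz.1] at this
      linarith
    · exact (key z hz).1.2 i

end admits

/-! ### Potentials that are constant along a flow -/

section flow

variable {I : Set ℝ} {J : Fin 3 → Set ℝ} {N : ℝ → ℝ} {a : Fin 3 → ℝ → ℝ} {V W : Pt 4 → ℝ}

/-- No regularity is asked of U, so constancy on common level sets suffices: choose a point of the
level set, and the value 0 where there is none. -/
lemma factors_iff {Ω : Set (Pt 4)} {W f g h : Pt 4 → ℝ} :
    (∀ p ∈ Ω, ∀ p' ∈ Ω, f p = f p' → g p = g p' → h p = h p' → W p = W p') ↔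
      ∃ U : ℝ → ℝ → ℝ → ℝ, ∀ p ∈ Ω, W p = U (f p) (g p) (h p) := by
  classical
  constructor
  · intro H
    refine ⟨fun x y z => if hp : ∃ p ∈ Ω, f p = x ∧ g p = y ∧ h p = z then W hp.choose else 0,
      fun p hp => ?_⟩
    have hex : ∃ p' ∈ Ω, f p' = f p ∧ g p' = g p ∧ h p' = h p := ⟨p, hp, rfl, rfl, rfl⟩
    simp only [dif_pos hex]
    obtain ⟨h1, h2, h3, h4⟩ := hex.choose_spec
    exact H p hp _ h1 h2.symm h3.symm h4.symm
  · rintro ⟨U, hU⟩ p hp p' hp' e1 e2 e3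
    rw [hU p hp, hU p' hp', e1, e2, e3]

lemma pos_or_neg_of_ne_zero {f : ℝ → ℝ} (hIc : I.OrdConnected) (hf : ContinuousOn f I)
    (h0 : ∀ t ∈ I, f t ≠ 0) : (∀ t ∈ I, 0 < f t) ∨ (∀ t ∈ I, f t < 0) := by
  by_contra! hcon
  obtain ⟨⟨s, hs, hs'⟩, ⟨t, ht, ht'⟩⟩ := hcon
  obtain ⟨r, hr, hr'⟩ := hIc.isPreconnected.intermediate_value hs ht hf ⟨hs', ht'⟩
  exact h0 r hr hr'

/-- Convexity keeps the segment between two points of one orbit inside Ω. -/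
lemma translation_iff {Ω : Set (Pt 4)} (hΩ : IsOpen Ω) (hc : Convex ℝ Ω)
    (hW : DifferentiableOn ℝ W Ω) (v : Pt 4) :
    (∀ x ∈ Ω, fderiv ℝ W x v = 0) ↔
      ∀ p ∈ Ω, ∀ p' ∈ Ω, (∃ s : ℝ, p' = p + s • v) → W p = W p' := by
  constructor
  · rintro h p hp p' hp' ⟨s, rfl⟩
    refine eq_of_pd_eq_zero hΩ hc hW hp hp' fun z hz => ?_
    rw [add_sub_cancel_left, map_smul, h z hz, smul_zero]
  · intro h x hx
    have h1 := ((hW x hx).differentiableAt (hΩ.mem_nhds hx)).hasFDerivAt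
    have h2 : HasDerivAt (fun s : ℝ => x + s • v) v 0 := by
      simpa using ((hasDerivAt_id (0 : ℝ)).smul_const v).const_add x
    have h1' : HasFDerivAt W (fderiv ℝ W x) ((fun s : ℝ => x + s • v) 0) := by simpa using h1
    have h3 := h1'.comp_hasDerivAt (0 : ℝ) h2
    have h4 : (W ∘ fun s : ℝ => x + s • v) =ᶠ[nhds 0] fun _ => W x := by
      have hmem : (fun s : ℝ => x + s • v) ⁻¹' Ω ∈ nhds (0 : ℝ) :=
        h2.continuousAt.preimage_mem_nhds (by simpa using hΩ.mem_nhds hx)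
      filter_upwards [hmem] with s hs
      exact (h x hx _ hs ⟨s, rfl⟩).symm
    have h5 := h3.deriv
    rw [h4.deriv_eq] at h5
    simpa using h5.symm

/-- Data of the invariants `Eᵢ(t) xᵢ + Fᵢ(t)` of the field `T ∂_t + (lᵢ xᵢ + mᵢ) ∂ᵢ`. -/
structure IsInvariant (I : Set ℝ) (T : ℝ → ℝ) (l m : Fin 3 → ℝ) (E F : Fin 3 → ℝ → ℝ) : Prop where
  diff_E : ∀ i, ∀ t ∈ I, DifferentiableAt ℝ (E i) t
  diff_F : ∀ i, ∀ t ∈ I, DifferentiableAt ℝ (F i) t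
  ne_zero : ∀ i, ∀ t ∈ I, E i t ≠ 0
  eq_E : ∀ i, ∀ t ∈ I, E i t * l i + T t * deriv (E i) t = 0
  eq_F : ∀ i, ∀ t ∈ I, E i t * m i + T t * deriv (F i) t = 0

/-- As T has no zero, orbits are graphs over time, with spatial coordinates (v_i − F_i)/E_i. These
are monotone, so between two points of the box an orbit stays inside it, and a function with zero
derivative along the field takes equal values at both. -/
lemma flow_iff (hI : IsOpen I) (hIc : I.OrdConnected) (hJ : ∀ i, IsOpen (J i))
    (hJc : ∀ i, (J i).OrdConnected) {T : ℝ → ℝ} (hT : ContinuousOn T I) (hT0 : ∀ t ∈ I, T t ≠ 0)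
    {l m : Fin 3 → ℝ} {E F : Fin 3 → ℝ → ℝ} (hE : IsInvariant I T l m E F)
    (hW : DifferentiableOn ℝ W (box I J)) :
    (∀ x ∈ box I J, fderiv ℝ W x (affField T l m x) = 0) ↔
      ∀ p ∈ box I J, ∀ p' ∈ box I J, (∀ i : Fin 3, E i (p 0) * p i.succ + F i (p 0) =
        E i (p' 0) * p' i.succ + F i (p' 0)) → W p = W p' := by
  have hΩ := isOpen_box hI hJ
  set y : ℝ → Fin 3 → ℝ → ℝ := fun v i t => (v - F i t) / E i t with hy
  have hyd : ∀ v i, ∀ t ∈ I, HasDerivAt (y v i) ((l i * y v i t + m i) / T t) t := by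
    intro v i t ht
    have h1 := (hE.diff_E i t ht).hasDerivAt
    have h2 := (hE.diff_F i t ht).hasDerivAt
    have e0 := hE.ne_zero i t ht
    have t0 := hT0 t ht
    have e1 := hE.eq_E i t ht
    have e2 := hE.eq_F i t ht
    refine ((h2.const_sub v).div h1 e0).congr_deriv ?_
    simp only [hy]
    field_simp
    linear_combination -(E i t) * e2 - (v - F i t) * e1
  have hmono : ∀ v i, MonotoneOn (y v i) I ∨ AntitoneOn (y v i) I := by
    intro v i
    have hcont : ContinuousOn (y v i) I := fun t ht => (hyd v i t ht).continuousAt.continuousWithinAt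
    have hdiff : DifferentiableOn ℝ (y v i) (interior I) := fun t ht =>
      (hyd v i t (interior_subset ht)).differentiableAt.differentiableWithinAt
    -- The numerator of the velocity of the coordinate is constant in time. The denominator E_iT
    -- never changes sign, so the coordinate is monotone.
    set Q : ℝ → ℝ := fun t => l i * (v - F i t) + m i * E i t with hQ
    have hQd : ∀ t ∈ I, HasDerivAt Q 0 t := by
      intro t ht
      have h1 := (hE.diff_E i t ht).hasDerivAt
      have h2 := (hE.diff_F i t ht).hasDerivAt
      refine (((h2.const_sub v).const_mul (l i)).add (h1.const_mul (m i))).congr_deriv ?_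
      apply mul_left_cancel₀ (hT0 t ht)
      linear_combination -(l i) * hE.eq_F i t ht + m i * hE.eq_E i t ht
    have hQc : ∀ s ∈ I, ∀ t ∈ I, Q s = Q t := by
      intro s hs t ht
      refine hIc.convex.is_const_of_fderivWithin_eq_zero (𝕜 := ℝ)
        (fun s hs => (hQd s hs).differentiableAt.differentiableWithinAt) (fun s hs => ?_) hs ht
      have h3 := (hQd s hs).hasFDerivAt.hasFDerivWithinAt (s := I)
      rw [h3.fderivWithin (hI.uniqueDiffWithinAt hs)]
      ext; simp
    have hder : ∀ t ∈ I, deriv (y v i) t = Q t / (E i t * T t) := by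
      intro t ht
      have e0 := hE.ne_zero i t ht
      have t0 := hT0 t ht
      rw [(hyd v i t ht).deriv]
      simp only [hy, hQ]
      field_simp
    have hET : ContinuousOn (fun t => E i t * T t) I :=
      ContinuousOn.mul (fun t ht => (hE.diff_E i t ht).continuousAt.continuousWithinAt) hT
    rcases I.eq_empty_or_nonempty with rfl | ⟨t₀, ht₀⟩
    · left; intro s hs; exact absurd hs (Set.notMem_empty s)
    have hsign := pos_or_neg_of_ne_zero hIc hET fun t ht =>
      mul_ne_zero (hE.ne_zero i t ht) (hT0 t ht)
    have up : (∀ t ∈ I, 0 ≤ Q t₀ / (E i t * T t)) → MonotoneOn (y v i) I := fun h =>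
      monotoneOn_of_deriv_nonneg hIc.convex hcont hdiff fun t ht => by
        have ht := interior_subset ht
        rw [hder t ht, hQc t ht t₀ ht₀]; exact h t ht
    have down : (∀ t ∈ I, Q t₀ / (E i t * T t) ≤ 0) → AntitoneOn (y v i) I := fun h =>
      antitoneOn_of_deriv_nonpos hIc.convex hcont hdiff fun t ht => by
        have ht := interior_subset ht
        rw [hder t ht, hQc t ht t₀ ht₀]; exact h t ht
    rcases le_total 0 (Q t₀) with hq | hq <;> rcases hsign with hs | hs
    · exact Or.inl (up fun t ht => div_nonneg hq (hs t ht).le)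
    · exact Or.inr (down fun t ht => div_nonpos_of_nonneg_of_nonpos hq (hs t ht).le)
    · exact Or.inr (down fun t ht => div_nonpos_of_nonpos_of_nonneg hq (hs t ht).le)
    · exact Or.inl (up fun t ht => div_nonneg_of_nonpos hq (hs t ht).le)
  set γ : (Fin 3 → ℝ) → ℝ → Pt 4 := fun v t => Fin.cons t (fun i => y (v i) i t) with hγ
  have hγd : ∀ v, ∀ t ∈ I, HasDerivAt (γ v) ((T t)⁻¹ • affField T l m (γ v t)) t := by
    intro v t ht
    rw [hasDerivAt_pi]
    intro μ
    refine Fin.cases ?_ (fun i => ?_) μ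
    · have : (T t)⁻¹ * T t = 1 := inv_mul_cancel₀ (hT0 t ht)
      simp only [hγ, Fin.cons_zero, Pi.smul_apply, affField_zero, smul_eq_mul, this]
      exact hasDerivAt_id t
    · simp only [hγ, Fin.cons_succ, Pi.smul_apply, affField_succ, smul_eq_mul]
      refine (hyd (v i) i t ht).congr_deriv ?_
      rw [div_eq_inv_mul]
  have hγp : ∀ p ∈ box I J, γ (fun i => E i (p 0) * p i.succ + F i (p 0)) (p 0) = p := by
    intro p hp
    ext μ
    refine Fin.cases rfl (fun i => ?_) μ
    have := hE.ne_zero i _ hp.1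
    simp only [hγ, hy, Fin.cons_succ]
    field_simp
    ring
  have hWd : ∀ v, ∀ t ∈ I, γ v t ∈ box I J → HasDerivAt (W ∘ γ v)
      (fderiv ℝ W (γ v t) ((T t)⁻¹ • affField T l m (γ v t))) t := fun v t ht hm =>
    ((hW _ hm).differentiableAt (hΩ.mem_nhds hm)).hasFDerivAt.comp_hasDerivAt t (hγd v t ht)
  constructor
  · intro h
    have aux : ∀ p ∈ box I J, ∀ p' ∈ box I J, p 0 ≤ p' 0 →
        (∀ i : Fin 3, E i (p 0) * p i.succ + F i (p 0) =
          E i (p' 0) * p' i.succ + F i (p' 0)) → W p = W p' := by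
      intro p hp p' hp' hle hinv
      set v := fun i => E i (p 0) * p i.succ + F i (p 0) with hv
      have hv' : v = fun i => E i (p' 0) * p' i.succ + F i (p' 0) := funext hinv
      have e1 : γ v (p 0) = p := hγp p hp
      have e2 : γ v (p' 0) = p' := by rw [hv']; exact hγp p' hp'
      have hsub : Set.Icc (p 0) (p' 0) ⊆ I := hIc.out hp.1 hp'.1
      have hmem : ∀ t ∈ Set.Icc (p 0) (p' 0), γ v t ∈ box I J := by
        intro t ht
        refine ⟨hsub ht, fun i => ?_⟩
        have q1 : y (v i) i (p 0) = p i.succ := congrFun e1 i.succ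
        have q2 : y (v i) i (p' 0) = p' i.succ := congrFun e2 i.succ
        simp only [hγ, Fin.cons_succ]
        rcases hmono (v i) i with hm | hm
        · refine (hJc i).out (hp.2 i) (hp'.2 i) ⟨?_, ?_⟩
          · rw [← q1]; exact hm hp.1 (hsub ht) ht.1
          · rw [← q2]; exact hm (hsub ht) hp'.1 ht.2
        · refine (hJc i).out (hp'.2 i) (hp.2 i) ⟨?_, ?_⟩
          · rw [← q2]; exact hm (hsub ht) hp'.1 ht.2
          · rw [← q1]; exact hm hp.1 (hsub ht) ht.1
      have hd : ∀ t ∈ Set.Icc (p 0) (p' 0), HasDerivAt (W ∘ γ v) 0 t := by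
        intro t ht
        have := hWd v t (hsub ht) (hmem t ht)
        rwa [map_smul, h _ (hmem t ht), smul_zero] at this
      have := constant_of_has_deriv_right_zero (f := W ∘ γ v)
        (fun t ht => (hd t ht).continuousAt.continuousWithinAt)
        (fun t ht => (hd t ⟨ht.1, ht.2.le⟩).hasDerivWithinAt) (p' 0) ⟨hle, le_rfl⟩
      simp only [Function.comp_apply, e1, e2] at this
      exact this.symm
    intro p hp p' hp' hinv
    rcases le_total (p 0) (p' 0) with hle | hle
    · exact aux p hp p' hp' hle hinv
    · exact (aux p' hp' p hp hle fun i => (hinv i).symm).symm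
  · intro h x hx
    set v := fun i => E i (x 0) * x i.succ + F i (x 0) with hv
    have e1 : γ v (x 0) = x := hγp x hx
    have hm : γ v (x 0) ∈ box I J := by rw [e1]; exact hx
    have hd := hWd v (x 0) hx.1 hm
    -- Near x_0 the orbit lies in the box, and all its points share the invariants of x.
    have hev : (W ∘ γ v) =ᶠ[nhds (x 0)] fun _ => W x := by
      have h1 : γ v ⁻¹' box I J ∈ nhds (x 0) :=
        (hγd v _ hx.1).continuousAt.preimage_mem_nhds (hΩ.mem_nhds hm)
      filter_upwards [h1, hI.mem_nhds hx.1] with t ht htI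
      refine (h x hx _ ht fun i => ?_).symm
      have e0 := hE.ne_zero i t htI
      simp only [hγ, hy, hv, Fin.cons_zero, Fin.cons_succ]
      field_simp
      ring
    have h5 := hd.deriv
    rw [hev.deriv_eq, e1, map_smul] at h5
    simp only [deriv_const', smul_eq_mul] at h5
    exact (mul_eq_zero.1 h5.symm).resolve_left (inv_ne_zero (hT0 _ hx.1))

/-- The general solution of the equation of the potential. -/
lemma potentialEq_iff_form (hI : IsOpen I) (hIc : I.OrdConnected) (hJ : ∀ i, IsOpen (J i))
    (hJc : ∀ i, (J i).OrdConnected) (hV : ContDiffOn ℝ ∞ V (box I J)) {T ψ : ℝ → ℝ}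
    (hT : ContinuousOn T I) (hT0 : ∀ t ∈ I, T t ≠ 0)
    {l m : Fin 3 → ℝ} {E F : Fin 3 → ℝ → ℝ} (hE : IsInvariant I T l m E F)
    {M R : ℝ → ℝ} (hM0 : ∀ t ∈ I, M t ≠ 0) (hM : ∀ t ∈ I, DifferentiableAt ℝ M t)
    (hR : ∀ t ∈ I, DifferentiableAt ℝ R t)
    (hM' : ∀ t ∈ I, T t * deriv M t = 2 * ψ t * M t)
    (hR' : ∀ t ∈ I, T t * deriv R t = -(M t * waveTime N a ψ t)) (σ : Equiv.Perm (Fin 3)) :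
    PotentialEq N a V T l m ψ (box I J) ↔ ∃ U : ℝ → ℝ → ℝ → ℝ, ∀ p ∈ box I J,
      M (p 0) * V p - R (p 0) = U (E (σ 0) (p 0) * p (σ 0).succ + F (σ 0) (p 0))
        (E (σ 1) (p 0) * p (σ 1).succ + F (σ 1) (p 0))
        (E (σ 2) (p 0) * p (σ 2).succ + F (σ 2) (p 0)) := by
  have hΩ := isOpen_box hI hJ
  have hVd : ∀ x ∈ box I J, DifferentiableAt ℝ V x := fun x hx => differentiableAt_of_smooth hΩ hV hx
  have ht : ∀ (f : ℝ → ℝ) (x : Pt 4), DifferentiableAt ℝ f (x 0) → HasFDerivAt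
      (fun p : Pt 4 => f (p 0)) ((deriv f (x 0)) •
        (ContinuousLinearMap.proj (R := ℝ) (φ := fun _ : Fin 4 => ℝ) 0)) x := fun f x hf =>
    HasDerivAt.comp_hasFDerivAt x (f := fun p : Pt 4 => p 0) hf.hasDerivAt (hasFDerivAt_apply 0 x)
  have hWd : ∀ x ∈ box I J, HasFDerivAt (fun p => M (p 0) * V p - R (p 0))
      ((M (x 0) • fderiv ℝ V x + V x • (deriv M (x 0) •
        (ContinuousLinearMap.proj (R := ℝ) (φ := fun _ : Fin 4 => ℝ) 0)))
        - deriv R (x 0) • (ContinuousLinearMap.proj (R := ℝ) (φ := fun _ : Fin 4 => ℝ) 0)) x :=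
    fun x hx => ((ht M x (hM _ hx.1)).mul (hVd x hx).hasFDerivAt).sub (ht R x (hR _ hx.1))
  rw [← factors_iff]
  -- M is an integrating factor and R a primitive of the inhomogeneity: M times the equation is the
  -- derivative of MV − R along the field.
  have key : PotentialEq N a V T l m ψ (box I J) ↔ ∀ x ∈ box I J,
      fderiv ℝ (fun p => M (p 0) * V p - R (p 0)) x (affField T l m x) = 0 := by
    refine forall₂_congr fun x hx => ?_
    have e : fderiv ℝ (fun p => M (p 0) * V p - R (p 0)) x (affField T l m x) =
        M (x 0) * (fderiv ℝ V x (affField T l m x) + 2 * ψ (x 0) * V x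
          + waveTime N a ψ (x 0)) := by
      rw [(hWd x hx).fderiv]
      simp
      linear_combination V x * hM' _ hx.1 - hR' _ hx.1
    rw [e, mul_eq_zero, or_iff_right (hM0 _ hx.1)]
  rw [key, flow_iff hI hIc hJ hJc hT hT0 hE
    fun x hx => (hWd x hx).differentiableAt.differentiableWithinAt]
  -- The permutation only reorders the arguments of U; equality of all three invariants does not see
  -- it.
  refine forall₄_congr fun p hp p' hp' => ?_
  constructor
  · intro h e0 e1 e2
    refine h fun i => ?_
    obtain ⟨j, rfl⟩ := σ.surjective i
    fin_cases j
    · exact e0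
    · exact e1
    · exact e2
  · intro h e
    exact h (e _) (e _) (e _)

end flow


/-! ### Translations -/

section translations

variable {I : Set ℝ} {J : Fin 3 → Set ℝ} {N : ℝ → ℝ} {a : Fin 3 → ℝ → ℝ} {V : Pt 4 → ℝ}

@[simp] lemma adapt_zero (τ : ℝ → ℝ) (k : Fin 3 → ℝ) (σ : Equiv.Perm (Fin 3)) (p : Pt 4) :
    adapt τ k σ p 0 = τ (p 0) := rfl

lemma adapt_succ (τ : ℝ → ℝ) (k : Fin 3 → ℝ) (σ : Equiv.Perm (Fin 3)) (p : Pt 4) (i : Fin 3) :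
    adapt τ k σ p i.succ = k i * p (σ i).succ := rfl

@[simp] lemma adapt_one (τ : ℝ → ℝ) (k : Fin 3 → ℝ) (σ : Equiv.Perm (Fin 3)) (p : Pt 4) :
    adapt τ k σ p 1 = k 0 * p (σ 0).succ := rfl

@[simp] lemma adapt_two (τ : ℝ → ℝ) (k : Fin 3 → ℝ) (σ : Equiv.Perm (Fin 3)) (p : Pt 4) :
    adapt τ k σ p 2 = k 1 * p (σ 1).succ := rfl

@[simp] lemma adapt_three (τ : ℝ → ℝ) (k : Fin 3 → ℝ) (σ : Equiv.Perm (Fin 3)) (p : Pt 4) :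
    adapt τ k σ p 3 = k 2 * p (σ 2).succ := rfl

lemma adapt_id (p : Pt 4) : adapt id 1 1 p = p := by
  ext μ
  refine Fin.cases rfl (fun i => ?_) μ
  simp [adapt_succ]

lemma isDilation_zero : IsDilation I N a (fun _ => 0) 0 (fun _ => 0) :=
  ⟨contDiffOn_const, contDiffOn_const, fun t _ => by simp, fun t _ i => by simp⟩

lemma potentialEq_zero_iff {m : Fin 3 → ℝ} {Ω : Set (Pt 4)} :
    PotentialEq N a V (fun _ => 0) 0 m (fun _ => 0) Ω ↔
      ∀ x ∈ Ω, fderiv ℝ V x (Fin.cons 0 m : Pt 4) = 0 := by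
  have h : ∀ x, affField (fun _ => 0) 0 m x = (Fin.cons 0 m : Pt 4) := by
    intro x
    ext μ
    refine Fin.cases rfl (fun i => by simp) μ
  simp only [PotentialEq, h, waveTime, deriv_const', mul_zero, zero_mul, add_zero]

/-- The permutation brings a nonzero component to the front, and division by it yields the
invariants of the translation. -/
lemma fderiv_translation_iff (hI : IsOpen I) (hIc : I.OrdConnected) (hJ : ∀ i, IsOpen (J i))
    (hJc : ∀ i, (J i).OrdConnected) (hV : ContDiffOn ℝ ∞ V (box I J)) {m : Fin 3 → ℝ}
    (σ : Equiv.Perm (Fin 3)) (h0 : m (σ 0) ≠ 0) :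
    (∀ x ∈ box I J, fderiv ℝ V x (Fin.cons 0 m : Pt 4) = 0) ↔
      ∃ U : ℝ → ℝ → ℝ → ℝ, ∀ p ∈ box I J,
        V p = potIV (m (σ 0)) (m (σ 1)) (m (σ 2)) U (adapt id 1 σ p) := by
  rw [translation_iff (isOpen_box hI hJ) (convex_box hIc hJc) (hV.differentiableOn (by simp))]
  simp only [potIV, adapt_zero, adapt_one, adapt_two, adapt_three, Pi.one_apply, one_mul, id]
  rw [← factors_iff]
  refine forall₂_congr fun p hp => forall₂_congr fun p' hp' => ?_
  constructor
  · intro h e0 e1 e2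
    -- The flow parameter is forced by the coordinate with nonzero component.
    refine h ⟨(p' (σ 0).succ - p (σ 0).succ) / m (σ 0), ?_⟩
    ext μ
    refine Fin.cases (by simpa using e0.symm) (fun i => ?_) μ
    obtain ⟨j, rfl⟩ := σ.surjective i
    simp only [Pi.add_apply, Pi.smul_apply, Fin.cons_succ, smul_eq_mul]
    field_simp at e1 e2 ⊢
    fin_cases j
    · simp only [Fin.zero_eta]; ring
    · simp; linear_combination -e1
    · simp; linear_combination -e2
  · rintro h ⟨s, rfl⟩
    refine h (by simp) ?_ ?_
    · simp only [Pi.add_apply, Pi.smul_apply, Fin.cons_succ, smul_eq_mul]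
      field_simp
      ring
    · simp only [Pi.add_apply, Pi.smul_apply, Fin.cons_succ, smul_eq_mul]
      field_simp
      ring

/-- For ψ = 0 the term Δψ drops out, so the metric does not matter. -/
lemma isTranslationForm_iff (hI : IsOpen I) (hIc : I.OrdConnected) (hJ : ∀ i, IsOpen (J i))
    (hJc : ∀ i, (J i).OrdConnected) (hV : ContDiffOn ℝ ∞ V (box I J)) :
    IsTranslationForm V (box I J) ↔
      ∃ m : Fin 3 → ℝ, m ≠ 0 ∧ PotentialEq N a V (fun _ => 0) 0 m (fun _ => 0) (box I J) := by
  simp only [potentialEq_zero_iff]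
  constructor
  · rintro ⟨σ, α, β, γ, U, hα, hU⟩
    set m : Fin 3 → ℝ := fun i => ![α, β, γ] (σ.symm i) with hm
    have h0 : m (σ 0) = α := by simp [hm]
    have h1 : m (σ 1) = β := by simp [hm]
    have h2 : m (σ 2) = γ := by simp [hm]
    refine ⟨m, fun h => hα (by rw [← h0, h]; rfl), ?_⟩
    rw [fderiv_translation_iff hI hIc hJ hJc hV σ (by rwa [h0]), h0, h1, h2]
    exact ⟨U, hU⟩
  · rintro ⟨m, hm, h⟩
    -- A swap with the first axis brings a nonzero component of `m` to the front.
    obtain ⟨i, hi⟩ := Function.ne_iff.1 hm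
    rw [fderiv_translation_iff hI hIc hJ hJc hV (Equiv.swap 0 i) (by simpa using hi)] at h
    obtain ⟨U, hU⟩ := h
    exact ⟨_, _, _, _, U, by simpa using hi, hU⟩

lemma symmetryIff_translation (hI : IsOpen I) (hIc : I.OrdConnected) (hJ : ∀ i, IsOpen (J i))
    (hJc : ∀ i, (J i).OrdConnected) (hN : IsScaleFactorOn I N)
    (ha : ∀ i, IsScaleFactorOn I (a i)) (hV : ContDiffOn ℝ ∞ V (box I J))
    (σ : Equiv.Perm (Fin 3)) (α β γ : ℝ) (h0 : ![α, β, γ] (σ 0) ≠ 0) :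
    SymmetryIff (bianchiI N a) V (box I J) (conformalLift (transl α β γ) 0)
      (∃ U : ℝ → ℝ → ℝ → ℝ, ∀ p ∈ box I J,
        V p = potIV (![α, β, γ] (σ 0)) (![α, β, γ] (σ 1)) (![α, β, γ] (σ 2)) U
          (adapt id 1 σ p)) := by
  refine symmetryIff_dilation (m := ![α, β, γ]) hI hJ hN ha hV isDilation_zero (fun p _ => ?_)
    (fun _ _ => rfl)
    (potentialEq_zero_iff.trans (fderiv_translation_iff hI hIc hJ hJc hV σ h0))
  ext μ
  refine Fin.cases rfl (fun i => ?_) μ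
  fin_cases i <;> simp [transl, affField]

lemma admitsNoether_of_translationForm (hI : IsOpen I) (hIc : I.OrdConnected)
    (hIne : I.Nonempty) (hJ : ∀ i, IsOpen (J i)) (hJc : ∀ i, (J i).OrdConnected)
    (hJne : ∀ i, (J i).Nonempty) (hN : IsScaleFactorOn I N)
    (ha : ∀ i, IsScaleFactorOn I (a i)) (hV : ContDiffOn ℝ ∞ V (box I J))
    (h : IsTranslationForm V (box I J)) : AdmitsNoether (bianchiI N a) V (box I J) := by
  obtain ⟨m, hm, hP⟩ := (isTranslationForm_iff (N := N) (a := a) hI hIc hJ hJc hV).1 h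
  obtain ⟨t, ht⟩ := hIne
  choose y hy using hJne
  obtain ⟨i, hi⟩ := Function.ne_iff.1 hm
  refine admitsNoether_of_potentialEq hI hJ hN ha hV isDilation_zero hP
    ⟨(Fin.cons t y : Pt 4), ⟨ht, hy⟩, fun h0 => hi ?_⟩
  simpa using congrFun h0 i.succ

lemma symmetryIff_x (hI : IsOpen I) (hIc : I.OrdConnected) (hJ : ∀ i, IsOpen (J i))
    (hJc : ∀ i, (J i).OrdConnected) (hN : IsScaleFactorOn I N)
    (ha : ∀ i, IsScaleFactorOn I (a i)) (hV : ContDiffOn ℝ ∞ V (box I J)) :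
    SymmetryIff (bianchiI N a) V (box I J) (conformalLift (transl 1 0 0) 0)
      (∃ U : ℝ → ℝ → ℝ → ℝ, ∀ p ∈ box I J, V p = U (p 0) (p 2) (p 3)) := by
  simpa [potIV] using symmetryIff_translation hI hIc hJ hJc hN ha hV 1 1 0 0 (by simp)

lemma symmetryIff_y (hI : IsOpen I) (hIc : I.OrdConnected) (hJ : ∀ i, IsOpen (J i))
    (hJc : ∀ i, (J i).OrdConnected) (hN : IsScaleFactorOn I N)
    (ha : ∀ i, IsScaleFactorOn I (a i)) (hV : ContDiffOn ℝ ∞ V (box I J)) :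
    SymmetryIff (bianchiI N a) V (box I J) (conformalLift (transl 0 1 0) 0)
      (∃ U : ℝ → ℝ → ℝ → ℝ, ∀ p ∈ box I J, V p = U (p 0) (p 1) (p 3)) := by
  have e : Equiv.swap (0 : Fin 3) 1 2 = 2 := by decide
  simpa [potIV, e] using
    symmetryIff_translation hI hIc hJ hJc hN ha hV (Equiv.swap 0 1) 0 1 0 (by simp)

lemma symmetryIff_z (hI : IsOpen I) (hIc : I.OrdConnected) (hJ : ∀ i, IsOpen (J i))
    (hJc : ∀ i, (J i).OrdConnected) (hN : IsScaleFactorOn I N)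
    (ha : ∀ i, IsScaleFactorOn I (a i)) (hV : ContDiffOn ℝ ∞ V (box I J)) :
    SymmetryIff (bianchiI N a) V (box I J) (conformalLift (transl 0 0 1) 0)
      (∃ U : ℝ → ℝ → ℝ → ℝ, ∀ p ∈ box I J, V p = U (p 0) (p 1) (p 2)) := by
  -- The inverse rotation puts z first and keeps x, y in order, so that U is applied to (t, x, y).
  have e0 : (finRotate 3)⁻¹ 0 = 2 := by decide
  have e1 : (finRotate 3)⁻¹ 1 = 0 := by decide
  have e2 : (finRotate 3)⁻¹ 2 = 1 := by decide
  have h := symmetryIff_translation hI hIc hJ hJc hN ha hV (finRotate 3)⁻¹ 0 0 1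
    (by rw [e0]; simp)
  simpa [potIV, e0, e1, e2] using h

lemma symmetryIff_transl (hI : IsOpen I) (hIc : I.OrdConnected) (hJ : ∀ i, IsOpen (J i))
    (hJc : ∀ i, (J i).OrdConnected) (hN : IsScaleFactorOn I N)
    (ha : ∀ i, IsScaleFactorOn I (a i)) (hV : ContDiffOn ℝ ∞ V (box I J)) (α β γ : ℝ)
    (hα : α ≠ 0) :
    SymmetryIff (bianchiI N a) V (box I J) (conformalLift (transl α β γ) 0)
      (∃ U : ℝ → ℝ → ℝ → ℝ, ∀ p ∈ box I J, V p = potIV α β γ U p) := by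
  simpa [adapt_id] using symmetryIff_translation hI hIc hJ hJc hN ha hV 1 α β γ (by simpa)

end translations


/-! ### Integrated flows and their transport under changes of coordinates -/

section normalFlow

variable {I : Set ℝ} {J : Fin 3 → Set ℝ} {N : ℝ → ℝ} {a : Fin 3 → ℝ → ℝ} {V : Pt 4 → ℝ}
  {T ψ M R : ℝ → ℝ} {l m : Fin 3 → ℝ} {E F : Fin 3 → ℝ → ℝ}

/-- A homothety with the data that integrate the equation of its potentials. -/
structure IsNormalFlow (I : Set ℝ) (N : ℝ → ℝ) (a : Fin 3 → ℝ → ℝ) (T : ℝ → ℝ) (l m : Fin 3 → ℝ)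
    (ψ : ℝ → ℝ) (E F : Fin 3 → ℝ → ℝ) (M R : ℝ → ℝ) : Prop where
  dilation : IsDilation I N a T l ψ
  T_ne : ∀ t ∈ I, T t ≠ 0
  invariant : IsInvariant I T l m E F
  M_ne : ∀ t ∈ I, M t ≠ 0
  diff_M : ∀ t ∈ I, DifferentiableAt ℝ M t
  diff_R : ∀ t ∈ I, DifferentiableAt ℝ R t
  eq_M : ∀ t ∈ I, T t * deriv M t = 2 * ψ t * M t
  eq_R : ∀ t ∈ I, T t * deriv R t = -(M t * waveTime N a ψ t)

lemma IsNormalFlow.potentialEq_iff (h : IsNormalFlow I N a T l m ψ E F M R) (hI : IsOpen I)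
    (hIc : I.OrdConnected) (hJ : ∀ i, IsOpen (J i)) (hJc : ∀ i, (J i).OrdConnected)
    (hV : ContDiffOn ℝ ∞ V (box I J)) (σ : Equiv.Perm (Fin 3)) :
    PotentialEq N a V T l m ψ (box I J) ↔ ∃ U : ℝ → ℝ → ℝ → ℝ, ∀ p ∈ box I J,
      M (p 0) * V p - R (p 0) = U (E (σ 0) (p 0) * p (σ 0).succ + F (σ 0) (p 0))
        (E (σ 1) (p 0) * p (σ 1).succ + F (σ 1) (p 0))
        (E (σ 2) (p 0) * p (σ 2).succ + F (σ 2) (p 0)) :=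
  potentialEq_iff_form hI hIc hJ hJc hV h.dilation.smooth_T.continuousOn h.T_ne h.invariant h.M_ne
    h.diff_M h.diff_R h.eq_M h.eq_R σ

lemma isOpen_image_of_deriv_ne {τ : ℝ → ℝ} (hI : IsOpen I) (hτ : ContDiffOn ℝ ∞ τ I)
    (h0 : ∀ t ∈ I, deriv τ t ≠ 0) : IsOpen (τ '' I) := by
  rw [isOpen_iff_mem_nhds]
  rintro _ ⟨t, ht, rfl⟩
  have h1 : HasStrictDerivAt τ (deriv τ t) t :=
    (hτ.contDiffAt (hI.mem_nhds ht)).hasStrictDerivAt (by simp)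
  rw [← h1.map_nhds_eq (h0 t ht)]
  exact Filter.image_mem_map (hI.mem_nhds ht)

/-- The line element fixes lapse and scale factors only up to sign, and the logarithmic derivative
of a square is twice that of its root. -/
lemma logDeriv_eq_of_sq_eq {f g : ℝ → ℝ} {t : ℝ} (h : ∀ᶠ s in nhds t, f s ^ 2 = g s ^ 2)
    (hf : DifferentiableAt ℝ f t) (hg : DifferentiableAt ℝ g t) :
    logDeriv f t = logDeriv g t := by
  have h1 : logDeriv (fun s => f s ^ 2) t = logDeriv (fun s => g s ^ 2) t := by
    have h' : (fun s => f s ^ 2) =ᶠ[nhds t] fun s => g s ^ 2 := h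
    rw [logDeriv_apply, logDeriv_apply, h'.deriv_eq, h'.eq_of_nhds]
  rw [logDeriv_fun_pow hf, logDeriv_fun_pow hg] at h1
  simpa using h1

lemma waveTime_eq_sum (ψ : ℝ → ℝ) (t : ℝ) : waveTime N a ψ t = -(1 / N t ^ 2) *
    (deriv (deriv ψ) t + ((∑ i, logDeriv (a i) t) - logDeriv N t) * deriv ψ t) := by
  rw [Fin.sum_univ_three]; rfl

section pullback

variable {N' τ : ℝ → ℝ} {a' : Fin 3 → ℝ → ℝ} {k : Fin 3 → ℝ} {σ : Equiv.Perm (Fin 3)}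

lemma IsAdapted.logDeriv_space (hA : IsAdapted I N a N' a' τ k σ) (hI : IsOpen I)
    (ha : ∀ i, IsScaleFactorOn I (a i)) (ha' : ∀ i, IsScaleFactorOn (τ '' I) (a' i)) {t : ℝ}
    (ht : t ∈ I) (i : Fin 3) :
    logDeriv (a (σ i)) t = logDeriv (a' i) (τ t) * deriv τ t := by
  obtain ⟨hτ, h0, hk, hsq⟩ := hA
  have hτ' := (differentiableAt_of_smooth hI hτ ht).hasDerivAt
  have hd := (ha' i).diff (isOpen_image_of_deriv_ne hI hτ h0) (Set.mem_image_of_mem τ ht)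
  have hc : HasDerivAt (fun s => k i * a' i (τ s)) (k i * (deriv (a' i) (τ t) * deriv τ t)) t :=
    (hd.hasDerivAt.comp t hτ').const_mul (k i)
  rw [logDeriv_eq_of_sq_eq (g := fun s => k i * a' i (τ s)) ?_ ((ha _).diff hI ht)
    hc.differentiableAt, logDeriv_apply, hc.deriv, logDeriv_apply]
  · have := (ha' i).2 _ (Set.mem_image_of_mem τ ht)
    have := hk i
    field_simp
  · filter_upwards [hI.mem_nhds ht] with s hs using (hsq s hs).2 i

/-- The lapse acquires the factor τ', hence the extra term τ''/τ'. -/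
lemma IsAdapted.logDeriv_time (hA : IsAdapted I N a N' a' τ k σ) (hI : IsOpen I)
    (hN : IsScaleFactorOn I N) (hN' : IsScaleFactorOn (τ '' I) N') {t : ℝ} (ht : t ∈ I) :
    logDeriv N t = logDeriv N' (τ t) * deriv τ t + deriv (deriv τ) t / deriv τ t := by
  obtain ⟨hτ, h0, hk, hsq⟩ := hA
  have hτ' := (differentiableAt_of_smooth hI hτ ht).hasDerivAt
  have hτ'' := (differentiableAt_of_smooth hI (smooth_deriv hI hτ) ht).hasDerivAt
  have hd := hN'.diff (isOpen_image_of_deriv_ne hI hτ h0) (Set.mem_image_of_mem τ ht)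
  have hc : HasDerivAt (fun s => N' (τ s) * deriv τ s) (deriv N' (τ t) * deriv τ t * deriv τ t
      + N' (τ t) * deriv (deriv τ) t) t :=
    (hd.hasDerivAt.comp t hτ').mul hτ''
  rw [logDeriv_eq_of_sq_eq (g := fun s => N' (τ s) * deriv τ s) ?_ (hN.diff hI ht)
    hc.differentiableAt, logDeriv_apply, hc.deriv, logDeriv_apply]
  · have := hN'.2 _ (Set.mem_image_of_mem τ ht)
    have := h0 t ht
    field_simp
  · filter_upwards [hI.mem_nhds ht] with s hs using (hsq s hs).1

lemma IsAdapted.deriv_comp (hA : IsAdapted I N a N' a' τ k σ) (hI : IsOpen I) {f : ℝ → ℝ} {t : ℝ}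
    (ht : t ∈ I) (hf : DifferentiableAt ℝ f (τ t)) :
    HasDerivAt (fun s => f (τ s)) (deriv f (τ t) * deriv τ t) t :=
  hf.hasDerivAt.comp t (differentiableAt_of_smooth hI hA.1 ht).hasDerivAt

/-- Invariance of the wave operator: the permutation leaves the sum of the spatial rates unchanged,
and the τ'' of the chain rule cancels that of the lapse. -/
lemma IsAdapted.waveTime_comp (hA : IsAdapted I N a N' a' τ k σ) (hI : IsOpen I)
    (hN : IsScaleFactorOn I N) (ha : ∀ i, IsScaleFactorOn I (a i))
    (hN' : IsScaleFactorOn (τ '' I) N') (ha' : ∀ i, IsScaleFactorOn (τ '' I) (a' i))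
    (hψ : ContDiffOn ℝ ∞ ψ (τ '' I)) {t : ℝ} (ht : t ∈ I) :
    waveTime N a (fun s => ψ (τ s)) t = waveTime N' a' ψ (τ t) := by
  have hI' := isOpen_image_of_deriv_ne hI hA.1 hA.2.1
  have hm : ∀ s ∈ I, τ s ∈ τ '' I := fun s hs => Set.mem_image_of_mem τ hs
  have hd : ∀ s ∈ I, deriv (fun s => ψ (τ s)) s = deriv ψ (τ s) * deriv τ s := fun s hs =>
    (hA.deriv_comp hI hs (differentiableAt_of_smooth hI' hψ (hm s hs))).deriv
  have hdd : deriv (deriv fun s => ψ (τ s)) t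
      = deriv (deriv ψ) (τ t) * deriv τ t * deriv τ t + deriv ψ (τ t) * deriv (deriv τ) t := by
    have e : (deriv fun s => ψ (τ s)) =ᶠ[nhds t] fun s => deriv ψ (τ s) * deriv τ s := by
      filter_upwards [hI.mem_nhds ht] with s hs using hd s hs
    rw [e.deriv_eq]
    exact ((hA.deriv_comp hI ht (differentiableAt_of_smooth hI' (smooth_deriv hI' hψ)
      (hm t ht))).mul
      (differentiableAt_of_smooth hI (smooth_deriv hI hA.1) ht).hasDerivAt).deriv
  have hs : ∑ i, logDeriv (a i) t = (∑ i, logDeriv (a' i) (τ t)) * deriv τ t := by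
    rw [← Equiv.sum_comp σ, Finset.sum_mul]
    exact Finset.sum_congr rfl fun i _ => hA.logDeriv_space hI ha ha' ht i
  rw [waveTime_eq_sum, waveTime_eq_sum, hdd, hd t ht, hs, hA.logDeriv_time hI hN hN' ht,
    (hA.2.2.2 t ht).1]
  have := hN'.2 _ (hm t ht)
  have := hA.2.1 t ht
  field_simp
  ring

lemma IsAdapted.dilation (hA : IsAdapted I N a N' a' τ k σ) (hI : IsOpen I)
    (hN : IsScaleFactorOn I N) (ha : ∀ i, IsScaleFactorOn I (a i))
    (hN' : IsScaleFactorOn (τ '' I) N') (ha' : ∀ i, IsScaleFactorOn (τ '' I) (a' i))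
    (h : IsDilation (τ '' I) N' a' T l ψ) :
    IsDilation I N a (fun t => T (τ t) / deriv τ t) (fun i => l (σ.symm i)) (fun t => ψ (τ t)) := by
  have hI' := isOpen_image_of_deriv_ne hI hA.1 hA.2.1
  have hm : ∀ s ∈ I, τ s ∈ τ '' I := fun s hs => Set.mem_image_of_mem τ hs
  refine ⟨(h.smooth_T.comp hA.1 hm).div (smooth_deriv hI hA.1) hA.2.1,
    h.smooth_ψ.comp hA.1 hm, fun t ht => ?_, fun t ht i => ?_⟩
  · have h0 := hA.2.1 t ht
    have hd : deriv (fun t => T (τ t) / deriv τ t) t = _ :=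
      ((hA.deriv_comp hI ht (differentiableAt_of_smooth hI' h.smooth_T (hm t ht))).div
        (differentiableAt_of_smooth hI (smooth_deriv hI hA.1) ht).hasDerivAt h0).deriv
    rw [hd, hA.logDeriv_time hI hN hN' ht, ← h.time _ (hm t ht)]
    field_simp
    ring
  · have h0 := hA.2.1 t ht
    have e := hA.logDeriv_space hI ha ha' ht (σ.symm i)
    rw [Equiv.apply_symm_apply] at e
    rw [e, ← h.space _ (hm t ht) (σ.symm i)]
    field_simp

/-- In the old coordinates the time component is divided by τ', the translation parts by k_i, and
the invariants carry the factor k_i. The inverse permutation appears because the new axis i is the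
old axis σ(i). -/
lemma IsNormalFlow.pullback (h : IsNormalFlow (τ '' I) N' a' T l m ψ E F M R)
    (hA : IsAdapted I N a N' a' τ k σ) (hI : IsOpen I) (hN : IsScaleFactorOn I N)
    (ha : ∀ i, IsScaleFactorOn I (a i)) (hN' : IsScaleFactorOn (τ '' I) N')
    (ha' : ∀ i, IsScaleFactorOn (τ '' I) (a' i)) :
    IsNormalFlow I N a (fun t => T (τ t) / deriv τ t) (fun i => l (σ.symm i))
      (fun i => m (σ.symm i) / k (σ.symm i)) (fun t => ψ (τ t))
      (fun i t => k (σ.symm i) * E (σ.symm i) (τ t)) (fun i t => F (σ.symm i) (τ t))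
      (fun t => M (τ t)) (fun t => R (τ t)) := by
  have hm : ∀ s ∈ I, τ s ∈ τ '' I := fun s hs => Set.mem_image_of_mem τ hs
  have hE := h.invariant
  have dE : ∀ i, ∀ t ∈ I, HasDerivAt (fun s => k (σ.symm i) * E (σ.symm i) (τ s))
      (k (σ.symm i) * (deriv (E (σ.symm i)) (τ t) * deriv τ t)) t := fun i t ht =>
    (hA.deriv_comp hI ht (hE.diff_E _ _ (hm t ht))).const_mul _
  have dF : ∀ i, ∀ t ∈ I, HasDerivAt (fun s => F (σ.symm i) (τ s)) _ t := fun i t ht =>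
    hA.deriv_comp hI ht (hE.diff_F _ _ (hm t ht))
  refine ⟨hA.dilation hI hN ha hN' ha' h.dilation,
    fun t ht => div_ne_zero (h.T_ne _ (hm t ht)) (hA.2.1 t ht),
    ⟨fun i t ht => (dE i t ht).differentiableAt, fun i t ht => (dF i t ht).differentiableAt,
      fun i t ht => mul_ne_zero (hA.2.2.1 _) (hE.ne_zero _ _ (hm t ht)), fun i t ht => ?_,
      fun i t ht => ?_⟩, fun t ht => h.M_ne _ (hm t ht),
    fun t ht => (hA.deriv_comp hI ht (h.diff_M _ (hm t ht))).differentiableAt,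
    fun t ht => (hA.deriv_comp hI ht (h.diff_R _ (hm t ht))).differentiableAt,
    fun t ht => ?_, fun t ht => ?_⟩
  · rw [(dE i t ht).deriv]
    have := hA.2.1 t ht
    have := hE.eq_E (σ.symm i) _ (hm t ht)
    field_simp
    linear_combination k (σ.symm i) * this
  · rw [(dF i t ht).deriv]
    have := hA.2.1 t ht
    have := hA.2.2.1 (σ.symm i)
    have := hE.eq_F (σ.symm i) _ (hm t ht)
    field_simp
    linear_combination this
  · rw [(hA.deriv_comp hI ht (h.diff_M _ (hm t ht))).deriv, ← h.eq_M _ (hm t ht)]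
    have := hA.2.1 t ht
    field_simp
  · rw [(hA.deriv_comp hI ht (h.diff_R _ (hm t ht))).deriv,
      hA.waveTime_comp hI hN ha hN' ha' h.dilation.smooth_ψ ht, ← h.eq_R _ (hm t ht)]
    have := hA.2.1 t ht
    field_simp

lemma IsNormalFlow.potentialEq_pullback_iff (h : IsNormalFlow (τ '' I) N' a' T l m ψ E F M R)
    (hA : IsAdapted I N a N' a' τ k σ) (hI : IsOpen I) (hIc : I.OrdConnected)
    (hJ : ∀ i, IsOpen (J i)) (hJc : ∀ i, (J i).OrdConnected) (hN : IsScaleFactorOn I N)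
    (ha : ∀ i, IsScaleFactorOn I (a i)) (hN' : IsScaleFactorOn (τ '' I) N')
    (ha' : ∀ i, IsScaleFactorOn (τ '' I) (a' i)) (hV : ContDiffOn ℝ ∞ V (box I J)) :
    PotentialEq N a V (fun t => T (τ t) / deriv τ t) (fun i => l (σ.symm i))
      (fun i => m (σ.symm i) / k (σ.symm i)) (fun t => ψ (τ t)) (box I J) ↔
      ∃ U : ℝ → ℝ → ℝ → ℝ, ∀ p ∈ box I J,
        M (adapt τ k σ p 0) * V p - R (adapt τ k σ p 0) =
          U (E 0 (adapt τ k σ p 0) * adapt τ k σ p 1 + F 0 (adapt τ k σ p 0))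
            (E 1 (adapt τ k σ p 0) * adapt τ k σ p 2 + F 1 (adapt τ k σ p 0))
            (E 2 (adapt τ k σ p 0) * adapt τ k σ p 3 + F 2 (adapt τ k σ p 0)) := by
  rw [(h.pullback hA hI hN ha hN' ha').potentialEq_iff hI hIc hJ hJc hV σ]
  simp only [Equiv.symm_apply_apply, adapt_zero, adapt_one, adapt_two, adapt_three]
  simp only [mul_left_comm, mul_assoc]

end pullback
end normalFlow


/-! ### Integrating the two model line elements -/

section models

variable {I : Set ℝ} {C : ℝ → ℝ} {c α₁ α₂ : ℝ}

lemma isScaleFactorOn_expFactors (hC : IsScaleFactorOn I C) (c α₁ : ℝ) (i : Fin 3) :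
    IsScaleFactorOn I (expFactors C c α₁ i) := by
  fin_cases i
  · exact ⟨hC.1.mul (by fun_prop), fun t ht => mul_ne_zero (hC.2 t ht) (Real.exp_ne_zero _)⟩
  · exact ⟨hC.1.mul (by fun_prop), fun t ht => mul_ne_zero (hC.2 t ht) (Real.exp_ne_zero _)⟩
  · exact hC

lemma isScaleFactorOn_powFactors (hC : IsScaleFactorOn I C) (hI : I ⊆ Set.Ioi 0) (α₁ α₂ : ℝ)
    (i : Fin 3) : IsScaleFactorOn I (powFactors C α₁ α₂ i) := by
  have h : ∀ r : ℝ, ContDiffOn ℝ ∞ (fun t : ℝ => t ^ r) I := fun r t ht =>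
    (Real.contDiffAt_rpow_const_of_ne (ne_of_gt (hI ht))).contDiffWithinAt
  fin_cases i
  · exact ⟨hC.1.mul (h _), fun t ht => mul_ne_zero (hC.2 t ht) (Real.rpow_pos_of_pos (hI ht) _).ne'⟩
  · exact ⟨hC.1.mul (h _), fun t ht => mul_ne_zero (hC.2 t ht) (Real.rpow_pos_of_pos (hI ht) _).ne'⟩
  · exact hC

lemma hasDerivAt_exp_div (r c t : ℝ) :
    HasDerivAt (fun t => Real.exp (-(r * t) / c)) (Real.exp (-(r * t) / c) * (-r / c)) t := by
  refine HasDerivAt.exp ?_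
  refine (((hasDerivAt_id t).const_mul r).neg.div_const c).congr_deriv (by simp)

lemma hasDerivAt_exp_div_one (c t : ℝ) :
    HasDerivAt (fun t => Real.exp (-t / c)) (Real.exp (-t / c) * (-1 / c)) t := by
  simpa using hasDerivAt_exp_div 1 c t

lemma hasDerivAt_rpow (r : ℝ) {t : ℝ} (ht : 0 < t) :
    HasDerivAt (fun t : ℝ => t ^ r) (t ^ r * (r / t)) t := by
  refine (Real.hasDerivAt_rpow_const (Or.inl ht.ne')).congr_deriv ?_
  rw [Real.rpow_sub_one ht.ne']
  ring

lemma logDeriv_mul_of_hasDerivAt {g : ℝ → ℝ} {g' t : ℝ} (hI : IsOpen I)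
    (hC : IsScaleFactorOn I C) (ht : t ∈ I) (hg : HasDerivAt g (g t * g') t) (h0 : g t ≠ 0) :
    logDeriv (fun t => C t * g t) t = logDeriv C t + g' := by
  rw [logDeriv_mul t (hC.2 t ht) h0 (hC.diff hI ht) hg.differentiableAt, logDeriv_apply g, hg.deriv]
  field_simp

lemma logDeriv_expFactors (hI : IsOpen I) (hC : IsScaleFactorOn I C) (c α₁ : ℝ) {t : ℝ}
    (ht : t ∈ I) (i : Fin 3) :
    logDeriv (expFactors C c α₁ i) t = logDeriv C t - (![1, α₁, 0] : Fin 3 → ℝ) i / c := by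
  fin_cases i
  · refine (logDeriv_mul_of_hasDerivAt hI hC ht (hasDerivAt_exp_div_one c t)
      (Real.exp_ne_zero _)).trans ?_
    simp; ring
  · refine (logDeriv_mul_of_hasDerivAt hI hC ht (hasDerivAt_exp_div α₁ c t)
      (Real.exp_ne_zero _)).trans ?_
    simp; ring
  · simp [expFactors]

lemma logDeriv_powFactors (hI : IsOpen I) (hI0 : I ⊆ Set.Ioi 0) (hC : IsScaleFactorOn I C)
    (α₁ : ℝ) (h2 : α₂ ≠ 0) {t : ℝ} (ht : t ∈ I) (i : Fin 3) :
    logDeriv (powFactors C α₁ α₂ i) t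
      = logDeriv C t + (1 - (![1, α₁, α₂] : Fin 3 → ℝ) i / α₂) / t := by
  have h0 : 0 < t := hI0 ht
  fin_cases i
  · refine (logDeriv_mul_of_hasDerivAt hI hC ht (hasDerivAt_rpow _ h0)
      (Real.rpow_pos_of_pos h0 _).ne').trans ?_
    simp; field_simp
  · refine (logDeriv_mul_of_hasDerivAt hI hC ht (hasDerivAt_rpow _ h0)
      (Real.rpow_pos_of_pos h0 _).ne').trans ?_
    simp; field_simp
  · simp [powFactors, h2]

lemma deriv_logDeriv (hI : IsOpen I) (hC : IsScaleFactorOn I C) {t : ℝ} (ht : t ∈ I) :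
    deriv (logDeriv C) t = deriv (deriv C) t / C t - logDeriv C t ^ 2 := by
  have h1 := (differentiableAt_of_smooth hI (smooth_deriv hI hC.1) ht).hasDerivAt
  have h2 := (hC.diff hI ht).hasDerivAt
  have h0 := hC.2 t ht
  have := (h1.div h2 h0).deriv
  rw [logDeriv_apply]
  refine Eq.trans this ?_
  field_simp

/-- `(c C_tt - (α₁+1) C_t) / (c C)` in terms of the logarithmic derivative of `C`. -/
noncomputable def expRest (C : ℝ → ℝ) (c α₁ t : ℝ) : ℝ :=
  deriv (logDeriv C) t + logDeriv C t ^ 2 - (α₁ + 1) / c * logDeriv C t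

/-- `potF` in terms of the logarithmic derivative of `C`. -/
noncomputable def powRest (C : ℝ → ℝ) (α₁ α₂ t : ℝ) : ℝ :=
  t ^ 2 * (deriv (logDeriv C) t + logDeriv C t ^ 2) + (2 - (α₁ + 1) / α₂) * t * logDeriv C t

lemma expRest_eq (hI : IsOpen I) (hC : IsScaleFactorOn I C) (hc : c ≠ 0) {t : ℝ} (ht : t ∈ I) :
    (c * deriv (deriv C) t - (α₁ + 1) * deriv C t) / (c * C t ^ 3)
      = expRest C c α₁ t / C t ^ 2 := by
  have h0 := hC.2 t ht
  rw [expRest, deriv_logDeriv hI hC ht, logDeriv_apply]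
  field_simp
  ring

lemma powRest_eq (hI : IsOpen I) (hC : IsScaleFactorOn I C) (h2 : α₂ ≠ 0) {t : ℝ} (ht : t ∈ I) :
    potF C α₁ α₂ t = powRest C α₁ α₂ t := by
  have h0 := hC.2 t ht
  rw [powRest, deriv_logDeriv hI hC ht, logDeriv_apply, potF]
  field_simp
  ring

lemma deriv_log_abs (hI : IsOpen I) (hC : IsScaleFactorOn I C) {t : ℝ} (ht : t ∈ I) :
    deriv (fun s => Real.log |C s|) t = logDeriv C t := by
  simp only [Real.log_abs]
  rw [((hC.diff hI ht).hasDerivAt.log (hC.2 t ht)).deriv, logDeriv_apply]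

/-- As ψ = c(ln|C|)' and T = c, the integrating factor is C², and `expRest` is the primitive of
−C²Δψ/c. For α₁ = 0 only β = 0 is allowed: then β/α₁ = 0 by convention, as it should be, while for β
≠ 0 the invariant would be linear in t. -/
lemma isNormalFlow_exp (hI : IsOpen I) (hC : IsScaleFactorOn I C) (hc : c ≠ 0) (α β γ : ℝ)
    (h1 : α₁ ≠ 0 ∨ β = 0) :
    IsNormalFlow I C (expFactors C c α₁) (fun _ => c) ![1, α₁, 0] ![α, β, γ]
      (fun t => c * logDeriv C t)
      ![fun t => Real.exp (-t / c), fun t => Real.exp (-(α₁ * t) / c), fun _ => 1]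
      ![fun t => α * Real.exp (-t / c), fun t => β / α₁ * Real.exp (-(α₁ * t) / c),
        fun t => -(γ / c * t)]
      (fun t => C t ^ 2) (expRest C c α₁) := by
  have dL : ∀ t ∈ I, HasDerivAt (logDeriv C) (deriv (logDeriv C) t) t := fun t ht =>
    (differentiableAt_of_smooth hI (smooth_logDeriv hI hC) ht).hasDerivAt
  have dL' : ∀ t ∈ I, HasDerivAt (deriv (logDeriv C)) (deriv (deriv (logDeriv C)) t) t :=
    fun t ht => (differentiableAt_of_smooth hI
      (smooth_deriv hI (smooth_logDeriv hI hC)) ht).hasDerivAt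
  have dC : ∀ t ∈ I, HasDerivAt C (deriv C t) t := fun t ht => (hC.diff hI ht).hasDerivAt
  have dM : ∀ t ∈ I, HasDerivAt (fun t => C t ^ 2) (2 * C t * deriv C t) t := fun t ht =>
    ((dC t ht).pow 2).congr_deriv (by simp)
  have dR : ∀ t ∈ I, HasDerivAt (expRest C c α₁) (deriv (deriv (logDeriv C)) t
      + 2 * logDeriv C t * deriv (logDeriv C) t - (α₁ + 1) / c * deriv (logDeriv C) t) t :=
    fun t ht => (((dL' t ht).add ((dL t ht).pow 2)).sub
      ((dL t ht).const_mul ((α₁ + 1) / c))).congr_deriv (by simp)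
  have d0 := fun t : ℝ => hasDerivAt_exp_div_one c t
  have d1 := fun t : ℝ => hasDerivAt_exp_div α₁ c t
  have d2 : ∀ t : ℝ, HasDerivAt (fun t => -(γ / c * t)) (-(γ / c)) t := fun t =>
    (((hasDerivAt_id t).const_mul (γ / c)).neg).congr_deriv (by simp)
  have d0' := fun t : ℝ => (d0 t).const_mul α
  have d1' := fun t : ℝ => (d1 t).const_mul (β / α₁)
  refine ⟨⟨contDiffOn_const, contDiffOn_const.mul (smooth_logDeriv hI hC), fun t ht => ?_,
    fun t ht i => ?_⟩, fun _ _ => hc, ⟨fun i t ht => ?_, fun i t ht => ?_, fun i t ht => ?_,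
      fun i t ht => ?_, fun i t ht => ?_⟩, fun t ht => pow_ne_zero 2 (hC.2 t ht),
    fun t ht => (dM t ht).differentiableAt, fun t ht => (dR t ht).differentiableAt,
    fun t ht => ?_, fun t ht => ?_⟩
  · simp [mul_comm]
  · rw [logDeriv_expFactors hI hC c α₁ ht]
    field_simp
    ring
  · fin_cases i
    · exact (d0 t).differentiableAt
    · exact (d1 t).differentiableAt
    · exact differentiableAt_const _
  · fin_cases i
    · exact (d0' t).differentiableAt
    · exact (d1' t).differentiableAt
    · exact (d2 t).differentiableAt
  · fin_cases i
    · exact Real.exp_ne_zero _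
    · exact Real.exp_ne_zero _
    · exact one_ne_zero
  · fin_cases i
    · simp [(d0 t).deriv]; field_simp; ring
    · simp [(d1 t).deriv]; field_simp; ring
    · simp
  · fin_cases i
    · simp [(d0 t).deriv]; field_simp; ring
    · rcases h1 with h1 | rfl
      · simp [(d1 t).deriv]; field_simp; ring
      · simp
    · simp [(d2 t).deriv]; field_simp; ring
  · have := hC.2 t ht
    rw [(dM t ht).deriv, logDeriv_apply]
    field_simp
  · have e1 : (deriv fun t => c * logDeriv C t) = fun t => c * deriv (logDeriv C) t := by
      funext t; exact deriv_const_mul_field c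
    have e2 : (deriv fun t => c * deriv (logDeriv C) t) t = c * deriv (deriv (logDeriv C)) t :=
      deriv_const_mul_field c
    have := hC.2 t ht
    simp only [waveTime, e1, e2, (dR t ht).deriv, logDeriv_expFactors hI hC c α₁ ht]
    simp
    field_simp
    ring

/-- The coordinates scale as t^{l_i/α₂} along the flow, whence the powers. The integrating factor is
(tC)² because ψ/T = (ln|tC|)'. -/
lemma isNormalFlow_pow (hI : IsOpen I) (hI0 : I ⊆ Set.Ioi 0) (hC : IsScaleFactorOn I C)
    (h2 : α₂ ≠ 0) (α β γ : ℝ) (h1 : α₁ ≠ 0 ∨ β = 0) :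
    IsNormalFlow I C (powFactors C α₁ α₂) (fun t => α₂ * t) ![1, α₁, α₂] ![α, β, γ]
      (fun t => α₂ * (1 + t * logDeriv C t))
      ![fun t => t ^ (-1 / α₂), fun t => t ^ (-α₁ / α₂), fun t => t⁻¹]
      ![fun t => α * t ^ (-1 / α₂), fun t => β / α₁ * t ^ (-α₁ / α₂), fun t => γ / α₂ * t⁻¹]
      (fun t => t ^ 2 * C t ^ 2) (powRest C α₁ α₂) := by
  have dL : ∀ t ∈ I, HasDerivAt (logDeriv C) (deriv (logDeriv C) t) t := fun t ht =>
    (differentiableAt_of_smooth hI (smooth_logDeriv hI hC) ht).hasDerivAt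
  have dL' : ∀ t ∈ I, HasDerivAt (deriv (logDeriv C)) (deriv (deriv (logDeriv C)) t) t :=
    fun t ht => (differentiableAt_of_smooth hI
      (smooth_deriv hI (smooth_logDeriv hI hC)) ht).hasDerivAt
  have dC : ∀ t ∈ I, HasDerivAt C (deriv C t) t := fun t ht => (hC.diff hI ht).hasDerivAt
  have did := fun t : ℝ => hasDerivAt_id' t
  have dsq : ∀ t : ℝ, HasDerivAt (fun t : ℝ => t ^ 2) (2 * t) t := fun t =>
    ((did t).pow 2).congr_deriv (by simp)
  have dM : ∀ t ∈ I, HasDerivAt (fun t => t ^ 2 * C t ^ 2)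
      (2 * t * C t ^ 2 + t ^ 2 * (2 * C t * deriv C t)) t := fun t ht =>
    ((dsq t).mul ((dC t ht).pow 2)).congr_deriv (by simp)
  have dR : ∀ t ∈ I, HasDerivAt (powRest C α₁ α₂) (2 * t * (deriv (logDeriv C) t + logDeriv C t ^ 2)
      + t ^ 2 * (deriv (deriv (logDeriv C)) t + 2 * logDeriv C t * deriv (logDeriv C) t)
      + ((2 - (α₁ + 1) / α₂) * logDeriv C t
        + (2 - (α₁ + 1) / α₂) * t * deriv (logDeriv C) t)) t := fun t ht =>
    (((dsq t).mul ((dL' t ht).add ((dL t ht).pow 2))).add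
      (((did t).const_mul (2 - (α₁ + 1) / α₂)).mul (dL t ht))).congr_deriv (by simp)
  have dψ : ∀ t ∈ I, HasDerivAt (fun t => α₂ * (1 + t * logDeriv C t))
      (α₂ * (logDeriv C t + t * deriv (logDeriv C) t)) t := fun t ht =>
    ((((did t).mul (dL t ht)).const_add 1).const_mul α₂).congr_deriv (by simp)
  have dψ' : ∀ t ∈ I, HasDerivAt (fun t => α₂ * (logDeriv C t + t * deriv (logDeriv C) t))
      (α₂ * (2 * deriv (logDeriv C) t + t * deriv (deriv (logDeriv C)) t)) t := fun t ht =>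
    (((dL t ht).add ((did t).mul (dL' t ht))).const_mul α₂).congr_deriv (by ring)
  have d0 := fun t (ht : t ∈ I) => hasDerivAt_rpow (-1 / α₂) (hI0 ht)
  have d1 := fun t (ht : t ∈ I) => hasDerivAt_rpow (-α₁ / α₂) (hI0 ht)
  have d2 : ∀ t ∈ I, HasDerivAt (fun t : ℝ => t⁻¹) (-(t ^ 2)⁻¹) t := fun t ht =>
    hasDerivAt_inv (ne_of_gt (hI0 ht))
  have d0' := fun t ht => (d0 t ht).const_mul α
  have d1' := fun t ht => (d1 t ht).const_mul (β / α₁)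
  have d2' := fun t ht => (d2 t ht).const_mul (γ / α₂)
  have ht0 : ∀ t ∈ I, t ≠ 0 := fun t ht => ne_of_gt (hI0 ht)
  refine ⟨⟨contDiffOn_const.mul contDiffOn_id, contDiffOn_const.mul (contDiffOn_const.add
    (contDiffOn_id.mul (smooth_logDeriv hI hC))), fun t ht => ?_,
    fun t ht i => ?_⟩, fun t ht => mul_ne_zero h2 (ht0 t ht), ⟨fun i t ht => ?_, fun i t ht => ?_,
      fun i t ht => ?_, fun i t ht => ?_, fun i t ht => ?_⟩,
    fun t ht => mul_ne_zero (pow_ne_zero 2 (ht0 t ht)) (pow_ne_zero 2 (hC.2 t ht)),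
    fun t ht => (dM t ht).differentiableAt, fun t ht => (dR t ht).differentiableAt,
    fun t ht => ?_, fun t ht => ?_⟩
  · rw [((did t).const_mul α₂).deriv]
    ring
  · have := ht0 t ht
    rw [logDeriv_powFactors hI hI0 hC α₁ h2 ht]
    field_simp
    ring
  · fin_cases i
    · exact (d0 t ht).differentiableAt
    · exact (d1 t ht).differentiableAt
    · exact (d2 t ht).differentiableAt
  · fin_cases i
    · exact (d0' t ht).differentiableAt
    · exact (d1' t ht).differentiableAt
    · exact (d2' t ht).differentiableAt
  · fin_cases i
    · exact (Real.rpow_pos_of_pos (hI0 ht) _).ne'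
    · exact (Real.rpow_pos_of_pos (hI0 ht) _).ne'
    · exact inv_ne_zero (ht0 t ht)
  · have := ht0 t ht
    fin_cases i
    · simp [(d0 t ht).deriv]; field_simp; ring
    · simp [(d1 t ht).deriv]; field_simp; ring
    · simp; field_simp; ring
  · have := ht0 t ht
    fin_cases i
    · simp [(d0 t ht).deriv]; field_simp; ring
    · rcases h1 with h1 | rfl
      · simp [(d1 t ht).deriv]; field_simp; ring
      · simp
    · simp; field_simp; ring
  · have := hC.2 t ht
    rw [(dM t ht).deriv, logDeriv_apply]
    field_simp
  · have e1 : (deriv fun t => α₂ * (1 + t * logDeriv C t)) =ᶠ[nhds t]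
        fun t => α₂ * (logDeriv C t + t * deriv (logDeriv C) t) := by
      filter_upwards [hI.mem_nhds ht] with s hs using (dψ s hs).deriv
    have := hC.2 t ht
    have := ht0 t ht
    simp only [waveTime, e1.deriv_eq, (dψ t ht).deriv, (dψ' t ht).deriv, (dR t ht).deriv,
      logDeriv_powFactors hI hI0 hC α₁ h2 ht]
    simp
    field_simp
    ring

end models


/-! ### Rescaling of fields, and the exponential model -/

section models

variable {I : Set ℝ} {J : Fin 3 → Set ℝ} {N : ℝ → ℝ} {a : Fin 3 → ℝ → ℝ} {V : Pt 4 → ℝ}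

lemma IsDilation.isCKVOn {T ψ : ℝ → ℝ} {l : Fin 3 → ℝ} (h : IsDilation I N a T l ψ)
    (hI : IsOpen I) (hN : IsScaleFactorOn I N) (ha : ∀ i, IsScaleFactorOn I (a i))
    {ξ : Pt 4 → Pt 4} {Ψ : Pt 4 → ℝ} {m : Fin 3 → ℝ} (hξ : ξ = affField T l m)
    (hΨ : ∀ p ∈ box I J, Ψ p = ψ (p 0)) : IsCKVOn (bianchiI N a) (box I J) ξ Ψ := by
  subst hξ
  intro x hx μ ν
  have hD : ∀ κ ρ : Fin 4, pd ρ (fun y => affField T l m y κ) x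
      = if ρ = κ then ψ (x 0) - hubble N a κ (x 0) * T (x 0) else 0 := by
    intro κ ρ
    refine Fin.cases ?_ (fun i => ?_) κ
    · rw [pd_affField_zero hI h.smooth_T l m hx.1, ← h.time _ hx.1]
      simp
    · rw [pd_affField_succ, ← h.space _ hx.1 i]
      simp
  simp only [hD, pd_bianchiI hI hN ha hx.1, hΨ x hx]
  simp only [bianchiI_eq, Matrix.diagonal_apply, Finset.sum_add_distrib]
  by_cases hμν : μ = ν
  · subst hμν
    simp
    ring
  · simp [hμν]

/-- The equation is linear in (T, l, m, ψ), and proportionality of the factors follows from the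
conformal equations. This permits normalising one weight to 1. -/
lemma PotentialEq.of_smul {T ψ T' ψ' : ℝ → ℝ} {l m l' m' : Fin 3 → ℝ} {s : ℝ} (hI : IsOpen I)
    (hK : IsDilation I N a T l ψ) (hK' : IsDilation I N a T' l' ψ')
    (hT : ∀ t ∈ I, T' t = s * T t) (hl : ∀ i, l' i = s * l i) (hm : ∀ i, m' i = s * m i)
    (h : PotentialEq N a V T l m ψ (box I J)) : PotentialEq N a V T' l' m' ψ' (box I J) := by
  have hψ : ∀ t ∈ I, ψ' t = s * ψ t := fun t ht => by
    rw [← hK'.space t ht 0, ← hK.space t ht 0, hT t ht, hl]; ring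
  have hψ1 : ∀ t ∈ I, deriv ψ' t = s * deriv ψ t := fun t ht => by
    have e : ψ' =ᶠ[nhds t] fun r => s * ψ r := by
      filter_upwards [hI.mem_nhds ht] with r hr using hψ r hr
    rw [e.deriv_eq, deriv_const_mul_field]
  have hψ2 : ∀ t ∈ I, deriv (deriv ψ') t = s * deriv (deriv ψ) t := fun t ht => by
    have e : deriv ψ' =ᶠ[nhds t] fun r => s * deriv ψ r := by
      filter_upwards [hI.mem_nhds ht] with r hr using hψ1 r hr
    rw [e.deriv_eq, deriv_const_mul_field]
  intro x hx
  have e : affField T' l' m' x = s • affField T l m x := by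
    ext μ
    refine Fin.cases (by simp [hT _ hx.1]) (fun i => ?_) μ
    simp [hl, hm]; ring
  have := h x hx
  unfold waveTime at this ⊢
  rw [e, map_smul, hψ _ hx.1, hψ1 _ hx.1, hψ2 _ hx.1, smul_eq_mul]
  linear_combination s * this

lemma isTranslationForm_of_potentialEq {T ψ : ℝ → ℝ} {l m : Fin 3 → ℝ} (hI : IsOpen I)
    (hIc : I.OrdConnected) (hJ : ∀ i, IsOpen (J i)) (hJc : ∀ i, (J i).OrdConnected)
    (hV : ContDiffOn ℝ ∞ V (box I J)) (hK : IsDilation I N a T l ψ)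
    (h : PotentialEq N a V T l m ψ (box I J)) (hne : ¬ ((∀ t ∈ I, T t = 0) ∧ l = 0 ∧ m = 0))
    (hT : ∀ t ∈ I, T t = 0) (hl : l = 0) : IsTranslationForm V (box I J) := by
  rw [isTranslationForm_iff (N := N) (a := a) hI hIc hJ hJc hV]
  exact ⟨m, fun hm => hne ⟨hT, hl, hm⟩, PotentialEq.of_smul (s := 1) hI hK isDilation_zero
    (fun t ht => by simp [hT t ht]) (by simp [hl]) (by simp) h⟩

lemma admitsIff_of {g : MetricField 4} {Ω : Set (Pt 4)} {P : Prop} (h1 : AdmitsLie g V Ω → P)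
    (h2 : P → AdmitsNoether g V Ω) : AdmitsIff g V Ω P := by
  have h3 : AdmitsNoether g V Ω → AdmitsLie g V Ω := fun ⟨X, hX, hn⟩ => ⟨X, hX.1, hn⟩
  exact ⟨⟨h1, fun h => h3 (h2 h)⟩, ⟨fun h => h1 (h3 h), h2⟩⟩

lemma exists_mem_box (hIne : I.Nonempty) (hJne : ∀ i, (J i).Nonempty) : (box I J).Nonempty := by
  obtain ⟨t, ht⟩ := hIne
  choose y hy using hJne
  exact ⟨Fin.cons t y, ht, hy⟩

lemma exists_forall_eq_congr {Ω : Set (Pt 4)} {P Q : (ℝ → ℝ → ℝ → ℝ) → Pt 4 → Prop}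
    (h : ∀ p ∈ Ω, ∀ U, P U p ↔ Q U p) :
    (∃ U, ∀ p ∈ Ω, P U p) ↔ ∃ U, ∀ p ∈ Ω, Q U p :=
  exists_congr fun U => forall₂_congr fun p hp => h p hp U

section expModel

variable {C : ℝ → ℝ} {c α₁ : ℝ}

lemma potVI_iff (hI : IsOpen I) (hC : IsScaleFactorOn I C) (hc : c ≠ 0) (α β γ : ℝ) {q : Pt 4}
    (hq : q 0 ∈ I) (v : ℝ) (U : ℝ → ℝ → ℝ → ℝ) :
    C (q 0) ^ 2 * v - expRest C c α₁ (q 0) =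
        U (Real.exp (-(q 0) / c) * q 1 + α * Real.exp (-(q 0) / c))
          (Real.exp (-(α₁ * q 0) / c) * q 2 + β / α₁ * Real.exp (-(α₁ * q 0) / c))
          (1 * q 3 + -(γ / c * q 0)) ↔ v = potVI C c α₁ α β γ U q := by
  have h0 := hC.2 _ hq
  rw [potVI, expRest_eq hI hC hc hq]
  have e0 : Real.exp (-(q 0) / c) * q 1 + α * Real.exp (-(q 0) / c)
    = (q 1 + α) * Real.exp (-(q 0) / c) := by ring
  have e1 : Real.exp (-(α₁ * q 0) / c) * q 2 + β / α₁ * Real.exp (-(α₁ * q 0) / c)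
    = (q 2 + β / α₁) * Real.exp (-(α₁ * q 0) / c) := by ring
  have e2 : 1 * q 3 + -(γ / c * q 0) = q 3 - γ / c * q 0 := by ring
  rw [e0, e1, e2]
  generalize U _ _ _ = w
  constructor
  · intro h; field_simp; linear_combination h
  · intro h; rw [h]; field_simp; ring

/-- Valid for α₁ = 0 as well, since 0/α₁ = 0 in every case. -/
lemma potV_eq (U : ℝ → ℝ → ℝ → ℝ) (p : Pt 4) : potV C c α₁ U p = potVI C c α₁ 0 0 0 U p := by
  simp [potV, potVI]

lemma potentialEq_exp_iff (hI : IsOpen I) (hIc : I.OrdConnected) (hJ : ∀ i, IsOpen (J i))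
    (hJc : ∀ i, (J i).OrdConnected) (hV : ContDiffOn ℝ ∞ V (box I J)) (hC : IsScaleFactorOn I C)
    (hc : c ≠ 0) (α β γ : ℝ) (h1 : α₁ ≠ 0 ∨ β = 0) :
    PotentialEq C (expFactors C c α₁) V (fun _ => c) ![1, α₁, 0] ![α, β, γ]
        (fun t => c * logDeriv C t) (box I J) ↔
      ∃ U : ℝ → ℝ → ℝ → ℝ, ∀ p ∈ box I J, V p = potVI C c α₁ α β γ U p := by
  rw [(isNormalFlow_exp hI hC hc α β γ h1).potentialEq_iff hI hIc hJ hJc hV 1]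
  exact exists_forall_eq_congr fun p hp U => potVI_iff hI hC hc α β γ hp.1 (V p) U

lemma X₁_add_transl (c α₁ α β γ : ℝ) :
    X₁ c α₁ + transl α β γ = affField (fun _ => c) ![1, α₁, 0] ![α, β, γ] := by
  ext p μ
  refine Fin.cases (by simp [X₁, transl]) (fun i => ?_) μ
  rw [affField_succ]
  fin_cases i <;> simp [X₁, transl]

lemma symmetryIff_exp (hI : IsOpen I) (hIc : I.OrdConnected) (hJ : ∀ i, IsOpen (J i))
    (hJc : ∀ i, (J i).OrdConnected) (hV : ContDiffOn ℝ ∞ V (box I J)) (hC : IsScaleFactorOn I C)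
    (hc : c ≠ 0) (α β γ : ℝ) (h1 : α₁ ≠ 0 ∨ β = 0) :
    SymmetryIff (bianchiI C (expFactors C c α₁)) V (box I J)
      (conformalLift (X₁ c α₁ + transl α β γ) (ψ₁ C c))
      (∃ U : ℝ → ℝ → ℝ → ℝ, ∀ p ∈ box I J, V p = potVI C c α₁ α β γ U p) :=
  symmetryIff_dilation hI hJ hC (isScaleFactorOn_expFactors hC c α₁) hV
    (isNormalFlow_exp hI hC hc α β γ h1).dilation
    (fun p _ => congrFun (X₁_add_transl c α₁ α β γ) p)
    (fun p hp => by rw [ψ₁, deriv_log_abs hI hC hp.1])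
    (potentialEq_exp_iff hI hIc hJ hJc hV hC hc α β γ h1)

lemma transl_zero : transl 0 0 0 = 0 := by
  ext p μ
  fin_cases μ <;> rfl

lemma isCKVOn_exp (hI : IsOpen I) (hC : IsScaleFactorOn I C) (hc : c ≠ 0) :
    IsCKVOn (bianchiI C (expFactors C c α₁)) (box I J) (X₁ c α₁) (ψ₁ C c) :=
  (isNormalFlow_exp hI hC hc 0 0 0 (Or.inr rfl)).dilation.isCKVOn hI hC
    (isScaleFactorOn_expFactors hC c α₁)
    (by rw [← X₁_add_transl c α₁ 0 0 0, transl_zero, add_zero])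
    (fun p hp => by rw [ψ₁, deriv_log_abs hI hC hp.1])

lemma relHubble_exp (hI : IsOpen I) (hC : IsScaleFactorOn I C) (c α₁ : ℝ) {t : ℝ} (ht : t ∈ I)
    (i : Fin 3) : relHubble C (expFactors C c α₁) i t = -((![1, α₁, 0] : Fin 3 → ℝ) i / c) := by
  rw [relHubble, logDeriv_expFactors hI hC c α₁ ht]
  ring

lemma not_isLRSOn_of_relHubble {t₀ : ℝ} (hI : IsOpen I) (ht₀ : t₀ ∈ I)
    (ha : ∀ i, IsScaleFactorOn I (a i))
    (h : ∀ i j, i ≠ j → relHubble N a i t₀ ≠ relHubble N a j t₀) : ¬ IsLRSOn I a := by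
  rintro ⟨i, j, hij, k, hk⟩
  refine h i j hij ?_
  have e : a i =ᶠ[nhds t₀] fun t => k * a j t := by
    filter_upwards [hI.mem_nhds ht₀] with t ht using hk t ht
  have hk0 : k ≠ 0 := fun h0 => (ha i).2 _ ht₀ (by rw [hk _ ht₀, h0, zero_mul])
  simp only [relHubble, logDeriv_apply]
  rw [e.deriv_eq, e.eq_of_nhds, deriv_const_mul_field, mul_div_mul_left _ _ hk0]

/-- The relative Hubble rates −1/c, −α₁/c, 0 are constant and distinct, and two gaps are nonzero, so
the conformal fields are dilations and translations. Their equations then leave only multiples of X₁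
plus a translation. -/
lemma admitsIff_exp (hI : IsOpen I) (hIc : I.OrdConnected) (hIne : I.Nonempty)
    (hJ : ∀ i, IsOpen (J i)) (hJc : ∀ i, (J i).OrdConnected) (hJne : ∀ i, (J i).Nonempty)
    (hV : ContDiffOn ℝ ∞ V (box I J)) (hC : IsScaleFactorOn I C)
    (hc : c ≠ 0) (h0 : α₁ ≠ 0) (h1 : α₁ ≠ 1) :
    AdmitsIff (bianchiI C (expFactors C c α₁)) V (box I J) (IsTranslationForm V (box I J) ∨
      ∃ (α β γ : ℝ) (U : ℝ → ℝ → ℝ → ℝ), ∀ p ∈ box I J, V p = potVI C c α₁ α β γ U p) := by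
  have ha := isScaleFactorOn_expFactors hC c α₁
  have hF := fun α β γ => isNormalFlow_exp hI hC hc α β γ (Or.inl h0)
  refine admitsIff_of (fun h => ?_) ?_
  · obtain ⟨t₀, ht₀⟩ := hIne
    have hr : ∀ i, ∀ t ∈ I, relHubble C (expFactors C c α₁) i t
        = -((![1, α₁, 0] : Fin 3 → ℝ) i / c) := fun i t ht => relHubble_exp hI hC c α₁ ht i
    have hr' : ∀ i, deriv (relHubble C (expFactors C c α₁) i) t₀ = 0 := fun i => by
      have e : relHubble C (expFactors C c α₁) i =ᶠ[nhds t₀]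
          fun _ => -((![1, α₁, 0] : Fin 3 → ℝ) i / c) := by
        filter_upwards [hI.mem_nhds ht₀] with t ht using hr i t ht
      rw [e.deriv_eq, deriv_const]
    have h1' : 1 - α₁ ≠ 0 := sub_ne_zero.2 h1.symm
    have hL : ¬ IsLRSOn I (expFactors C c α₁) := by
      refine not_isLRSOn_of_relHubble (N := C) hI ht₀ ha fun i j hij => ?_
      rw [hr i _ ht₀, hr j _ ht₀]
      intro he
      field_simp at he
      fin_cases i <;> fin_cases j <;> simp_all [eq_comm]
    obtain ⟨T, l, m, ψ, hK, hP, hne⟩ := exists_dilation_of_admitsLie hI hIc ⟨t₀, ht₀⟩ hJ hJc hJne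
      -- The two gaps are −α₁(1 − α₁)/c² and (1 − α₁)/c².
      hC ha hL ⟨t₀, ht₀, 0, 1, 2, by decide, by decide, by decide, by
        simp only [weylGap, hr _ _ ht₀, hr']
        have : α₁ * (1 - α₁) / c ^ 2 ≠ 0 := div_ne_zero (mul_ne_zero h0 h1') (pow_ne_zero 2 hc)
        intro he
        apply this
        simp at he
        field_simp at he ⊢
        linear_combination -he, by
        simp only [weylGap, hr _ _ ht₀, hr']
        have : (1 - α₁) / c ^ 2 ≠ 0 := div_ne_zero h1' (pow_ne_zero 2 hc)
        intro he
        apply this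
        simp at he
        field_simp at he ⊢
        linear_combination he⟩ hV h
    have hs : ∀ t ∈ I, ∀ i, l i + (logDeriv C t - (![1, α₁, 0] : Fin 3 → ℝ) i / c) * T t
        = l 2 + (logDeriv C t - (![1, α₁, 0] : Fin 3 → ℝ) 2 / c) * T t := fun t ht i => by
      rw [← logDeriv_expFactors hI hC c α₁ ht, ← logDeriv_expFactors hI hC c α₁ ht,
        hK.space t ht, hK.space t ht]
    -- The difference of the x and z equations determines T. The time equation compared with that of
    -- z, whose scale factor equals the lapse, then gives l_2 = T' = 0.
    have hT : ∀ t ∈ I, T t = c * (l 0 - l 2) := fun t ht => by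
      have := hs t ht 0
      simp at this
      field_simp at this
      linear_combination -this
    have hT' : deriv T t₀ = 0 := by
      have e : T =ᶠ[nhds t₀] fun _ => c * (l 0 - l 2) := by
        filter_upwards [hI.mem_nhds ht₀] with t ht using hT t ht
      rw [e.deriv_eq, deriv_const]
    have hl2 : l 2 = 0 := by
      have e1 := hK.time t₀ ht₀
      have e2 := hK.space t₀ ht₀ 2
      rw [logDeriv_expFactors hI hC c α₁ ht₀] at e2
      simp at e2
      linear_combination e2 - e1 + hT'
    have hl1 : l 1 = α₁ * l 0 := by
      have := hs t₀ ht₀ 1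
      rw [hT t₀ ht₀, hl2] at this
      simp at this
      field_simp at this
      linear_combination this
    by_cases hl0 : l 0 = 0
    · left
      refine isTranslationForm_of_potentialEq hI hIc hJ hJc hV hK hP hne
        (fun t ht => by rw [hT t ht, hl0, hl2]; ring) ?_
      ext i
      fin_cases i <;> simp [hl0, hl1, hl2]
    · right
      -- Division by l_0 normalises the dilation part to X₁.
      refine ⟨m 0 / l 0, m 1 / l 0, m 2 / l 0, ?_⟩
      rw [← potentialEq_exp_iff hI hIc hJ hJc hV hC hc _ _ _ (Or.inl h0)]
      refine PotentialEq.of_smul (s := (l 0)⁻¹) hI hK (hF 0 0 0).dilation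
        (fun t ht => ?_) (fun i => ?_) (fun i => ?_) hP
      · rw [hT t ht, hl2]; field_simp; ring
      · fin_cases i <;> simp [hl1, hl2] <;> field_simp
      · fin_cases i <;> simp <;> ring
  · rintro (h | ⟨α, β, γ, h⟩)
    · exact admitsNoether_of_translationForm hI hIc hIne hJ hJc hJne hC ha hV h
    · rw [← potentialEq_exp_iff hI hIc hJ hJc hV hC hc _ _ _ (Or.inl h0)] at h
      obtain ⟨p, hp⟩ := exists_mem_box hIne hJne
      exact admitsNoether_of_potentialEq hI hJ hC ha hV (hF 0 0 0).dilation h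
        ⟨p, hp, fun h => hc (congrFun h 0)⟩

end expModel
end models


/-! ### The power-law model -/

section powModel

variable {I : Set ℝ} {J : Fin 3 → Set ℝ} {N : ℝ → ℝ} {a : Fin 3 → ℝ → ℝ} {V : Pt 4 → ℝ}
  {C : ℝ → ℝ} {α₁ α₂ : ℝ}

lemma potVIII_iff (hI : IsOpen I) (hI0 : I ⊆ Set.Ioi 0) (hC : IsScaleFactorOn I C) (h2 : α₂ ≠ 0)
    (α β γ : ℝ) {q : Pt 4} (hq : q 0 ∈ I) (v : ℝ) (U : ℝ → ℝ → ℝ → ℝ) :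
    q 0 ^ 2 * C (q 0) ^ 2 * v - powRest C α₁ α₂ (q 0) =
        U (q 0 ^ (-1 / α₂) * q 1 + α * q 0 ^ (-1 / α₂))
          (q 0 ^ (-α₁ / α₂) * q 2 + β / α₁ * q 0 ^ (-α₁ / α₂))
          ((q 0)⁻¹ * q 3 + γ / α₂ * (q 0)⁻¹) ↔ v = potVIII C α₁ α₂ α β γ U q := by
  have h0 := hC.2 _ hq
  have ht : q 0 ≠ 0 := ne_of_gt (hI0 hq)
  rw [potVIII, powRest_eq hI hC h2 hq]
  have e0 : q 0 ^ (-1 / α₂) * q 1 + α * q 0 ^ (-1 / α₂) = (q 1 + α) * q 0 ^ (-1 / α₂) := by ring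
  have e1 : q 0 ^ (-α₁ / α₂) * q 2 + β / α₁ * q 0 ^ (-α₁ / α₂)
    = (q 2 + β / α₁) * q 0 ^ (-α₁ / α₂) := by ring
  have e2 : (q 0)⁻¹ * q 3 + γ / α₂ * (q 0)⁻¹ = (q 3 + γ / α₂) / q 0 := by ring
  rw [e0, e1, e2]
  generalize U _ _ _ = w
  constructor
  · intro h; field_simp; linear_combination h
  · intro h; rw [h]; field_simp; ring

lemma potVII_eq (U : ℝ → ℝ → ℝ → ℝ) (p : Pt 4) :
    potVII C α₁ α₂ U p = potVIII C α₁ α₂ 0 0 0 U p := by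
  simp [potVII, potVIII]

lemma potentialEq_pow_iff (hI : IsOpen I) (hI0 : I ⊆ Set.Ioi 0) (hIc : I.OrdConnected)
    (hJ : ∀ i, IsOpen (J i)) (hJc : ∀ i, (J i).OrdConnected) (hV : ContDiffOn ℝ ∞ V (box I J))
    (hC : IsScaleFactorOn I C) (h2 : α₂ ≠ 0) (α β γ : ℝ) (h1 : α₁ ≠ 0 ∨ β = 0) :
    PotentialEq C (powFactors C α₁ α₂) V (fun t => α₂ * t) ![1, α₁, α₂] ![α, β, γ]
        (fun t => α₂ * (1 + t * logDeriv C t)) (box I J) ↔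
      ∃ U : ℝ → ℝ → ℝ → ℝ, ∀ p ∈ box I J, V p = potVIII C α₁ α₂ α β γ U p := by
  rw [(isNormalFlow_pow hI hI0 hC h2 α β γ h1).potentialEq_iff hI hIc hJ hJc hV 1]
  exact exists_forall_eq_congr fun p hp U => potVIII_iff hI hI0 hC h2 α β γ hp.1 (V p) U

lemma X₂_add_transl (α₁ α₂ α β γ : ℝ) :
    X₂ α₁ α₂ + transl α β γ = affField (fun t => α₂ * t) ![1, α₁, α₂] ![α, β, γ] := by
  ext p μ
  refine Fin.cases (by simp [X₂, transl]) (fun i => ?_) μ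
  rw [affField_succ]
  fin_cases i <;> simp [X₂, transl]

lemma symmetryIff_pow (hI : IsOpen I) (hI0 : I ⊆ Set.Ioi 0) (hIc : I.OrdConnected)
    (hJ : ∀ i, IsOpen (J i)) (hJc : ∀ i, (J i).OrdConnected) (hV : ContDiffOn ℝ ∞ V (box I J))
    (hC : IsScaleFactorOn I C) (h2 : α₂ ≠ 0) (α β γ : ℝ) (h1 : α₁ ≠ 0 ∨ β = 0) :
    SymmetryIff (bianchiI C (powFactors C α₁ α₂)) V (box I J)
      (conformalLift (X₂ α₁ α₂ + transl α β γ) (ψ₂ C α₂))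
      (∃ U : ℝ → ℝ → ℝ → ℝ, ∀ p ∈ box I J, V p = potVIII C α₁ α₂ α β γ U p) :=
  symmetryIff_dilation hI hJ hC (isScaleFactorOn_powFactors hC hI0 α₁ α₂) hV
    (isNormalFlow_pow hI hI0 hC h2 α β γ h1).dilation
    (fun p _ => congrFun (X₂_add_transl α₁ α₂ α β γ) p)
    (fun p hp => by rw [ψ₂, deriv_log_abs hI hC hp.1])
    (potentialEq_pow_iff hI hI0 hIc hJ hJc hV hC h2 α β γ h1)

lemma isCKVOn_pow (hI : IsOpen I) (hI0 : I ⊆ Set.Ioi 0) (hC : IsScaleFactorOn I C) (h2 : α₂ ≠ 0) :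
    IsCKVOn (bianchiI C (powFactors C α₁ α₂)) (box I J) (X₂ α₁ α₂) (ψ₂ C α₂) :=
  (isNormalFlow_pow hI hI0 hC h2 0 0 0 (Or.inr rfl)).dilation.isCKVOn hI hC
    (isScaleFactorOn_powFactors hC hI0 α₁ α₂)
    (by rw [← X₂_add_transl α₁ α₂ 0 0 0, transl_zero, add_zero])
    (fun p hp => by rw [ψ₂, deriv_log_abs hI hC hp.1])

lemma relHubble_pow (hI : IsOpen I) (hI0 : I ⊆ Set.Ioi 0) (hC : IsScaleFactorOn I C) (α₁ : ℝ)
    (h2 : α₂ ≠ 0) {t : ℝ} (ht : t ∈ I) (i : Fin 3) :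
    relHubble C (powFactors C α₁ α₂) i t = (1 - (![1, α₁, α₂] : Fin 3 → ℝ) i / α₂) * t⁻¹ := by
  rw [relHubble, logDeriv_powFactors hI hI0 hC α₁ h2 ht]
  ring

/-- A single gap may vanish for special parameters, so the two good axes cannot be named in advance;
but the gaps of x and y cannot vanish together. -/
lemma exists_weylGap_pow (hI : IsOpen I) (hI0 : I ⊆ Set.Ioi 0) (hC : IsScaleFactorOn I C)
    (h2 : α₂ ≠ 0) (h21 : α₂ ≠ 1) (h12 : α₁ ≠ α₂) {t : ℝ} (ht : t ∈ I) :
    ∃ p q r : Fin 3, p ≠ q ∧ p ≠ r ∧ q ≠ r ∧ weylGap C (powFactors C α₁ α₂) p q r t ≠ 0 ∧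
      weylGap C (powFactors C α₁ α₂) q p r t ≠ 0 := by
  have t0 : t ≠ 0 := ne_of_gt (hI0 ht)
  have hr : ∀ i, ∀ t ∈ I, relHubble C (powFactors C α₁ α₂) i t
      = (1 - (![1, α₁, α₂] : Fin 3 → ℝ) i / α₂) * t⁻¹ := fun i t ht =>
    relHubble_pow hI hI0 hC α₁ h2 ht i
  have hr' : ∀ i, deriv (relHubble C (powFactors C α₁ α₂) i) t
      = (1 - (![1, α₁, α₂] : Fin 3 → ℝ) i / α₂) * -(t ^ 2)⁻¹ := fun i => by
    have e : relHubble C (powFactors C α₁ α₂) i =ᶠ[nhds t]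
        fun t => (1 - (![1, α₁, α₂] : Fin 3 → ℝ) i / α₂) * t⁻¹ := by
      filter_upwards [hI.mem_nhds ht] with t ht using hr i t ht
    rw [e.deriv_eq, ((hasDerivAt_inv t0).const_mul _).deriv]
  by_cases hg : weylGap C (powFactors C α₁ α₂) 0 1 2 t = 0
  · refine exists_two_weylGap (i := 1) (j := 0) (k := 2) (by decide) (by decide) (by decide) ?_
    intro hg'
    simp only [weylGap, hr _ _ ht, hr'] at hg hg'
    simp at hg hg'
    field_simp at hg hg'
    -- Both vanishing would give α₁ = 1 − α₂ and α₁ = 1 + α₂, hence α₂ = 0.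
    have e1 : (α₂ - α₁) * (1 - α₁ - α₂) = 0 := by
      linear_combination hg
    have e2 : (α₂ - 1) * (α₁ - 1 - α₂) = 0 := by
      linear_combination hg'
    have f1 := (mul_eq_zero.1 e1).resolve_left (sub_ne_zero.2 h12.symm)
    have f2 := (mul_eq_zero.1 e2).resolve_left (sub_ne_zero.2 h21)
    apply h2
    linarith
  · exact exists_two_weylGap (i := 0) (j := 1) (k := 2) (by decide) (by decide) (by decide) hg

/-- The exclusions make 1, α₁, α₂ distinct and give two nonzero gaps. The conformal equations then
force T to be linear in t and (l_0, l_1, l_2) to be proportional to (1, α₁, α₂). -/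
lemma admitsIff_pow (hI : IsOpen I) (hI0 : I ⊆ Set.Ioi 0) (hIc : I.OrdConnected)
    (hIne : I.Nonempty) (hJ : ∀ i, IsOpen (J i)) (hJc : ∀ i, (J i).OrdConnected)
    (hJne : ∀ i, (J i).Nonempty) (hV : ContDiffOn ℝ ∞ V (box I J)) (hC : IsScaleFactorOn I C)
    (h2 : α₂ ≠ 0) (h0 : α₁ ≠ 0) (h1 : α₁ ≠ 1) (h21 : α₂ ≠ 1) (h12 : α₁ ≠ α₂) :
    AdmitsIff (bianchiI C (powFactors C α₁ α₂)) V (box I J) (IsTranslationForm V (box I J) ∨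
      ∃ (α β γ : ℝ) (U : ℝ → ℝ → ℝ → ℝ), ∀ p ∈ box I J,
        V p = potVIII C α₁ α₂ α β γ U p) := by
  have ha := isScaleFactorOn_powFactors hC hI0 α₁ α₂
  have hF := fun α β γ => isNormalFlow_pow hI hI0 hC h2 α β γ (Or.inl h0)
  refine admitsIff_of (fun h => ?_) ?_
  · obtain ⟨t₀, ht₀⟩ := hIne
    have hp0 : ∀ t ∈ I, t ≠ 0 := fun t ht => ne_of_gt (hI0 ht)
    have hL : ¬ IsLRSOn I (powFactors C α₁ α₂) := by
      refine not_isLRSOn_of_relHubble (N := C) hI ht₀ ha fun i j hij => ?_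
      rw [relHubble_pow hI hI0 hC α₁ h2 ht₀, relHubble_pow hI hI0 hC α₁ h2 ht₀]
      intro he
      have he' : (![1, α₁, α₂] : Fin 3 → ℝ) i = (![1, α₁, α₂] : Fin 3 → ℝ) j :=
        (div_left_inj' h2).1 (sub_right_injective (mul_right_cancel₀ (inv_ne_zero (hp0 t₀ ht₀)) he))
      clear he
      fin_cases i <;> fin_cases j <;> simp at hij he' <;>
        first | exact h1 he' | exact h21 he' | exact h12 he' | exact h1 he'.symm |
          exact h21 he'.symm | exact h12 he'.symm
    obtain ⟨T, l, m, ψ, hK, hP, hne⟩ := exists_dilation_of_admitsLie hI hIc ⟨t₀, ht₀⟩ hJ hJc hJne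
      hC ha hL ⟨t₀, ht₀, exists_weylGap_pow hI hI0 hC h2 h21 h12 ht₀⟩ hV h
    have hs : ∀ t ∈ I, ∀ i, l i + (logDeriv C t + (1 - (![1, α₁, α₂] : Fin 3 → ℝ) i / α₂) / t) * T t
        = l 2 + (logDeriv C t + (1 - (![1, α₁, α₂] : Fin 3 → ℝ) 2 / α₂) / t) * T t :=
      fun t ht i => by
        rw [← logDeriv_powFactors hI hI0 hC α₁ h2 ht, ← logDeriv_powFactors hI hI0 hC α₁ h2 ht,
          hK.space t ht, hK.space t ht]
    have h21' : α₂ - 1 ≠ 0 := sub_ne_zero.2 h21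
    have hT : ∀ t ∈ I, T t = (l 2 - l 0) * α₂ / (α₂ - 1) * t := fun t ht => by
      have h3 := hs t ht 0
      have := hp0 t ht
      have h4 : (1 - 1 / α₂) / t * T t = l 2 - l 0 := by
        simp [h2] at h3 ⊢
        linear_combination h3
      field_simp at h4 ⊢
      linear_combination h4
    have hT' : deriv T t₀ = (l 2 - l 0) * α₂ / (α₂ - 1) := by
      have e : T =ᶠ[nhds t₀] fun t => (l 2 - l 0) * α₂ / (α₂ - 1) * t := by
        filter_upwards [hI.mem_nhds ht₀] with t ht using hT t ht
      rw [e.deriv_eq, ((hasDerivAt_id' t₀).const_mul _).deriv, mul_one]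
    -- Lapse and z scale factor coincide, so their two equations give T' = l_2.
    have hl2 : l 2 = (l 2 - l 0) * α₂ / (α₂ - 1) := by
      have e1 := hK.time t₀ ht₀
      have e2 := hK.space t₀ ht₀ 2
      rw [logDeriv_powFactors hI hI0 hC α₁ h2 ht₀] at e2
      simp [h2] at e2
      linear_combination e2 - e1 + hT'
    rw [← hl2] at hT
    have hl2' : l 2 = α₂ * l 0 := by
      field_simp at hl2
      linear_combination -hl2
    have hl1 : l 1 = α₁ * l 0 := by
      have h3 := hs t₀ ht₀ 1
      have := hp0 t₀ ht₀
      rw [hT t₀ ht₀, hl2'] at h3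
      simp [h2] at h3
      field_simp at h3
      linear_combination h3
    by_cases hl0 : l 0 = 0
    · left
      refine isTranslationForm_of_potentialEq hI hIc hJ hJc hV hK hP hne
        (fun t ht => by rw [hT t ht, hl2', hl0]; ring) ?_
      ext i
      fin_cases i <;> simp [hl0, hl1, hl2']
    · right
      refine ⟨m 0 / l 0, m 1 / l 0, m 2 / l 0, ?_⟩
      rw [← potentialEq_pow_iff hI hI0 hIc hJ hJc hV hC h2 _ _ _ (Or.inl h0)]
      refine PotentialEq.of_smul (s := (l 0)⁻¹) hI hK (hF 0 0 0).dilation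
        (fun t ht => ?_) (fun i => ?_) (fun i => ?_) hP
      · rw [hT t ht, hl2']; field_simp
      · fin_cases i <;> simp [hl1, hl2'] <;> field_simp
      · fin_cases i <;> simp <;> ring
  · rintro (h | ⟨α, β, γ, h⟩)
    · exact admitsNoether_of_translationForm hI hIc hIne hJ hJc hJne hC ha hV h
    · rw [← potentialEq_pow_iff hI hI0 hIc hJ hJc hV hC h2 _ _ _ (Or.inl h0)] at h
      obtain ⟨p, hp⟩ := exists_mem_box hIne hJne
      exact admitsNoether_of_potentialEq hI hJ hC ha hV (hF 0 0 0).dilation h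
        ⟨p, hp, fun h => mul_ne_zero h2 (ne_of_gt (hI0 hp.1)) (congrFun h 0)⟩

end powModel


/-! ### Potentials in adapted coordinates -/

section adapted

variable {I : Set ℝ} {J : Fin 3 → Set ℝ} {N : ℝ → ℝ} {a : Fin 3 → ℝ → ℝ} {V : Pt 4 → ℝ}
  {N' τ C : ℝ → ℝ} {a' : Fin 3 → ℝ → ℝ} {k : Fin 3 → ℝ} {σ : Equiv.Perm (Fin 3)}
  {c α₁ α₂ : ℝ}

lemma adapt_mem {p : Pt 4} (hp : p ∈ box I J) : adapt τ k σ p 0 ∈ τ '' I :=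
  Set.mem_image_of_mem τ hp.1

lemma potentialEq_exp_pullback_iff (hA : IsAdapted I N a C (expFactors C c α₁) τ k σ)
    (hI : IsOpen I) (hIc : I.OrdConnected) (hJ : ∀ i, IsOpen (J i))
    (hJc : ∀ i, (J i).OrdConnected) (hN : IsScaleFactorOn I N)
    (ha : ∀ i, IsScaleFactorOn I (a i)) (hC : IsScaleFactorOn (τ '' I) C)
    (hV : ContDiffOn ℝ ∞ V (box I J)) (hc : c ≠ 0) (h1 : α₁ ≠ 0) (α β γ : ℝ) :
    PotentialEq N a V (fun t => c / deriv τ t) (fun i => (![1, α₁, 0] : Fin 3 → ℝ) (σ.symm i))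
      (fun i => (![α, β, γ] : Fin 3 → ℝ) (σ.symm i) / k (σ.symm i))
      (fun t => c * logDeriv C (τ t)) (box I J) ↔
      ∃ U : ℝ → ℝ → ℝ → ℝ, ∀ p ∈ box I J, V p = potVI C c α₁ α β γ U (adapt τ k σ p) := by
  have hI' := isOpen_image_of_deriv_ne hI hA.1 hA.2.1
  rw [(isNormalFlow_exp hI' hC hc α β γ (Or.inl h1)).potentialEq_pullback_iff hA hI hIc hJ hJc
    hN ha hC (isScaleFactorOn_expFactors hC c α₁) hV]
  exact exists_forall_eq_congr fun p hp U => potVI_iff hI' hC hc α β γ (adapt_mem hp) (V p) U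

lemma potentialEq_pow_pullback_iff (hA : IsAdapted I N a C (powFactors C α₁ α₂) τ k σ)
    (hI : IsOpen I) (hIc : I.OrdConnected) (hJ : ∀ i, IsOpen (J i))
    (hJc : ∀ i, (J i).OrdConnected) (hN : IsScaleFactorOn I N)
    (ha : ∀ i, IsScaleFactorOn I (a i)) (hC : IsScaleFactorOn (τ '' I) C)
    (hV : ContDiffOn ℝ ∞ V (box I J)) (hτ : ∀ t ∈ I, 0 < τ t) (h2 : α₂ ≠ 0) (h1 : α₁ ≠ 0)
    (α β γ : ℝ) :
    PotentialEq N a V (fun t => α₂ * τ t / deriv τ t)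
      (fun i => (![1, α₁, α₂] : Fin 3 → ℝ) (σ.symm i))
      (fun i => (![α, β, γ] : Fin 3 → ℝ) (σ.symm i) / k (σ.symm i))
      (fun t => α₂ * (1 + τ t * logDeriv C (τ t))) (box I J) ↔
      ∃ U : ℝ → ℝ → ℝ → ℝ, ∀ p ∈ box I J, V p = potVIII C α₁ α₂ α β γ U (adapt τ k σ p) := by
  have hI' := isOpen_image_of_deriv_ne hI hA.1 hA.2.1
  have hI0 : τ '' I ⊆ Set.Ioi 0 := by rintro _ ⟨t, ht, rfl⟩; exact hτ t ht
  rw [(isNormalFlow_pow hI' hI0 hC h2 α β γ (Or.inl h1)).potentialEq_pullback_iff hA hI hIc hJ hJc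
    hN ha hC (isScaleFactorOn_powFactors hC hI0 α₁ α₂) hV]
  exact exists_forall_eq_congr fun p hp U => potVIII_iff hI' hI0 hC h2 α β γ (adapt_mem hp) (V p) U

lemma admitsNoether_of_expForm (hI : IsOpen I) (hIc : I.OrdConnected) (hIne : I.Nonempty)
    (hJ : ∀ i, IsOpen (J i)) (hJc : ∀ i, (J i).OrdConnected) (hJne : ∀ i, (J i).Nonempty)
    (hN : IsScaleFactorOn I N) (ha : ∀ i, IsScaleFactorOn I (a i))
    (hV : ContDiffOn ℝ ∞ V (box I J)) (h : IsExpForm I N a V (box I J)) :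
    AdmitsNoether (bianchiI N a) V (box I J) := by
  obtain ⟨τ, k, σ, C, c, α₁, α, β, γ, U, hc, h1, hC, hA, hU⟩ := h
  have hI' := isOpen_image_of_deriv_ne hI hA.1 hA.2.1
  obtain ⟨p, hp⟩ := exists_mem_box hIne hJne
  exact admitsNoether_of_potentialEq hI hJ hN ha hV
    (hA.dilation hI hN ha hC (isScaleFactorOn_expFactors hC c α₁)
      (isNormalFlow_exp hI' hC hc α β γ (Or.inl h1)).dilation)
    ((potentialEq_exp_pullback_iff hA hI hIc hJ hJc hN ha hC hV hc h1 α β γ).2 ⟨U, hU⟩)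
    ⟨p, hp, fun h => div_ne_zero hc (hA.2.1 _ hp.1) (congrFun h 0)⟩

lemma admitsNoether_of_powForm (hI : IsOpen I) (hIc : I.OrdConnected) (hIne : I.Nonempty)
    (hJ : ∀ i, IsOpen (J i)) (hJc : ∀ i, (J i).OrdConnected) (hJne : ∀ i, (J i).Nonempty)
    (hN : IsScaleFactorOn I N) (ha : ∀ i, IsScaleFactorOn I (a i))
    (hV : ContDiffOn ℝ ∞ V (box I J)) (h : IsPowForm I N a V (box I J)) :
    AdmitsNoether (bianchiI N a) V (box I J) := by
  obtain ⟨τ, k, σ, C, α₁, α₂, α, β, γ, U, h1, h2, hτ, hC, hA, hU⟩ := h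
  have hI' := isOpen_image_of_deriv_ne hI hA.1 hA.2.1
  have hI0 : τ '' I ⊆ Set.Ioi 0 := by rintro _ ⟨t, ht, rfl⟩; exact hτ t ht
  obtain ⟨p, hp⟩ := exists_mem_box hIne hJne
  exact admitsNoether_of_potentialEq hI hJ hN ha hV
    (hA.dilation hI hN ha hC (isScaleFactorOn_powFactors hC hI0 α₁ α₂)
      (isNormalFlow_pow hI' hI0 hC h2 α β γ (Or.inl h1)).dilation)
    ((potentialEq_pow_pullback_iff hA hI hIc hJ hJc hN ha hC hV hτ h2 h1 α β γ).2 ⟨U, hU⟩)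
    ⟨p, hp, fun h => div_ne_zero (mul_ne_zero h2 (hτ _ hp.1).ne') (hA.2.1 _ hp.1) (congrFun h 0)⟩

/-! ### Construction of adapted coordinates -/

lemma eq_of_hasDerivAt_zero {f : ℝ → ℝ} (hI : IsOpen I) (hIc : I.OrdConnected)
    (h : ∀ t ∈ I, HasDerivAt f 0 t) {s t : ℝ} (hs : s ∈ I) (ht : t ∈ I) : f s = f t := by
  refine hIc.convex.is_const_of_fderivWithin_eq_zero (𝕜 := ℝ)
    (fun s hs => (h s hs).differentiableAt.differentiableWithinAt) (fun s hs => ?_) hs ht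
  have h3 := (h s hs).hasFDerivAt.hasFDerivWithinAt (s := I)
  rw [h3.fderivWithin (hI.uniqueDiffWithinAt hs)]
  ext; simp

lemma exists_mul_of_logDeriv_eq {f g : ℝ → ℝ} (hI : IsOpen I) (hIc : I.OrdConnected)
    (hIne : I.Nonempty) (hf : IsScaleFactorOn I f) (hg : IsScaleFactorOn I g)
    (h : ∀ t ∈ I, logDeriv f t = logDeriv g t) : ∃ k : ℝ, k ≠ 0 ∧ ∀ t ∈ I, f t = k * g t := by
  obtain ⟨t₀, ht₀⟩ := hIne
  refine ⟨f t₀ / g t₀, div_ne_zero (hf.2 _ ht₀) (hg.2 _ ht₀), fun t ht => ?_⟩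
  have := eq_of_hasDerivAt_zero hI hIc (f := fun t => f t / g t) (fun s hs => by
    simpa [h s hs] using hasDerivAt_ratio hI hf hg hs) ht₀ ht
  rw [this, div_mul_cancel₀ _ (hg.2 t ht)]

/-- A continuous derivative without zeros has one sign on an interval. -/
lemma injOn_of_deriv_ne (hI : IsOpen I) (hIc : I.OrdConnected) (hτ : ContDiffOn ℝ ∞ τ I)
    (h0 : ∀ t ∈ I, deriv τ t ≠ 0) : Set.InjOn τ I := by
  have hi : interior I = I := hI.interior_eq
  rcases pos_or_neg_of_ne_zero hIc (smooth_deriv hI hτ).continuousOn h0 with h | h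
  · exact (strictMonoOn_of_deriv_pos hIc.convex hτ.continuousOn (by rwa [hi])).injOn
  · exact (strictAntiOn_of_deriv_neg hIc.convex hτ.continuousOn (by rwa [hi])).injOn

/-- A scale factor as a function of a new time. -/
lemma exists_comp_eq {f : ℝ → ℝ} (hI : IsOpen I) (hIc : I.OrdConnected)
    (hτ : ContDiffOn ℝ ∞ τ I) (h0 : ∀ t ∈ I, deriv τ t ≠ 0) (hf : IsScaleFactorOn I f) :
    ∃ C, IsScaleFactorOn (τ '' I) C ∧ ∀ t ∈ I, C (τ t) = f t := by
  have hinj := injOn_of_deriv_ne hI hIc hτ h0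
  have hC : ∀ t ∈ I, f (Function.invFunOn τ I (τ t)) = f t := fun t ht => by
    rw [hinj.leftInvOn_invFunOn ht]
  refine ⟨fun s => f (Function.invFunOn τ I s), ⟨?_, ?_⟩, hC⟩
  · rintro _ ⟨t, ht, rfl⟩
    refine ContDiffAt.contDiffWithinAt ?_
    have hct : ContDiffAt ℝ ∞ τ t := hτ.contDiffAt (hI.mem_nhds ht)
    have hd : HasStrictDerivAt τ (deriv τ t) t := hct.hasStrictDerivAt (by simp)
    -- The chosen inverse is not visibly smooth. Near each point its composition with `f` agrees
    -- with that of the smooth local inverse from the inverse function theorem.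
    set e : ℝ ≃L[ℝ] ℝ := ContinuousLinearEquiv.unitsEquivAut ℝ (Units.mk0 _ (h0 t ht)) with he
    have hd' : HasStrictFDerivAt τ (e : ℝ →L[ℝ] ℝ) t := hd.hasStrictFDerivAt_equiv (h0 t ht)
    have hL : ContDiffAt ℝ ∞ (hd'.localInverse τ e t) (τ t) :=
      hct.to_localInverse hd'.hasFDerivAt (by simp)
    have hLt : hd'.localInverse τ e t (τ t) = t := hd'.localInverse_apply_image
    have hfL : ContDiffAt ℝ ∞ (fun s => f (hd'.localInverse τ e t s)) (τ t) :=
      ContDiffAt.comp (τ t) (by rw [hLt]; exact hf.1.contDiffAt (hI.mem_nhds ht)) hL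
    refine hfL.congr_of_eventuallyEq ?_
    have hm : ∀ᶠ s in nhds (τ t), hd'.localInverse τ e t s ∈ I :=
      hL.continuousAt.eventually_mem (by rw [hLt]; exact hI.mem_nhds ht)
    filter_upwards [hd'.eventually_right_inverse, hm] with s hs hs'
    rw [← hC _ hs', hs]
  · rintro _ ⟨t, ht, rfl⟩
    exact (hC t ht).trans_ne (hf.2 t ht)

lemma isScaleFactorOn_comp {f : ℝ → ℝ} (hτ : ContDiffOn ℝ ∞ τ I)
    (hf : IsScaleFactorOn (τ '' I) f) : IsScaleFactorOn I (fun t => f (τ t)) :=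
  ⟨hf.1.comp hτ fun _ ht => Set.mem_image_of_mem τ ht,
    fun _ ht => hf.2 _ (Set.mem_image_of_mem τ ht)⟩

lemma logDeriv_comp_time {f : ℝ → ℝ} (hI : IsOpen I) (hτ : ContDiffOn ℝ ∞ τ I)
    (h0 : ∀ t ∈ I, deriv τ t ≠ 0) (hf : IsScaleFactorOn (τ '' I) f) {t : ℝ} (ht : t ∈ I) :
    logDeriv (fun t => f (τ t)) t = logDeriv f (τ t) * deriv τ t :=
  logDeriv_comp (f := f) (g := τ)
    (hf.diff (isOpen_image_of_deriv_ne hI hτ h0) (Set.mem_image_of_mem τ ht))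
    (differentiableAt_of_smooth hI hτ ht)

/-- Equal logarithmic derivatives give proportional scale factors; the constants of proportionality
are the rescalings k_i of the axes. -/
lemma exists_isAdapted (hI : IsOpen I) (hIc : I.OrdConnected) (hIne : I.Nonempty)
    (ha : ∀ i, IsScaleFactorOn I (a i)) (ha' : ∀ i, IsScaleFactorOn (τ '' I) (a' i))
    (hτ : ContDiffOn ℝ ∞ τ I) (h0 : ∀ t ∈ I, deriv τ t ≠ 0)
    (hsq : ∀ t ∈ I, N t ^ 2 = (N' (τ t) * deriv τ t) ^ 2)
    (h : ∀ t ∈ I, ∀ i, logDeriv (a (σ i)) t = logDeriv (a' i) (τ t) * deriv τ t) :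
    ∃ k, IsAdapted I N a N' a' τ k σ := by
  have := fun i => exists_mul_of_logDeriv_eq hI hIc hIne (ha (σ i))
    (isScaleFactorOn_comp hτ (ha' i)) fun t ht => by
      rw [h t ht i, logDeriv_comp_time hI hτ h0 (ha' i) ht]
  choose k hk hk' using this
  exact ⟨k, hτ, h0, hk, fun t ht => ⟨hsq t ht, fun i => by rw [hk' i t ht]⟩⟩

end adapted


/-! ### Normal forms of dilations and completeness -/

section completeness

variable {I : Set ℝ} {J : Fin 3 → Set ℝ} {N : ℝ → ℝ} {a : Fin 3 → ℝ → ℝ} {V : Pt 4 → ℝ}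
  {T ψ : ℝ → ℝ} {l m : Fin 3 → ℝ}

lemma IsDilation.sub_space (hK : IsDilation I N a T l ψ) {t : ℝ} (ht : t ∈ I) (i j : Fin 3) :
    l i - l j + (relHubble N a i t - relHubble N a j t) * T t = 0 := by
  unfold relHubble
  linear_combination hK.space t ht i - hK.space t ht j

/-- `(T N / aᵢ)' = lᵢ N / aᵢ`. -/
lemma IsDilation.hasDerivAt_mul (hK : IsDilation I N a T l ψ) (hI : IsOpen I)
    (hN : IsScaleFactorOn I N) (ha : ∀ i, IsScaleFactorOn I (a i)) {t : ℝ} (ht : t ∈ I)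
    (i : Fin 3) : HasDerivAt (fun t => T t * (N t / a i t)) (l i * (N t / a i t)) t := by
  have h1 := (differentiableAt_of_smooth hI hK.smooth_T ht).hasDerivAt
  refine (h1.mul (hasDerivAt_ratio hI hN (ha i) ht)).congr_deriv ?_
  linear_combination (N t / a i t) * (hK.time t ht - hK.space t ht i)

/-- A zero of T at t₀ makes all l_i equal. Near a time where two rates differ, T must then vanish,
so ψ and all l_i are 0. Hence TN/a_0 is constant, and its value at t₀ is 0. -/
lemma IsDilation.forall_ne_zero (hK : IsDilation I N a T l ψ) (hI : IsOpen I)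
    (hIc : I.OrdConnected) (hN : IsScaleFactorOn I N) (ha : ∀ i, IsScaleFactorOn I (a i))
    (hL : ¬ IsLRSOn I a) (hT : ¬ ∀ t ∈ I, T t = 0) : ∀ t ∈ I, T t ≠ 0 := by
  intro t₀ ht₀ h0
  apply hT
  obtain ⟨t₁, ht₁, hne⟩ := exists_relHubble_ne (N := N) hI hIc ⟨t₀, ht₀⟩ ha hL
    (show (0 : Fin 3) ≠ 1 by decide)
  have hl : ∀ i, l i = ψ t₀ := fun i => by
    have := hK.space t₀ ht₀ i
    rwa [h0, mul_zero, add_zero] at this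
  have hT1 : T =ᶠ[nhds t₁] fun _ => 0 := by
    have hc : ContinuousAt (fun t => relHubble N a 0 t - relHubble N a 1 t) t₁ :=
      (differentiableAt_of_smooth hI ((smooth_relHubble hI hN ha 0).sub
        (smooth_relHubble hI hN ha 1)) ht₁).continuousAt
    filter_upwards [hI.mem_nhds ht₁, hc.eventually_ne (sub_ne_zero.2 hne)] with t ht hn
    have := hK.sub_space ht 0 1
    rw [hl, hl, sub_self, zero_add] at this
    exact (mul_eq_zero.1 this).resolve_left hn
  have hψ : ψ t₁ = 0 := by
    rw [← hK.time t₁ ht₁, hT1.deriv_eq, hT1.eq_of_nhds]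
    simp
  have hl0 : l 0 = 0 := by
    have := hK.space t₁ ht₁ 0
    rwa [hT1.eq_of_nhds, mul_zero, add_zero, hψ] at this
  intro t ht
  have := eq_of_hasDerivAt_zero hI hIc (f := fun t => T t * (N t / a 0 t))
    (fun s hs => by simpa [hl0] using hK.hasDerivAt_mul hI hN ha hs 0) ht ht₀
  simp only [h0, zero_mul] at this
  exact (mul_eq_zero.1 this).resolve_right (div_ne_zero (hN.2 t ht) ((ha 0).2 t ht))

/-- Different rates with T ≠ 0 need different weights; hence at most one weight vanishes. -/
lemma IsDilation.ne_of_ne (hK : IsDilation I N a T l ψ) (hI : IsOpen I) (hIc : I.OrdConnected)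
    (hIne : I.Nonempty) (ha : ∀ i, IsScaleFactorOn I (a i)) (hL : ¬ IsLRSOn I a)
    (hT : ∀ t ∈ I, T t ≠ 0) {i j : Fin 3} (hij : i ≠ j) : l i ≠ l j := by
  obtain ⟨t, ht, hne⟩ := exists_relHubble_ne (N := N) hI hIc hIne ha hL hij
  intro h
  have := hK.sub_space ht i j
  rw [h, sub_self, zero_add] at this
  exact (mul_ne_zero (sub_ne_zero.2 hne) (hT t ht)) this

/-- For l_i = 0 the quantity TN/a_i is a constant c₀. In a time with τ' = c₀/T the lapse becomes
±a_i, the field has constant time component, and the ratios of the other scale factors to a_i are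
exponentials. -/
lemma isExpForm_of_dilation (hI : IsOpen I) (hIc : I.OrdConnected) (hIne : I.Nonempty)
    (hJ : ∀ i, IsOpen (J i)) (hJc : ∀ i, (J i).OrdConnected) (hN : IsScaleFactorOn I N)
    (ha : ∀ i, IsScaleFactorOn I (a i)) (hL : ¬ IsLRSOn I a) (hV : ContDiffOn ℝ ∞ V (box I J))
    (hK : IsDilation I N a T l ψ) (hP : PotentialEq N a V T l m ψ (box I J))
    (hT : ∀ t ∈ I, T t ≠ 0) {i : Fin 3} (hi : l i = 0) : IsExpForm I N a V (box I J) := by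
  -- The axis of vanishing weight becomes z.
  set σ : Equiv.Perm (Fin 3) := Equiv.swap 2 i with hσ
  have hs2 : σ 2 = i := Equiv.swap_apply_left 2 i
  have hl0 : l (σ 0) ≠ 0 := by
    rw [← hi, ← hs2]
    exact hK.ne_of_ne hI hIc hIne ha hL hT (σ.injective.ne (by decide))
  have hl1 : l (σ 1) ≠ 0 := by
    rw [← hi, ← hs2]
    exact hK.ne_of_ne hI hIc hIne ha hL hT (σ.injective.ne (by decide))
  obtain ⟨t₀, ht₀⟩ := hIne
  set c₀ := T t₀ * (N t₀ / a i t₀) with hc₀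
  have hTc : ∀ t ∈ I, T t * (N t / a i t) = c₀ := fun t ht =>
    eq_of_hasDerivAt_zero hI hIc (f := fun t => T t * (N t / a i t))
      (fun s hs => by simpa [hi] using hK.hasDerivAt_mul hI hN ha hs i) ht ht₀
  have hc0 : c₀ ≠ 0 := mul_ne_zero (hT _ ht₀) (div_ne_zero (hN.2 _ ht₀) ((ha i).2 _ ht₀))
  -- The first weight is to become 1, which divides the time component c₀ by it.
  set c := c₀ / l (σ 0) with hc
  have hcne : c ≠ 0 := div_ne_zero hc0 hl0
  -- Solves |a_{σ0}/a_i| = e^{−τ/c} for the new time.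
  set τ : ℝ → ℝ := fun t => -c * Real.log (a (σ 0) t / a i t) with hτ
  have hq : ∀ t ∈ I, a (σ 0) t / a i t ≠ 0 := fun t ht =>
    div_ne_zero ((ha _).2 t ht) ((ha i).2 t ht)
  have hτs : ContDiffOn ℝ ∞ τ I :=
    contDiffOn_const.mul (((ha _).1.div (ha i).1 (ha i).2).log hq)
  have hτd : ∀ t ∈ I, deriv τ t = c₀ / T t := fun t ht => by
    have h1 : HasDerivAt τ _ t :=
      ((hasDerivAt_ratio hI (ha (σ 0)) (ha i) ht).log (hq t ht)).const_mul (-c)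
    have h2 := hK.sub_space ht (σ 0) i
    rw [h1.deriv, mul_div_assoc, div_self (hq t ht), mul_one]
    have := hT t ht
    unfold relHubble at h2
    rw [hi] at h2
    simp only [hc]
    field_simp
    linear_combination -h2
  have h0 : ∀ t ∈ I, deriv τ t ≠ 0 := fun t ht => by
    rw [hτd t ht]; exact div_ne_zero hc0 (hT t ht)
  obtain ⟨C, hC, hCeq⟩ := exists_comp_eq hI hIc hτs h0 (ha i)
  set α₁ := l (σ 1) / l (σ 0) with hα₁
  have hα₁0 : α₁ ≠ 0 := div_ne_zero hl1 hl0
  have hI' := isOpen_image_of_deriv_ne hI hτs h0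
  have hCd : ∀ t ∈ I, logDeriv (a i) t = logDeriv C (τ t) * deriv τ t := fun t ht => by
    rw [← logDeriv_comp_time hI hτs h0 hC ht, logDeriv_apply, logDeriv_apply]
    have e : (fun t => C (τ t)) =ᶠ[nhds t] a i := by
      filter_upwards [hI.mem_nhds ht] with s hs using hCeq s hs
    rw [e.deriv_eq, hCeq t ht]
  have hlj : ∀ j, (![1, α₁, 0] : Fin 3 → ℝ) j = l (σ j) / l (σ 0) := fun j => by
    fin_cases j
    · simp [hl0]
    · simp [hα₁]
    · simp [hs2, hi]
  obtain ⟨k, hA⟩ := exists_isAdapted (N := N) (N' := C) (σ := σ) hI hIc ⟨t₀, ht₀⟩ ha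
    (isScaleFactorOn_expFactors hC c α₁) hτs h0 (fun t ht => by
      rw [hCeq t ht, hτd t ht, ← hTc t ht]
      have := hT t ht
      have := (ha i).2 t ht
      field_simp) (fun t ht j => by
      rw [logDeriv_expFactors hI' hC c α₁ (Set.mem_image_of_mem τ ht), sub_mul, ← hCd t ht,
        hlj, hτd t ht, hc]
      have h2 := hK.sub_space ht (σ j) i
      unfold relHubble at h2
      rw [hi] at h2
      have := hT t ht
      field_simp
      linear_combination h2)
  have hk := hA.2.2.1
  have hF := isNormalFlow_exp hI' hC hcne 0 0 0 (Or.inl hα₁0)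
  have hK' := hA.dilation hI hN ha hC (isScaleFactorOn_expFactors hC c α₁) hF.dilation
  have hP' : PotentialEq N a V (fun t => c / deriv τ t)
      (fun i => (![1, α₁, 0] : Fin 3 → ℝ) (σ.symm i))
      (fun i => (![k 0 * m (σ 0) / l (σ 0), k 1 * m (σ 1) / l (σ 0), k 2 * m (σ 2) / l (σ 0)] :
        Fin 3 → ℝ) (σ.symm i) / k (σ.symm i)) (fun t => c * logDeriv C (τ t)) (box I J) := by
    refine PotentialEq.of_smul (s := (l (σ 0))⁻¹) hI hK hK' (fun t ht => ?_) (fun j => ?_)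
      (fun j => ?_) hP
    · have := hT t ht
      rw [hτd t ht, hc]
      field_simp
    · rw [hlj, Equiv.apply_symm_apply]; ring
    · obtain ⟨j, rfl⟩ := σ.surjective j
      rw [Equiv.symm_apply_apply]
      have := hk j
      fin_cases j <;> simp at this ⊢ <;> field_simp
  obtain ⟨U, hU⟩ := (potentialEq_exp_pullback_iff hA hI hIc hJ hJc hN ha hC hV hcne hα₁0
    _ _ _).1 hP'
  exact ⟨τ, k, σ, C, c, α₁, _, _, _, U, hcne, hα₁0, hC, hA, hU⟩

/-- Since (TN/a_2)' = l_2N/a_2, the function τ = ±TN/(l_2a_2) satisfies τ' = ±N/a_2 = l_2τ/T. As a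
time it makes the lapse ±a_2 and the ratios of scale factors powers of τ. -/
lemma isPowForm_of_dilation (hI : IsOpen I) (hIc : I.OrdConnected) (hIne : I.Nonempty)
    (hJ : ∀ i, IsOpen (J i)) (hJc : ∀ i, (J i).OrdConnected) (hN : IsScaleFactorOn I N)
    (ha : ∀ i, IsScaleFactorOn I (a i)) (hV : ContDiffOn ℝ ∞ V (box I J))
    (hK : IsDilation I N a T l ψ) (hP : PotentialEq N a V T l m ψ (box I J))
    (hT : ∀ t ∈ I, T t ≠ 0) (hl : ∀ i, l i ≠ 0) : IsPowForm I N a V (box I J) := by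
  have hg : ∀ t ∈ I, N t / a 2 t ≠ 0 := fun t ht => div_ne_zero (hN.2 t ht) ((ha 2).2 t ht)
  have hgs : ContDiffOn ℝ ∞ (fun t => T t * (N t / a 2 t)) I :=
    hK.smooth_T.mul (hN.1.div (ha 2).1 (ha 2).2)
  -- The sign `s` makes the new time positive; it drops out of the squared lapse.
  obtain ⟨s, hs1, hs⟩ : ∃ s : ℝ, s ^ 2 = 1 ∧ ∀ t ∈ I, 0 < s / l 2 * (T t * (N t / a 2 t)) := by
    rcases pos_or_neg_of_ne_zero (f := fun t => T t * (N t / a 2 t) / l 2) hIc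
      (hgs.continuousOn.div_const _)
      (fun t ht => div_ne_zero (mul_ne_zero (hT t ht) (hg t ht)) (hl 2)) with h | h
    · refine ⟨1, by norm_num, fun t ht => (h t ht).trans_eq (by ring)⟩
    · refine ⟨-1, by norm_num, fun t ht => (neg_pos.2 (h t ht)).trans_eq (by ring)⟩
  have hs0 : s ≠ 0 := by rintro rfl; norm_num at hs1
  set τ : ℝ → ℝ := fun t => s / l 2 * (T t * (N t / a 2 t)) with hτ
  have hl2 := hl 2
  have hl0 := hl 0
  have hτ0 : ∀ t ∈ I, 0 < τ t := hs
  have hτs : ContDiffOn ℝ ∞ τ I := contDiffOn_const.mul hgs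
  have hτd : ∀ t ∈ I, deriv τ t = s * (N t / a 2 t) := fun t ht => by
    have h1 : HasDerivAt τ _ t := (hK.hasDerivAt_mul hI hN ha ht 2).const_mul (s / l 2)
    rw [h1.deriv]
    field_simp
  have hτ' : ∀ t ∈ I, deriv τ t = l 2 * τ t / T t := fun t ht => by
    have := hT t ht
    rw [hτd t ht]
    simp only [hτ]
    field_simp
  have h0 : ∀ t ∈ I, deriv τ t ≠ 0 := fun t ht => by
    rw [hτd t ht]; exact mul_ne_zero hs0 (hg t ht)
  obtain ⟨C, hC, hCeq⟩ := exists_comp_eq hI hIc hτs h0 (ha 2)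
  set α₁ := l 1 / l 0 with hα₁
  set α₂ := l 2 / l 0 with hα₂
  have hα₁0 : α₁ ≠ 0 := div_ne_zero (hl 1) hl0
  have hα₂0 : α₂ ≠ 0 := div_ne_zero hl2 hl0
  have hI' := isOpen_image_of_deriv_ne hI hτs h0
  have hI0 : τ '' I ⊆ Set.Ioi 0 := by rintro _ ⟨t, ht, rfl⟩; exact hs t ht
  have hCd : ∀ t ∈ I, logDeriv (a 2) t = logDeriv C (τ t) * deriv τ t := fun t ht => by
    rw [← logDeriv_comp_time hI hτs h0 hC ht, logDeriv_apply, logDeriv_apply]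
    have e : (fun t => C (τ t)) =ᶠ[nhds t] a 2 := by
      filter_upwards [hI.mem_nhds ht] with s hs using hCeq s hs
    rw [e.deriv_eq, hCeq t ht]
  have hlj : ∀ j, (![1, α₁, α₂] : Fin 3 → ℝ) j = l j / l 0 := fun j => by
    fin_cases j
    · simp [hl0]
    · simp [hα₁]
    · simp [hα₂]
  obtain ⟨k, hA⟩ := exists_isAdapted (N := N) (N' := C) (σ := 1) hI hIc hIne ha
    (isScaleFactorOn_powFactors hC hI0 α₁ α₂) hτs h0 (fun t ht => by
      rw [hCeq t ht, hτd t ht]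
      have := (ha 2).2 t ht
      field_simp
      rw [hs1, mul_one]) (fun t ht j => by
      rw [logDeriv_powFactors hI' hI0 hC α₁ hα₂0 (Set.mem_image_of_mem τ ht), add_mul,
        ← hCd t ht, hlj, hτ' t ht, hα₂]
      have h2 := hK.sub_space ht j 2
      unfold relHubble at h2
      have := hT t ht
      have : τ t ≠ 0 := (hτ0 t ht).ne'
      rw [Equiv.Perm.one_apply]
      clear_value τ
      field_simp
      linear_combination h2)
  have hk := hA.2.2.1
  have hF := isNormalFlow_pow hI' hI0 hC hα₂0 0 0 0 (Or.inl hα₁0)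
  have hK' := hA.dilation hI hN ha hC (isScaleFactorOn_powFactors hC hI0 α₁ α₂) hF.dilation
  have hP' : PotentialEq N a V (fun t => α₂ * τ t / deriv τ t)
      (fun i => (![1, α₁, α₂] : Fin 3 → ℝ) ((1 : Equiv.Perm (Fin 3)).symm i))
      (fun i => (![k 0 * m 0 / l 0, k 1 * m 1 / l 0, k 2 * m 2 / l 0] :
        Fin 3 → ℝ) ((1 : Equiv.Perm (Fin 3)).symm i) / k ((1 : Equiv.Perm (Fin 3)).symm i))
      (fun t => α₂ * (1 + τ t * logDeriv C (τ t))) (box I J) := by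
    refine PotentialEq.of_smul (s := (l 0)⁻¹) hI hK hK' (fun t ht => ?_) (fun j => ?_)
      (fun j => ?_) hP
    · have := hT t ht
      have : τ t ≠ 0 := (hτ0 t ht).ne'
      rw [hτ' t ht, hα₂]
      field_simp
    · rw [hlj, show (1 : Equiv.Perm (Fin 3)).symm j = j from rfl]; ring
    · rw [show (1 : Equiv.Perm (Fin 3)).symm j = j from rfl]
      have := hk j
      fin_cases j <;> simp at this ⊢ <;> field_simp
  obtain ⟨U, hU⟩ := (potentialEq_pow_pullback_iff hA hI hIc hJ hJc hN ha hC hV hs hα₂0 hα₁0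
    _ _ _).1 hP'
  exact ⟨τ, k, 1, C, α₁, α₂, _, _, _, U, hα₁0, hα₂0, hs, hC, hA, hU⟩

/-- Three cases: T vanishes identically, T has no zero and some weight vanishes, T has no zero and
no weight vanishes. They give the translation, exponential and power-law forms. -/
lemma admitsIff_bianchiI (hI : IsOpen I) (hIc : I.OrdConnected) (hIne : I.Nonempty)
    (hJ : ∀ i, IsOpen (J i)) (hJc : ∀ i, (J i).OrdConnected) (hJne : ∀ i, (J i).Nonempty)
    (hN : IsScaleFactorOn I N) (ha : ∀ i, IsScaleFactorOn I (a i))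
    (hV : ContDiffOn ℝ ∞ V (box I J)) (hL : ¬ IsLRSOn I a)
    (hW : ¬ ConformallyFlatOn (bianchiI N a) (box I J)) :
    AdmitsIff (bianchiI N a) V (box I J) (IsTranslationForm V (box I J) ∨
      IsExpForm I N a V (box I J) ∨ IsPowForm I N a V (box I J)) := by
  refine admitsIff_of (fun h => ?_) ?_
  · obtain ⟨T, l, m, ψ, hK, hP, hne⟩ := exists_dilation_of_admitsLie hI hIc hIne hJ hJc hJne hN ha
      hL (exists_weylGap_of_not_flat hI hJ hN ha hW) hV h
    by_cases hT : ∀ t ∈ I, T t = 0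
    · left
      refine isTranslationForm_of_potentialEq hI hIc hJ hJc hV hK hP hne hT ?_
      -- With T = 0 the time equation gives ψ = 0, and the spatial equations give l = 0.
      obtain ⟨t, ht⟩ := hIne
      have e : T =ᶠ[nhds t] fun _ => 0 := by
        filter_upwards [hI.mem_nhds ht] with s hs using hT s hs
      have hψ := hK.time t ht
      rw [e.deriv_eq, hT t ht] at hψ
      ext i
      have := hK.space t ht i
      rw [hT t ht, ← hψ] at this
      simpa using this
    · have hT' := hK.forall_ne_zero hI hIc hN ha hL hT
      right
      by_cases hl : ∃ i, l i = 0
      · obtain ⟨i, hi⟩ := hl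
        exact Or.inl (isExpForm_of_dilation hI hIc hIne hJ hJc hN ha hL hV hK hP hT' hi)
      · exact Or.inr (isPowForm_of_dilation hI hIc hIne hJ hJc hN ha hV hK hP hT'
          (not_exists.1 hl))
  · rintro (h | h | h)
    · exact admitsNoether_of_translationForm hI hIc hIne hJ hJc hJne hN ha hV h
    · exact admitsNoether_of_expForm hI hIc hIne hJ hJc hJne hN ha hV h
    · exact admitsNoether_of_powForm hI hIc hIne hJ hJc hJne hN ha hV h

end completeness
end KleinGordon

open KleinGordon in
theorem mainTheorem1
    (I : Set ℝ) (J : Fin 3 → Set ℝ)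
    (hI : IsOpen I) (hIc : I.OrdConnected) (hIne : I.Nonempty)
    (hJ : ∀ i, IsOpen (J i)) (hJc : ∀ i, (J i).OrdConnected) (hJne : ∀ i, (J i).Nonempty)
    (V : Pt 4 → ℝ) (hV : ContDiffOn ℝ ∞ V (box I J)) :
    -- a general Bianchi I line element
    (∀ (N : ℝ → ℝ) (a : Fin 3 → ℝ → ℝ), IsScaleFactorOn I N → (∀ i, IsScaleFactorOn I (a i)) →
      SymmetryIff (bianchiI N a) V (box I J) (conformalLift (transl 1 0 0) 0)
          (∃ U : ℝ → ℝ → ℝ → ℝ, ∀ p ∈ box I J, V p = U (p 0) (p 2) (p 3)) ∧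
      SymmetryIff (bianchiI N a) V (box I J) (conformalLift (transl 0 1 0) 0)
          (∃ U : ℝ → ℝ → ℝ → ℝ, ∀ p ∈ box I J, V p = U (p 0) (p 1) (p 3)) ∧
      SymmetryIff (bianchiI N a) V (box I J) (conformalLift (transl 0 0 1) 0)
          (∃ U : ℝ → ℝ → ℝ → ℝ, ∀ p ∈ box I J, V p = U (p 0) (p 1) (p 2)) ∧
      (∀ α β γ : ℝ, α ≠ 0 →
        SymmetryIff (bianchiI N a) V (box I J) (conformalLift (transl α β γ) 0)
          (∃ U : ℝ → ℝ → ℝ → ℝ, ∀ p ∈ box I J, V p = potIV α β γ U p)) ∧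
      (¬ IsLRSOn I a → ¬ ConformallyFlatOn (bianchiI N a) (box I J) →
        AdmitsIff (bianchiI N a) V (box I J)
          (IsTranslationForm V (box I J) ∨ IsExpForm I N a V (box I J) ∨
            IsPowForm I N a V (box I J)))) ∧
    -- the line element `C² [-dt² + e^{-2t/c} dx² + e^{-2α₁t/c} dy² + dz²]`
    (∀ (C : ℝ → ℝ) (c α₁ : ℝ), IsScaleFactorOn I C → c ≠ 0 →
      IsCKVOn (bianchiI C (expFactors C c α₁)) (box I J) (X₁ c α₁) (ψ₁ C c) ∧
      SymmetryIff (bianchiI C (expFactors C c α₁)) V (box I J)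
          (conformalLift (X₁ c α₁) (ψ₁ C c))
          (∃ U : ℝ → ℝ → ℝ → ℝ, ∀ p ∈ box I J, V p = potV C c α₁ U p) ∧
      (α₁ ≠ 0 → ∀ α β γ : ℝ,
        SymmetryIff (bianchiI C (expFactors C c α₁)) V (box I J)
          (conformalLift (X₁ c α₁ + transl α β γ) (ψ₁ C c))
          (∃ U : ℝ → ℝ → ℝ → ℝ, ∀ p ∈ box I J, V p = potVI C c α₁ α β γ U p)) ∧
      (α₁ ≠ 0 → α₁ ≠ 1 →
        AdmitsIff (bianchiI C (expFactors C c α₁)) V (box I J)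
          (IsTranslationForm V (box I J) ∨
            ∃ (α β γ : ℝ) (U : ℝ → ℝ → ℝ → ℝ), ∀ p ∈ box I J,
              V p = potVI C c α₁ α β γ U p))) ∧
    -- the line element `C² [-dt² + t^{2(α₂-1)/α₂} dx² + t^{2(α₂-α₁)/α₂} dy² + dz²]`, `t > 0`
    (∀ (C : ℝ → ℝ) (α₁ α₂ : ℝ), IsScaleFactorOn I C → I ⊆ Set.Ioi 0 → α₂ ≠ 0 →
      IsCKVOn (bianchiI C (powFactors C α₁ α₂)) (box I J) (X₂ α₁ α₂) (ψ₂ C α₂) ∧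
      SymmetryIff (bianchiI C (powFactors C α₁ α₂)) V (box I J)
          (conformalLift (X₂ α₁ α₂) (ψ₂ C α₂))
          (∃ U : ℝ → ℝ → ℝ → ℝ, ∀ p ∈ box I J, V p = potVII C α₁ α₂ U p) ∧
      (α₁ ≠ 0 → ∀ α β γ : ℝ,
        SymmetryIff (bianchiI C (powFactors C α₁ α₂)) V (box I J)
          (conformalLift (X₂ α₁ α₂ + transl α β γ) (ψ₂ C α₂))
          (∃ U : ℝ → ℝ → ℝ → ℝ, ∀ p ∈ box I J, V p = potVIII C α₁ α₂ α β γ U p)) ∧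
      (α₁ ≠ 0 → α₁ ≠ 1 → α₂ ≠ 1 → α₁ ≠ α₂ →
        AdmitsIff (bianchiI C (powFactors C α₁ α₂)) V (box I J)
          (IsTranslationForm V (box I J) ∨
            ∃ (α β γ : ℝ) (U : ℝ → ℝ → ℝ → ℝ), ∀ p ∈ box I J,
              V p = potVIII C α₁ α₂ α β γ U p))) := by
  refine ⟨fun N a hN ha => ⟨symmetryIff_x hI hIc hJ hJc hN ha hV,
    symmetryIff_y hI hIc hJ hJc hN ha hV, symmetryIff_z hI hIc hJ hJc hN ha hV,
    fun α β γ hα => symmetryIff_transl hI hIc hJ hJc hN ha hV α β γ hα,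
    fun hL hW => admitsIff_bianchiI hI hIc hIne hJ hJc hJne hN ha hV hL hW⟩,
    fun C c α₁ hC hc => ⟨isCKVOn_exp hI hC hc, ?_,
      fun h1 α β γ => symmetryIff_exp hI hIc hJ hJc hV hC hc α β γ (Or.inl h1),
      fun h0 h1 => admitsIff_exp hI hIc hIne hJ hJc hJne hV hC hc h0 h1⟩,
    fun C α₁ α₂ hC hI0 h2 => ⟨isCKVOn_pow hI hI0 hC h2, ?_,
      fun h1 α β γ => symmetryIff_pow hI hI0 hIc hJ hJc hV hC h2 α β γ (Or.inl h1),
      fun h0 h1 h21 h12 =>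
        admitsIff_pow hI hI0 hIc hIne hJ hJc hJne hV hC h2 h0 h1 h21 h12⟩⟩
  -- The fields X₁ and X₂ themselves are the cases of zero translation, where α₁ = 0 is admissible.
  · simpa only [potV_eq, transl_zero, add_zero] using
      symmetryIff_exp hI hIc hJ hJc hV hC hc 0 0 0 (Or.inr rfl)
  · simpa only [potVII_eq, transl_zero, add_zero] using
      symmetryIff_pow hI hI0 hIc hJ hJc hV hC h2 0 0 0 (Or.inr rfl)
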